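/- Let $M$ be an oriented closed connected (topological) $n$-manifold with fundamental group $\Gamma=\pi_1(M)$ and universal covering $\pi\colon\widetilde M\to M$. A *standard $\Gamma$-space* $\alpha=\Gamma\curvearrowright(X,\mu)$ is a standard Borel probability space with a measurable $\mu$-preserving left $\Gamma$-action. More generally, for any probability space $(X,\mu)$ with such an action let $L^\infty(X,\mu;\mathbb Z)$ be the group of classes of essentially bounded measurable functions $X\to\mathbb Z$, with the right $\Gamma$-action $(f\cdot g)(x)=f(gx)$, and let $C_*(M;\alpha)=L^\infty(X,\mu;\mathbb Z)\otimes_{\mathbb Z\Gamma}C_*(\widetilde M;\mathbb Z)$. The norm of a chain written in reduced form $\sum_j f_j\otimes\sigma_j$ (i.e. the singular simplices $\pi\circ\sigma_j$ of $M$ are pairwise distinct) is $\sum_j\int_X|f_j|\,d\mu$. The *parametrized simplicial volume* $|M|^\alpha$ is the infimum of the norms of all cycles in $C_n(M;\alpha)$ that represent the image of the integral fundamental class $[M]_{\mathbb Z}$ under the change of coefficients $C_*(M;\mathbb Z)\cong\mathbb Z\otimes_{\mathbb Z\Gamma}C_*(\widetilde M;\mathbb Z)\to C_*(M;\alpha)$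 induced by the inclusion of $\mathbb Z$ as constant functions. The *integral foliated simplicial volume* is $|M|=\inf_\alpha|M|^\alpha$, over all standard $\Gamma$-spaces $\alpha$. The *stable integral simplicial volume* is $$\|M\|_{\mathbb Z}^\infty=\inf\Bigl\{\tfrac1d\,\|\overline M\|_{\mathbb Z}\Bigm| d\ge 1,\ \overline M\to M\text{ a connected }d\text{-sheeted covering}\Bigr\},$$ where $\|\overline M\|_{\mathbb Z}$ is the minimal $\ell^1$-norm of an integral singular fundamental cycle of $\overline M$ (with the pulled-back orientation). Let $\widehat\Gamma$ be the profinite completion of $\Gamma$ with its normalized Haar measure and the left translation action of $\Gamma$. An action $\Gamma\curvearrowright(X,\mu)$ is *weakly contained* in $\Gamma\curvearrowright(Y,\nu)$ if for all $\varepsilon>0$, all finite $F\subset\Gamma$, all $m\in\mathbb N$ and all measurable $A_1,\dots,A_m\subset X$ there are measurable $B_1,\dots,B_m\subset Y$ with $|\mu(\gamma A_j\cap A_k)-\nu(\gamma B_j\cap B_k)|<\varepsilon$ for all $\gamma\in F$ and all $j,k$. An infinite countable group $\Gamma$ has *property EMD\** if every ergodic standard $\Gamma$-space is weakly contained in $\widehat\Gamma$.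 **Corollary.** If $\Gamma=\pi_1(M)$ has property EMD\*, then for every ergodic standard $\Gamma$-space $\alpha$ $$|M|^\alpha\ \ge\ |M|^{\widehat\Gamma}\ =\ \|M\|_{\mathbb Z}^\infty ,$$ and $|M|=\|M\|_{\mathbb Z}^\infty$. -/

import Mathlib

open MeasureTheory
open scoped ENNReal TensorProduct

universe u v w

namespace FoliatedVolume

noncomputable section

/-! ### Singular chains with integer coefficients -/

/-- Singular `k`-simplices of `X`. -/
abbrev SingularSimplex (X : Type u) [TopologicalSpace X] (k : ℕ) : Type u :=
  C(stdSimplex ℝ (Fin (k + 1)), X)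

/-- The singular chain group `C_k(X; ℤ)`: the free abelian group on the singular `k`-simplices. -/
abbrev Chain (X : Type u) [TopologicalSpace X] (k : ℕ) : Type u :=
  SingularSimplex X k →₀ ℤ

/-- The `i`-th face of a singular simplex. -/
def face {X : Type u} [TopologicalSpace X] {k : ℕ} (i : Fin (k + 2))
    (σ : SingularSimplex X (k + 1)) : SingularSimplex X k :=
  σ.comp ⟨stdSimplex.map (Fin.succAbove i), stdSimplex.continuous_map _⟩

/-- The singular boundary operator `∂ : C_{k+1}(X; ℤ) → C_k(X; ℤ)`. -/
def boundary (X : Type u) [TopologicalSpace X] (k : ℕ) : Chain X (k + 1) →ₗ[ℤ] Chain X k :=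
  Finsupp.linearCombination ℤ fun σ =>
    ∑ i : Fin (k + 2), ((-1 : ℤ) ^ (i : ℕ)) • Finsupp.single (face i σ) (1 : ℤ)

/-- The chain map induced by a continuous map. -/
def pushChain {X : Type u} {Y : Type v} [TopologicalSpace X] [TopologicalSpace Y] (f : C(X, Y))
    (k : ℕ) : Chain X k →ₗ[ℤ] Chain Y k :=
  Finsupp.lmapDomain ℤ ℤ fun σ => f.comp σ

/-- The subgroup `C_k(A; ℤ) ⊆ C_k(X; ℤ)` of chains all of whose simplices lie in `A`. -/
def chainsIn {X : Type u} [TopologicalSpace X] (A : Set X) (k : ℕ) : Submodule ℤ (Chain X k) :=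
  Finsupp.supported ℤ ℤ {σ | Set.range σ ⊆ A}

/-- Relative cycles of the pair `(X, A)`: chains whose boundary lies in `A`. -/
def relCycles {X : Type u} [TopologicalSpace X] (A : Set X) :
    (k : ℕ) → Submodule ℤ (Chain X k)
  | 0 => ⊤
  | k + 1 => (chainsIn A k).comap (boundary X k)

/-- Relative boundaries of the pair `(X, A)`. -/
def relBoundaries {X : Type u} [TopologicalSpace X] (A : Set X) (k : ℕ) :
    Submodule ℤ (Chain X k) :=
  LinearMap.range (boundary X k) ⊔ chainsIn A k

/-- Relative singular homology `H_k(X, A; ℤ)`. -/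
abbrev RelHomology {X : Type u} [TopologicalSpace X] (A : Set X) (k : ℕ) : Type u :=
  relCycles A k ⧸ (relBoundaries A k).submoduleOf (relCycles A k)

/-- The chain `c` is a cycle of the pair `(X, A)` and its class in `H_k(X, A; ℤ)` is `h`. -/
def Represents {X : Type u} [TopologicalSpace X] {A : Set X} {k : ℕ} (c : Chain X k)
    (h : RelHomology A k) : Prop :=
  ∃ hc : c ∈ relCycles A k, Submodule.Quotient.mk ⟨c, hc⟩ = h

/-! ### Orientations, fundamental cycles, integral simplicial volume -/

/-- An orientation of an `n`-manifold `X`: a choice of a generator of `H_n(X, X ∖ {x}; ℤ)` for every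
point `x` which is locally consistent, i.e. around every point the local generators come from a
single class in `H_n(X, X ∖ U; ℤ)`, with `U` an open neighbourhood. -/
structure Orientation (X : Type u) [TopologicalSpace X] (n : ℕ) where
  gen : (x : X) → RelHomology ({x}ᶜ : Set X) n
  span_gen : ∀ x, Submodule.span ℤ {gen x} = ⊤
  consistent : ∀ x, ∃ U : Set X, IsOpen U ∧ x ∈ U ∧
    ∃ c ∈ relCycles Uᶜ n, ∀ y ∈ U, Represents c (gen y)

/-- Integral fundamental cycles: singular cycles whose class restricts at every point to the local
orientation. (Note that no singular simplex lies in the empty set.) -/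
def IsFundamentalCycle {X : Type u} [TopologicalSpace X] {n : ℕ} (o : Orientation X n)
    (c : Chain X n) : Prop :=
  c ∈ relCycles (∅ : Set X) n ∧ ∀ x, Represents c (o.gen x)

/-- The `ℓ¹`-norm of an integral singular chain. -/
def l1Norm {X : Type u} [TopologicalSpace X] {k : ℕ} (c : Chain X k) : ℝ≥0∞ :=
  ∑ σ ∈ c.support, ‖c σ‖ₑ

/-- Integral simplicial volume `‖X‖_ℤ`. -/
def integralVolume {X : Type u} [TopologicalSpace X] {n : ℕ} (o : Orientation X n) : ℝ≥0∞ :=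
  ⨅ (c : Chain X n) (_ : IsFundamentalCycle o c), l1Norm c

/-- The orientation `o'` is the pull-back of `o` along the local homeomorphism `q`: near every point
`y` there is a chain in a set on which `q` is injective which represents the local orientation at
`y` and whose image represents the local orientation at `q y`. -/
def IsPullback {Y X : Type u} [TopologicalSpace Y] [TopologicalSpace X] {n : ℕ}
    (o' : Orientation Y n) (q : C(Y, X)) (o : Orientation X n) : Prop :=
  ∀ y, ∃ V : Set Y, IsOpen V ∧ y ∈ V ∧ Set.InjOn q V ∧
    ∃ c ∈ chainsIn V n, Represents c (o'.gen y) ∧ Represents (pushChain q n c) (o.gen (q y))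

/-- Stable integral simplicial volume: the infimum of `‖Y‖_ℤ / d` over all `d`-sheeted coverings
`Y → X` with `Y` connected and carrying the pulled-back orientation, `d ≥ 1`. -/
def stableIntegralVolume {X : Type u} [TopologicalSpace X] {n : ℕ} (o : Orientation X n) :
    ℝ≥0∞ :=
  ⨅ (Y : Type u) (_ : TopologicalSpace Y) (_ : ConnectedSpace Y) (q : C(Y, X))
    (_ : IsCoveringMap q) (d : ℕ) (_ : 0 < d) (_ : ∀ x : X, Nat.card (q ⁻¹' {x}) = d)
    (o' : Orientation Y n) (_ : IsPullback o' q o), integralVolume o' / d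

/-! ### The universal covering and the action of the fundamental group -/

/-- The universal covering of `X` (for `X` a connected manifold) with respect to the base point
`x₀`: homotopy classes relative end points of paths starting in `x₀`. -/
def UniversalCover {X : Type u} [TopologicalSpace X] (x₀ : X) : Type u :=
  Σ x : X, Path.Homotopic.Quotient x₀ x

namespace UniversalCover

variable {X : Type u} [TopologicalSpace X] {x₀ : X}

/-- All classes of the form `a · [δ]` where `δ` is a path in `U` starting in the end point
of `a`. -/
def sheet (a : UniversalCover x₀) (U : Set X) : Set (UniversalCover x₀) :=
  {b | ∃ δ : Path a.1 b.1, (∀ t, δ t ∈ U) ∧ b.2 = a.2.trans (Path.Homotopic.Quotient.mk δ)}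

/-- The usual topology of the universal covering. -/
instance : TopologicalSpace (UniversalCover x₀) :=
  TopologicalSpace.generateFrom {s | ∃ a : UniversalCover x₀, ∃ U : Set X, IsOpen U ∧ s = sheet a U}

/-- The universal covering map sends a path class to its end point. -/
def proj (x₀ : X) : C(UniversalCover x₀, X) where
  toFun a := a.1
  continuous_toFun := by
    refine continuous_def.2 fun V hV => ?_
    have h : (fun a : UniversalCover x₀ => a.1) ⁻¹' V
        = ⋃ a : UniversalCover x₀, ⋃ _ : a.1 ∈ V, sheet a V := by
      ext b
      simp only [Set.mem_preimage, Set.mem_iUnion]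
      constructor
      · intro hb
        refine ⟨b, hb, Path.refl _, fun _ => hb, ?_⟩
        simp
      · rintro ⟨a, -, δ, hδ, -⟩
        simpa using hδ 1
    rw [h]
    exact isOpen_iUnion fun a => isOpen_iUnion fun _ =>
      TopologicalSpace.isOpen_generateFrom_of_mem ⟨a, V, hV, rfl⟩

/-- The fundamental group acts from the left by deck transformations. Products of loops in
`FundamentalGroup` are composed from right to left, so the inverse loop is put in front. -/
instance : MulAction (FundamentalGroup X x₀) (UniversalCover x₀) where
  smul g a := ⟨a.1, (FundamentalGroup.toPath g).symm.trans a.2⟩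
  one_smul := by
    rintro ⟨x, a⟩
    induction a with | mk a =>
    refine Sigma.ext rfl (heq_of_eq ?_)
    exact Path.Homotopic.Quotient.eq.2 ⟨Path.Homotopy.reflTrans a⟩
  mul_smul := by
    rintro g h ⟨x, a⟩
    refine Sigma.ext rfl (heq_of_eq ?_)
    change Path.Homotopic.Quotient x₀ x at a
    change (Path.Homotopic.Quotient.trans (FundamentalGroup.toPath h)
        (FundamentalGroup.toPath g)).symm.trans a
      = (FundamentalGroup.toPath g).symm.trans ((FundamentalGroup.toPath h).symm.trans a)
    generalize FundamentalGroup.toPath g = g'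
    generalize FundamentalGroup.toPath h = h'
    induction g' with | mk g' =>
    induction h' with | mk h' =>
    induction a with | mk a =>
    rw [← Path.Homotopic.Quotient.mk_trans, ← Path.Homotopic.Quotient.mk_symm, Path.trans_symm]
    exact Path.Homotopic.Quotient.eq.2 ⟨Path.Homotopy.transAssoc g'.symm h'.symm a⟩

theorem smul_def (g : FundamentalGroup X x₀) (a : UniversalCover x₀) :
    g • a = ⟨a.1, (FundamentalGroup.toPath g).symm.trans a.2⟩ := rfl

theorem proj_smul (g : FundamentalGroup X x₀) (a : UniversalCover x₀) :
    proj x₀ (g • a) = proj x₀ a := rfl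

theorem smul_mem_sheet (g : FundamentalGroup X x₀) {a b : UniversalCover x₀} {U : Set X}
    (h : b ∈ sheet a U) : g • b ∈ sheet (g • a) U := by
  obtain ⟨x, a⟩ := a
  obtain ⟨y, b⟩ := b
  obtain ⟨δ, hδ, hb⟩ := h
  refine ⟨δ, hδ, ?_⟩
  change Path.Homotopic.Quotient x₀ x at a
  change Path.Homotopic.Quotient x₀ y at b
  change Path x y at δ
  change b = a.trans (Path.Homotopic.Quotient.mk δ) at hb
  change (FundamentalGroup.toPath g).symm.trans b
    = ((FundamentalGroup.toPath g).symm.trans a).trans (Path.Homotopic.Quotient.mk δ)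
  rw [hb]
  generalize FundamentalGroup.toPath g = g'
  induction g' with | mk g' =>
  induction a with | mk a =>
  exact (Path.Homotopic.Quotient.eq.2 ⟨Path.Homotopy.transAssoc g'.symm a δ⟩).symm

instance : ContinuousConstSMul (FundamentalGroup X x₀) (UniversalCover x₀) where
  continuous_const_smul g := by
    refine continuous_generateFrom_iff.2 ?_
    rintro _ ⟨a, U, hU, rfl⟩
    have h : (fun b : UniversalCover x₀ => g • b) ⁻¹' sheet a U = sheet (g⁻¹ • a) U := by
      ext b
      constructor
      · intro hb
        simpa using smul_mem_sheet g⁻¹ hb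
      · intro hb
        simpa using smul_mem_sheet g hb
    rw [h]
    exact TopologicalSpace.isOpen_generateFrom_of_mem ⟨_, U, hU, rfl⟩

end UniversalCover

/-! ### Parametrized chains

`Γ` is a group acting from the left on the total space `E` of a covering `p : E → M`, and on a
probability space `(S, μ)` by measure preserving transformations. -/

section Parametrized

variable {M : Type u} [TopologicalSpace M] {E : Type w} [TopologicalSpace E]
variable (Γ : Type u) [Group Γ] [MulAction Γ E] [ContinuousConstSMul Γ E]
variable {S : Type v} [MeasurableSpace S] [MulAction Γ S] [MeasurableConstSMul Γ S]
variable (μ : Measure S) [SMulInvariantMeasure Γ S μ]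

/-- The abelian group `L^∞(S, μ; ℤ)` of classes of essentially bounded measurable functions
`S → ℤ`. -/
abbrev LInfty {S : Type v} [MeasurableSpace S] (μ : Measure S) : Type v := Lp ℤ ∞ μ

/-- The right action of `Γ` on `L^∞(S, μ; ℤ)`: `(f · g)(x) = f (g x)`. -/
def rightAct {Γ : Type u} [Group Γ] {S : Type v} [MeasurableSpace S] [MulAction Γ S]
    [MeasurableConstSMul Γ S] {μ : Measure S} [SMulInvariantMeasure Γ S μ]
    (f : LInfty μ) (g : Γ) : LInfty μ :=
  Lp.compMeasurePreserving (g • ·) (measurePreserving_smul g μ) f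

/-- The left action of `Γ` on `C_k(E; ℤ)`: `g · σ = (g • ·) ∘ σ` on simplices. -/
def leftAct {Γ : Type u} [Group Γ] {E : Type w} [TopologicalSpace E] [MulAction Γ E]
    [ContinuousConstSMul Γ E] (g : Γ) (k : ℕ) : Chain E k →ₗ[ℤ] Chain E k :=
  pushChain ⟨fun x => g • x, continuous_const_smul g⟩ k

/-- The relations `(f · g) ⊗ c = f ⊗ (g · c)` that have to be imposed on the tensor product over
`ℤ` to get the tensor product over the group ring `ℤΓ`. -/
def balanced (E : Type w) [TopologicalSpace E] [MulAction Γ E] [ContinuousConstSMul Γ E]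
    (k : ℕ) : AddSubgroup (LInfty μ ⊗[ℤ] Chain E k) :=
  AddSubgroup.closure {t | ∃ (f : LInfty μ) (g : Γ) (c : Chain E k),
    t = rightAct f g ⊗ₜ[ℤ] c - f ⊗ₜ[ℤ] leftAct g k c}

/-- The group `L^∞(S, μ; ℤ) ⊗_{ℤΓ} C_k(E; ℤ)` of parametrized chains. -/
abbrev ParChain (E : Type w) [TopologicalSpace E] [MulAction Γ E] [ContinuousConstSMul Γ E]
    (k : ℕ) : Type (max v w) :=
  (LInfty μ ⊗[ℤ] Chain E k) ⧸ balanced Γ μ E k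

/-- The elementary tensor `f ⊗ c` in `L^∞(S, μ; ℤ) ⊗_{ℤΓ} C_k(E; ℤ)`. -/
def parTmul {k : ℕ} (f : LInfty μ) (c : Chain E k) : ParChain Γ μ E k :=
  QuotientAddGroup.mk (f ⊗ₜ[ℤ] c)

theorem pushChain_boundary {X : Type u} {Y : Type v} [TopologicalSpace X] [TopologicalSpace Y]
    (f : C(X, Y)) (k : ℕ) (c : Chain X (k + 1)) :
    boundary Y k (pushChain f (k + 1) c) = pushChain f k (boundary X k c) := by
  induction c using Finsupp.induction_linear with
  | zero => simp
  | add a b ha hb => simp [ha, hb]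
  | single σ a =>
    simp only [pushChain, boundary, Finsupp.lmapDomain_apply, Finsupp.mapDomain_single,
      Finsupp.linearCombination_single, Finsupp.mapDomain_smul, Finsupp.mapDomain_finsetSum]
    rfl

/-- The boundary operator `id ⊗ ∂` on parametrized chains. -/
def parBoundary (E : Type w) [TopologicalSpace E] [MulAction Γ E] [ContinuousConstSMul Γ E]
    (k : ℕ) : ParChain Γ μ E (k + 1) →+ ParChain Γ μ E k :=
  QuotientAddGroup.map _ _ (LinearMap.lTensor (LInfty μ) (boundary E k)).toAddMonoidHom <| by
    refine (AddSubgroup.closure_le _).2 ?_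
    rintro _ ⟨f, g, c, rfl⟩
    refine AddSubgroup.subset_closure ⟨f, g, boundary E k c, ?_⟩
    rw [map_sub]
    simp [leftAct, pushChain_boundary]

theorem parBoundary_parTmul {k : ℕ} (f : LInfty μ) (c : Chain E (k + 1)) :
    parBoundary Γ μ E k (parTmul Γ μ f c) = parTmul Γ μ f (boundary E k c) := rfl

/-- The `ℓ¹`-norm `∑ ∫ |f_j| dμ` of a parametrized chain with reduced form `∑ f_j ⊗ σ_j`, i.e. the
simplices `p ∘ σ_j` are pairwise different. (Reduced forms exist and all of them lead to the same
value.) -/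
def parNorm (p : C(E, M)) {k : ℕ} (c : ParChain Γ μ E k) : ℝ≥0∞ :=
  ⨅ (m : ℕ) (f : Fin m → LInfty μ) (σ : Fin m → SingularSimplex E k)
    (_ : Function.Injective fun j => p.comp (σ j))
    (_ : c = ∑ j, parTmul Γ μ (f j) (Finsupp.single (σ j) 1)), ∑ j, ∫⁻ x, ‖f j x‖ₑ ∂μ

/-- Parametrized fundamental cycles: chains that are homologous to the image of an integral
fundamental cycle of `M` under the change of coefficients
`C_n(M; ℤ) ≅ ℤ ⊗_{ℤΓ} C_n(E; ℤ) → L^∞(S, μ; ℤ) ⊗_{ℤΓ} C_n(E; ℤ)`. The first isomorphism is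
inverse to `1 ⊗ z ↦ p_* z`, so the image of `p_* z` is `1 ⊗ z`. -/
def IsParFundamentalCycle [IsFiniteMeasure μ] (p : C(E, M)) {n : ℕ} (o : Orientation M n)
    (c : ParChain Γ μ E n) : Prop :=
  ∃ z : Chain E n, IsFundamentalCycle o (pushChain p n z) ∧
    c - parTmul Γ μ (Lp.const ∞ μ (1 : ℤ)) z ∈ (parBoundary Γ μ E n).range

/-- The parametrized simplicial volume of `M`, computed on the covering `p : E → M`. -/
def parVolumeOn [IsFiniteMeasure μ] (p : C(E, M)) {n : ℕ} (o : Orientation M n) : ℝ≥0∞ :=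
  ⨅ (c : ParChain Γ μ E n) (_ : IsParFundamentalCycle Γ μ p o c), parNorm Γ μ p c

end Parametrized

/-- The parametrized simplicial volume `|M|^α` of the oriented closed connected `n`-manifold `M`,
where `α` is the action of `π₁(M, x₀)` on the probability space `(S, μ)`. -/
def parVolume {M : Type u} [TopologicalSpace M] {n : ℕ} (o : Orientation M n) (x₀ : M)
    {S : Type v} [MeasurableSpace S] [MulAction (FundamentalGroup M x₀) S]
    [MeasurableConstSMul (FundamentalGroup M x₀) S] (μ : Measure S) [IsProbabilityMeasure μ]
    [SMulInvariantMeasure (FundamentalGroup M x₀) S μ] : ℝ≥0∞ :=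
  parVolumeOn (FundamentalGroup M x₀) μ (UniversalCover.proj x₀) o

/-- The integral foliated simplicial volume `|M|`: the infimum of `|M|^α` over all standard
`π₁(M, x₀)`-spaces `α`. Every standard Borel space is isomorphic to one in `Type`. -/
def foliatedVolume {M : Type u} [TopologicalSpace M] {n : ℕ} (o : Orientation M n) (x₀ : M) :
    ℝ≥0∞ :=
  ⨅ (S : Type) (_ : MeasurableSpace S) (_ : StandardBorelSpace S)
    (_ : MulAction (FundamentalGroup M x₀) S) (_ : MeasurableConstSMul (FundamentalGroup M x₀) S)
    (μ : Measure S) (_ : IsProbabilityMeasure μ)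
    (_ : SMulInvariantMeasure (FundamentalGroup M x₀) S μ), parVolume o x₀ μ

/-! ### Profinite completion, weak containment and property EMD* -/

/-- The profinite completion of `Γ` (the limit of its finite quotients), as a `Γ`-space. -/
def ProfiniteCompletion (Γ : Type u) [Group Γ] : Type u :=
  ProfiniteGrp.ProfiniteCompletion.completion (GrpCat.of Γ)

namespace ProfiniteCompletion

variable (Γ : Type u) [Group Γ]

instance : Group (ProfiniteCompletion Γ) :=
  inferInstanceAs (Group (ProfiniteGrp.ProfiniteCompletion.completion (GrpCat.of Γ)))

instance : TopologicalSpace (ProfiniteCompletion Γ) :=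
  inferInstanceAs
    (TopologicalSpace (ProfiniteGrp.ProfiniteCompletion.completion (GrpCat.of Γ)))

instance : IsTopologicalGroup (ProfiniteCompletion Γ) :=
  inferInstanceAs
    (IsTopologicalGroup (ProfiniteGrp.ProfiniteCompletion.completion (GrpCat.of Γ)))

instance : CompactSpace (ProfiniteCompletion Γ) :=
  inferInstanceAs
    (CompactSpace (ProfiniteGrp.ProfiniteCompletion.completion (GrpCat.of Γ)))

instance : MeasurableSpace (ProfiniteCompletion Γ) := borel _

instance : BorelSpace (ProfiniteCompletion Γ) := ⟨rfl⟩

/-- The canonical homomorphism from `Γ` to its profinite completion. -/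
def ofGroup : Γ →* ProfiniteCompletion Γ :=
  (ProfiniteGrp.ProfiniteCompletion.eta (GrpCat.of Γ)).hom

/-- `Γ` acts on its profinite completion by left translations. -/
instance : MulAction Γ (ProfiniteCompletion Γ) := MulAction.compHom _ (ofGroup Γ)

theorem smul_def (g : Γ) (x : ProfiniteCompletion Γ) : g • x = ofGroup Γ g * x := rfl

/-- The normalized Haar measure. -/
def haar : Measure (ProfiniteCompletion Γ) := Measure.haarMeasure ⊤

instance : IsProbabilityMeasure (haar Γ) := ⟨by
  simpa [haar] using
    Measure.haarMeasure_self (K₀ := (⊤ : TopologicalSpace.PositiveCompacts (ProfiniteCompletion Γ)))⟩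

instance : MeasurableConstSMul Γ (ProfiniteCompletion Γ) where
  measurable_const_smul g := (continuous_const_mul (ofGroup Γ g)).measurable

instance : SMulInvariantMeasure Γ (ProfiniteCompletion Γ) (haar Γ) where
  measure_preimage_smul g s _ :=
    measure_preimage_mul (Measure.haarMeasure ⊤) (ofGroup Γ g) s

end ProfiniteCompletion

/-- Weak containment of the measure preserving action of `Γ` on `(S, μ)` in the one on
`(T, ν)`. -/
def WeaklyContained (Γ : Type u) [Group Γ] {S : Type v} [MeasurableSpace S] [MulAction Γ S]
    (μ : Measure S) {T : Type w} [MeasurableSpace T] [MulAction Γ T] (ν : Measure T) : Prop :=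
  ∀ ε : ℝ, 0 < ε → ∀ (F : Finset Γ) (m : ℕ) (A : Fin m → Set S), (∀ j, MeasurableSet (A j)) →
    ∃ B : Fin m → Set T, (∀ j, MeasurableSet (B j)) ∧ ∀ g ∈ F, ∀ j k,
      |μ.real (((g • ·) '' A j) ∩ A k) - ν.real (((g • ·) '' B j) ∩ B k)| < ε

/-- Property `EMD*` of an infinite countable group `Γ`: every ergodic standard `Γ`-space is weakly
contained in the profinite completion of `Γ`. -/
def HasEMDStar (Γ : Type u) [Group Γ] : Prop :=
  Infinite Γ ∧ Countable Γ ∧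
    ∀ (S : Type) [MeasurableSpace S] [StandardBorelSpace S] [MulAction Γ S]
      [MeasurableConstSMul Γ S] (μ : Measure S) [IsProbabilityMeasure μ] [ErgodicSMul Γ S μ],
      WeaklyContained Γ μ (ProfiniteCompletion.haar Γ)

end

end FoliatedVolume

/-! A parametrized fundamental cycle has the form `1 ⊗ z + ∑ h_j ⊗ ∂τ_j` with bounded integer
functions `h_j` on the parameter space. After every face is moved to a chosen lift, its coefficients
at a point `x` are combinations of finitely many values `h_j (γ • x)`; they form the chain
`evalChain`. The norm is therefore `∫ Φ (γ ↦ h (γ • x)) dμ`, where `h` has finitely many values and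
the functional `Φ` only sees the restriction to a finite set `D ⊆ Γ` (`parVolume_le_lintegral`,
`exists_lintegral_lt`). Hence `|M|^α` is governed by the distributions of `D`-patterns of
finite-valued functions on `α`.

Finite connected coverings fit into the same scheme. For a finite transitive `Γ`-set `F`, the sum of
`Φ` over `F` is the `ℓ¹`-norm of a chain `transfer z + ∂b` on `M~ ×_Γ F`
(`IsAssociated.sum_l1Norm_evalChain`). The transfer of a fundamental cycle is a fundamental cycle,
and fundamental cycles of a closed manifold are unique up to boundaries. So all fundamental cycles
of finite coverings arise in this way, and the stable integral simplicial volume is the infimum of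
the averages of `Φ` over finite transitive `Γ`-sets (`stableIntegralVolume_le`,
`le_stableIntegralVolume`).

Upper bounds: the profinite completion maps equivariantly to every such `F`, and Haar measure
becomes the uniform measure, so `|M|^Γ^` is at most the stable volume (`parVolume_haar_le`). The set
`F` with its uniform measure is itself a standard `Γ`-space, which gives the same bound for `|M|`
(`foliatedVolume_le`).

Lower bound, for an arbitrary invariant probability measure (`HasEMDStar.le_lintegral`): the map `x
↦ (γ ↦ h (γ • x))` carries the action to a shift over a finite alphabet, where `Φ` becomes a
continuous function. An extreme point of the set of invariant measures minimizing its integral is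
ergodic, so no ergodic decomposition is needed. By EMD* this ergodic action is weakly contained in
the profinite completion, and weak containment reproduces pattern distributions up to a small error
(`WeaklyContained.exists_patternSet_le`). On the profinite completion measurable functions are close
to locally constant ones, and these factor through finite transitive `Γ`-sets (`le_lintegral_haar`).

The topological input is the existence and uniqueness of fundamental cycles. It follows from
barycentric subdivision, excision and a Mayer–Vietoris argument: homology relative to the complement
of a compact set vanishes above the dimension and is detected at points in the top degree
(`LocallyEuclidean.isControlled`). -/

namespace FoliatedVolume
noncomputable section

/-! ### Ordered affine chains -/

/-- The free abelian group on the `(k + 1)`-tuples of points of `V`. -/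
abbrev VertexChain (V : Type u) (k : ℕ) : Type u := (Fin (k + 1) → V) →₀ ℤ

namespace VertexChain

variable {V : Type u} {W : Type v}

/-- Applying a map to all vertices. -/
def map (f : V → W) (k : ℕ) : VertexChain V k →ₗ[ℤ] VertexChain W k :=
  Finsupp.lmapDomain ℤ ℤ fun v => f ∘ v

@[simp] theorem map_single (f : V → W) (k : ℕ) (v : Fin (k + 1) → V) (a : ℤ) :
    map f k (Finsupp.single v a) = Finsupp.single (f ∘ v) a := by
  simp [map, Finsupp.mapDomain_single]

/-- The boundary of a tuple is the alternating sum of its faces. -/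
def bd (V : Type u) (k : ℕ) : VertexChain V (k + 1) →ₗ[ℤ] VertexChain V k :=
  Finsupp.linearCombination ℤ fun v =>
    ∑ i : Fin (k + 2), ((-1 : ℤ) ^ (i : ℕ)) • Finsupp.single (v ∘ i.succAbove) (1 : ℤ)

theorem bd_single (k : ℕ) (v : Fin (k + 2) → V) :
    bd V k (Finsupp.single v 1)
      = ∑ i : Fin (k + 2), ((-1 : ℤ) ^ (i : ℕ)) • Finsupp.single (v ∘ i.succAbove) (1 : ℤ) := by
  simp [bd]

/-- The cone with apex `b`. -/
def cone (b : V) (k : ℕ) : VertexChain V k →ₗ[ℤ] VertexChain V (k + 1) :=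
  Finsupp.lmapDomain ℤ ℤ fun v => Fin.cons b v

@[simp] theorem cone_single (b : V) (k : ℕ) (v : Fin (k + 1) → V) (a : ℤ) :
    cone b k (Finsupp.single v a) = Finsupp.single (Fin.cons b v : Fin (k + 2) → V) a := by
  simp [cone, Finsupp.mapDomain_single]

theorem hom_ext {k : ℕ} {N : Type w} [AddCommGroup N] {f g : VertexChain V k →ₗ[ℤ] N}
    (h : ∀ v, f (Finsupp.single v 1) = g (Finsupp.single v 1)) : f = g := by
  refine Finsupp.lhom_ext' fun v => LinearMap.ext_ring ?_
  simpa using h v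

theorem map_bd (f : V → W) (k : ℕ) (c : VertexChain V (k + 1)) :
    map f k (bd V k c) = bd W k (map f (k + 1) c) := by
  have : map f k ∘ₗ bd V k = bd W k ∘ₗ map f (k + 1) := by
    refine hom_ext fun v => ?_
    simp only [LinearMap.comp_apply, bd_single, map_single, map_sum, map_smul]
    rfl
  exact LinearMap.congr_fun this c

theorem map_cone (f : V → W) (b : V) (k : ℕ) (c : VertexChain V k) :
    map f (k + 1) (cone b k c) = cone (f b) k (map f k c) := by
  have : map f (k + 1) ∘ₗ cone b k = cone (f b) k ∘ₗ map f k := by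
    refine hom_ext fun v => ?_
    simp only [LinearMap.comp_apply, map_single, cone_single]
    congr 1
    ext i
    refine Fin.cases ?_ (fun i => ?_) i <;> simp
  exact LinearMap.congr_fun this c

/-- Face `0` drops the apex, and face `i + 1` is the cone over face `i`, with opposite sign.
Subdivision, its homotopy and the prism are cones over chains whose boundary is known by induction,
so this identity carries all three. -/
theorem bd_cone (b : V) (k : ℕ) (c : VertexChain V (k + 1)) :
    bd V (k + 1) (cone b (k + 1) c) = c - cone b k (bd V k c) := by
  have : bd V (k + 1) ∘ₗ cone b (k + 1) = LinearMap.id - cone b k ∘ₗ bd V k := by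
    refine hom_ext fun v => ?_
    simp only [LinearMap.comp_apply, LinearMap.sub_apply, LinearMap.id_apply, cone_single,
      bd_single, map_sum, map_smul]
    rw [Fin.sum_univ_succ, sub_eq_add_neg, ← Finset.sum_neg_distrib]
    congr 1
    · simp only [Fin.val_zero, pow_zero, one_smul]
      congr 1
    · refine Finset.sum_congr rfl fun i _ => ?_
      rw [Fin.val_succ, pow_succ, mul_neg_one, neg_smul]
      congr 3
      ext j
      refine Fin.cases ?_ (fun j => ?_) j <;> simp [Fin.succ_succAbove_succ]
  exact LinearMap.congr_fun this c

/-- In degree `0` the second face of a cone is the apex itself, which brings in the augmentation. -/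
theorem bd_cone_zero (b : V) (c : VertexChain V 0) :
    bd V 0 (cone b 0 c) = c - (Finsupp.linearCombination ℤ fun _ : Fin 1 → V => (1 : ℤ)) c •
      Finsupp.single (fun _ => b) 1 := by
  have : bd V 0 ∘ₗ cone b 0 = LinearMap.id -
      (LinearMap.toSpanSingleton ℤ _ (Finsupp.single (fun _ : Fin 1 => b) (1 : ℤ))) ∘ₗ
        (Finsupp.linearCombination ℤ fun _ : Fin 1 → V => (1 : ℤ)) := by
    refine hom_ext fun v => ?_
    have h : (Fin.cons b v : Fin 2 → V) ∘ Fin.succAbove 1 = fun _ => b := by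
      ext j
      fin_cases j
      rfl
    have h' : (Fin.cons b v : Fin 2 → V) ∘ Fin.succ = v := by
      ext j
      rfl
    simp [bd_single, Fin.sum_univ_two, h, h', sub_eq_add_neg]
  exact LinearMap.congr_fun this c

theorem augmentation_bd (c : VertexChain V 1) :
    (Finsupp.linearCombination ℤ fun _ : Fin 1 → V => (1 : ℤ)) (bd V 0 c) = 0 := by
  have : (Finsupp.linearCombination ℤ fun _ : Fin 1 → V => (1 : ℤ)) ∘ₗ bd V 0 = 0 := by
    refine hom_ext fun v => ?_
    simp [bd_single, Fin.sum_univ_succ]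
  exact LinearMap.congr_fun this c

theorem bd_bd (k : ℕ) (c : VertexChain V (k + 2)) : bd V k (bd V (k + 1) c) = 0 := by
  suffices bd V k ∘ₗ bd V (k + 1) = 0 from LinearMap.congr_fun this c
  clear c
  refine hom_ext fun v => ?_
  -- A tuple is the cone with apex its first entry over its tail, so `bd_cone` reduces `∂∂` of the
  -- tuple to the cone over `∂∂` of the tail.
  have hv : Finsupp.single v (1 : ℤ) = cone (v 0) (k + 1) (Finsupp.single (Fin.tail v) 1) := by
    simp
  induction k with
  | zero => simp [hv, LinearMap.comp_apply, bd_cone, bd_cone_zero, -cone_single, augmentation_bd]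
  | succ k ih =>
    rw [hv, LinearMap.comp_apply, bd_cone, map_sub, bd_cone]
    have := ih (Fin.tail v) (by simp)
    simp only [LinearMap.comp_apply, LinearMap.zero_apply] at this
    simp [this, -cone_single]

/-- Barycentric subdivision with respect to a choice of barycenters. -/
def sd (β : (k : ℕ) → (Fin (k + 1) → V) → V) : (k : ℕ) → VertexChain V k →ₗ[ℤ] VertexChain V k
  | 0 => LinearMap.id
  | k + 1 => Finsupp.linearCombination ℤ fun v =>
      cone (β (k + 1) v) k (sd β k (bd V k (Finsupp.single v 1)))

/-- The chain homotopy between the identity and the barycentric subdivision. -/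
def sdHtpy (β : (k : ℕ) → (Fin (k + 1) → V) → V) :
    (k : ℕ) → VertexChain V k →ₗ[ℤ] VertexChain V (k + 1)
  | 0 => 0
  | k + 1 => Finsupp.linearCombination ℤ fun v =>
      cone (β (k + 1) v) (k + 1)
        (Finsupp.single v 1 - sdHtpy β k (bd V k (Finsupp.single v 1)))

theorem sd_succ_single (β : (k : ℕ) → (Fin (k + 1) → V) → V) (k : ℕ) (v : Fin (k + 2) → V) :
    sd β (k + 1) (Finsupp.single v 1)
      = cone (β (k + 1) v) k (sd β k (bd V k (Finsupp.single v 1))) := by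
  simp [sd]

theorem sdHtpy_succ_single (β : (k : ℕ) → (Fin (k + 1) → V) → V) (k : ℕ) (v : Fin (k + 2) → V) :
    sdHtpy β (k + 1) (Finsupp.single v 1) = cone (β (k + 1) v) (k + 1)
      (Finsupp.single v 1 - sdHtpy β k (bd V k (Finsupp.single v 1))) := by
  simp [sdHtpy]

/-- By `bd_cone`, `∂ sd v = sd ∂v - cone (∂ sd ∂v)`, and inductively `∂ sd ∂v = sd ∂∂v = 0`. For
edges the vanishing of the augmentation on boundaries plays this role. -/
theorem bd_sd (β : (k : ℕ) → (Fin (k + 1) → V) → V) (k : ℕ) (c : VertexChain V (k + 1)) :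
    bd V k (sd β (k + 1) c) = sd β k (bd V k c) := by
  suffices bd V k ∘ₗ sd β (k + 1) = sd β k ∘ₗ bd V k from LinearMap.congr_fun this c
  induction k with
  | zero =>
    refine hom_ext fun v => ?_
    rw [LinearMap.comp_apply, sd_succ_single, bd_cone_zero]
    simp [sd, augmentation_bd]
  | succ k ih =>
    refine hom_ext fun v => ?_
    rw [LinearMap.comp_apply, sd_succ_single, bd_cone]
    have := LinearMap.congr_fun (ih (bd V (k + 1) (Finsupp.single v 1)))
      (bd V (k + 1) (Finsupp.single v 1))
    simp only [LinearMap.comp_apply] at this ⊢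
    rw [this, bd_bd]
    simp

/-- By induction the chain `v - T ∂v` under the cone has boundary `∂v - (∂v - sd ∂v) = sd ∂v`, and
the cone over `sd ∂v` is `sd v`. -/
theorem bd_sdHtpy (β : (k : ℕ) → (Fin (k + 1) → V) → V) (k : ℕ) (c : VertexChain V (k + 1)) :
    bd V (k + 1) (sdHtpy β (k + 1) c) + sdHtpy β k (bd V k c) = c - sd β (k + 1) c := by
  suffices bd V (k + 1) ∘ₗ sdHtpy β (k + 1) + sdHtpy β k ∘ₗ bd V k = LinearMap.id - sd β (k + 1)
    from LinearMap.congr_fun this c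
  induction k with
  | zero =>
    refine hom_ext fun v => ?_
    simp only [LinearMap.add_apply, LinearMap.comp_apply, LinearMap.sub_apply, LinearMap.id_apply]
    rw [sd_succ_single, sdHtpy_succ_single, bd_cone]
    simp [sdHtpy, sd]
  | succ k ih =>
    refine hom_ext fun v => ?_
    have := LinearMap.congr_fun (ih (bd V (k + 1) (Finsupp.single v 1)))
      (bd V (k + 1) (Finsupp.single v 1))
    simp only [LinearMap.add_apply, LinearMap.comp_apply, LinearMap.sub_apply,
      LinearMap.id_apply, bd_bd, map_zero, add_zero] at this ⊢
    rw [sd_succ_single, sdHtpy_succ_single, bd_cone, map_sub, this, sub_sub_cancel]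
    abel

/-- Naturality for maps respecting barycenters. Affine maps are of this kind, which lets subdivision
pass from affine to singular chains. -/
theorem map_sd {β : (k : ℕ) → (Fin (k + 1) → V) → V} {β' : (k : ℕ) → (Fin (k + 1) → W) → W}
    {f : V → W} (hf : ∀ k v, f (β k v) = β' k (f ∘ v)) (k : ℕ) (c : VertexChain V k) :
    map f k (sd β k c) = sd β' k (map f k c) := by
  suffices map f k ∘ₗ sd β k = sd β' k ∘ₗ map f k from LinearMap.congr_fun this c
  induction k with
  | zero => rfl
  | succ k ih =>
    refine hom_ext fun v => ?_
    have := LinearMap.congr_fun (ih (bd V k (Finsupp.single v 1)))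
      (bd V k (Finsupp.single v 1))
    simp only [LinearMap.comp_apply] at this ⊢
    rw [map_single, sd_succ_single, sd_succ_single, map_cone, this, map_bd, hf, map_single]

theorem map_sdHtpy {β : (k : ℕ) → (Fin (k + 1) → V) → V} {β' : (k : ℕ) → (Fin (k + 1) → W) → W}
    {f : V → W} (hf : ∀ k v, f (β k v) = β' k (f ∘ v)) (k : ℕ) (c : VertexChain V k) :
    map f (k + 1) (sdHtpy β k c) = sdHtpy β' k (map f k c) := by
  suffices map f (k + 1) ∘ₗ sdHtpy β k = sdHtpy β' k ∘ₗ map f k from LinearMap.congr_fun this c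
  induction k with
  | zero => ext; simp [sdHtpy]
  | succ k ih =>
    refine hom_ext fun v => ?_
    have := LinearMap.congr_fun (ih (bd V k (Finsupp.single v 1)))
      (bd V k (Finsupp.single v 1))
    simp only [LinearMap.comp_apply] at this ⊢
    rw [map_single, sdHtpy_succ_single, sdHtpy_succ_single, map_cone, map_sub, this, map_bd, hf,
      map_single]

/-- The prism operator from tuples of points of `V` to tuples of points of `V × W`, joining the
bottom `V × {e₀}` to the top `V × {e₁}`. -/
def prism (e₀ e₁ : W) : (k : ℕ) → VertexChain V k →ₗ[ℤ] VertexChain (V × W) (k + 1)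
  | 0 => Finsupp.linearCombination ℤ fun v =>
      cone (v 0, e₀) 0 (Finsupp.single (fun i => (v i, e₁)) 1)
  | k + 1 => Finsupp.linearCombination ℤ fun v =>
      cone (v 0, e₀) (k + 1) (Finsupp.single (fun i => (v i, e₁)) 1
        - Finsupp.single (fun i => (v i, e₀)) 1 - prism e₀ e₁ k (bd V k (Finsupp.single v 1)))

theorem prism_succ_single (e₀ e₁ : W) (k : ℕ) (v : Fin (k + 2) → V) :
    prism e₀ e₁ (k + 1) (Finsupp.single v 1) = cone (v 0, e₀) (k + 1)
      (map (fun x => (x, e₁)) _ (Finsupp.single v 1) - map (fun x => (x, e₀)) _ (Finsupp.single v 1)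
        - prism e₀ e₁ k (bd V k (Finsupp.single v 1))) := by
  simp only [prism, Finsupp.linearCombination_single, one_smul, map_single]
  rfl

theorem bd_prism_zero (e₀ e₁ : W) (c : VertexChain V 0) :
    bd (V × W) 0 (prism e₀ e₁ 0 c) = map (fun x => (x, e₁)) 0 c - map (fun x => (x, e₀)) 0 c := by
  suffices bd (V × W) 0 ∘ₗ prism e₀ e₁ 0
      = map (fun x => (x, e₁)) 0 - map (fun x => (x, e₀)) 0 from LinearMap.congr_fun this c
  refine hom_ext fun v => ?_
  simp only [prism, LinearMap.comp_apply, Finsupp.linearCombination_single, one_smul,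
    bd_cone_zero, LinearMap.sub_apply, map_single]
  have h : v = fun _ => v 0 := by
    ext i
    rw [Fin.fin_one_eq_zero i]
  rw [h]
  rfl

/-- The chain `top - bottom - prism ∂v` under the cone is a cycle by induction, so it is the whole
boundary of the cone. -/
theorem bd_prism (e₀ e₁ : W) (k : ℕ) (c : VertexChain V (k + 1)) :
    bd (V × W) (k + 1) (prism e₀ e₁ (k + 1) c) + prism e₀ e₁ k (bd V k c)
      = map (fun x => (x, e₁)) _ c - map (fun x => (x, e₀)) _ c := by
  suffices bd (V × W) (k + 1) ∘ₗ prism e₀ e₁ (k + 1) + prism e₀ e₁ k ∘ₗ bd V k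
      = map (fun x => (x, e₁)) _ - map (fun x => (x, e₀)) _ from LinearMap.congr_fun this c
  induction k with
  | zero =>
    refine hom_ext fun v => ?_
    simp only [LinearMap.add_apply, LinearMap.comp_apply, LinearMap.sub_apply]
    rw [prism_succ_single, bd_cone]
    simp only [map_sub, ← map_bd, bd_prism_zero, sub_self, map_zero]
    abel
  | succ k ih =>
    refine hom_ext fun v => ?_
    have := LinearMap.congr_fun (ih (bd V (k + 1) (Finsupp.single v 1)))
      (bd V (k + 1) (Finsupp.single v 1))
    simp only [LinearMap.add_apply, LinearMap.comp_apply, LinearMap.sub_apply, bd_bd, map_zero,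
      add_zero] at this ⊢
    rw [prism_succ_single, bd_cone]
    simp only [map_sub, ← map_bd, this, sub_self, map_zero]
    abel

theorem map_prism {V' : Type w} (f : V → V') (e₀ e₁ : W) (k : ℕ) (c : VertexChain V k) :
    map (Prod.map f id) (k + 1) (prism e₀ e₁ k c) = prism e₀ e₁ k (map f k c) := by
  suffices map (Prod.map f id) (k + 1) ∘ₗ prism e₀ e₁ k = prism e₀ e₁ k ∘ₗ map f k
    from LinearMap.congr_fun this c
  induction k with
  | zero =>
    refine hom_ext fun v => ?_
    simp only [prism, LinearMap.comp_apply, Finsupp.linearCombination_single, one_smul, map_single,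
      map_cone]
    rfl
  | succ k ih =>
    refine hom_ext fun v => ?_
    have := LinearMap.congr_fun (ih (bd V k (Finsupp.single v 1)))
      (bd V k (Finsupp.single v 1))
    simp only [LinearMap.comp_apply] at this ⊢
    rw [map_single, prism_succ_single, prism_succ_single, map_cone]
    simp only [map_sub, this, map_bd, map_single]
    rfl

end VertexChain

/-! ### Affine simplices and the induced operators on singular chains -/

/-- The standard simplex with vertex set `Fin (k + 1)`. -/
abbrev Splx (k : ℕ) : Type := stdSimplex ℝ (Fin (k + 1))

/-- The affine map from a standard simplex with prescribed images of the vertices. -/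
def affineSimplex {m k : ℕ} (v : Fin (k + 1) → Splx m) : C(Splx k, Splx m) where
  toFun t := ⟨fun j => ∑ i, t i * v i j, fun j => Finset.sum_nonneg fun i _ =>
      mul_nonneg (stdSimplex.zero_le t i) (stdSimplex.zero_le (v i) j), by
    rw [Finset.sum_comm]
    simp_rw [← Finset.mul_sum, stdSimplex.sum_eq_one, mul_one]
    exact stdSimplex.sum_eq_one t⟩
  continuous_toFun := by
    refine Continuous.subtype_mk (continuous_pi fun j => continuous_finsetSum _ fun i _ => ?_) _
    exact ((continuous_apply i).comp continuous_subtype_val).mul continuous_const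

theorem affineSimplex_apply {m k : ℕ} (v : Fin (k + 1) → Splx m) (t : Splx k) (j : Fin (m + 1)) :
    affineSimplex v t j = ∑ i, t i * v i j := rfl

theorem affineSimplex_comp {l m k : ℕ} (v : Fin (k + 1) → Splx m) (w : Fin (l + 1) → Splx k) :
    (affineSimplex v).comp (affineSimplex w) = affineSimplex (affineSimplex v ∘ w) := by
  ext t j
  change affineSimplex v (affineSimplex w t) j = _
  simp only [affineSimplex_apply, Function.comp_apply, Finset.sum_mul, Finset.mul_sum]
  rw [Finset.sum_comm]
  simp only [mul_assoc]

/-- The vertices of the standard simplex. -/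
def vertices (k : ℕ) : Fin (k + 1) → Splx k := fun i => stdSimplex.vertex i

theorem affineSimplex_vertices (k : ℕ) : affineSimplex (vertices k) = ContinuousMap.id _ := by
  ext t j
  change affineSimplex (vertices k) t j = t j
  rw [affineSimplex_apply]
  simp [vertices, Pi.single_apply]

theorem affineSimplex_comp_vertices {k m : ℕ} (v : Fin (k + 1) → Splx m) :
    affineSimplex v ∘ vertices k = v := by
  ext i j
  change affineSimplex v (vertices k i) j = v i j
  rw [affineSimplex_apply]
  simp [vertices, Pi.single_apply]

theorem face_affineSimplex {k m : ℕ} (v : Fin (k + 2) → Splx m) (i : Fin (k + 2)) :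
    face i (affineSimplex v) = affineSimplex (v ∘ i.succAbove) := by
  ext t j
  change affineSimplex v (stdSimplex.map i.succAbove t) j = _
  simp only [affineSimplex_apply, Function.comp_apply, stdSimplex.map_coe,
    FunOnFinite.linearMap_apply_apply, Finset.sum_mul]
  rw [Finset.sum_sigma' Finset.univ]
  refine Finset.sum_bij' (fun x _ => x.2) (fun x _ => ⟨i.succAbove x, x⟩) ?_ ?_ ?_ ?_ ?_ <;> aesop

theorem pushChain_single {X : Type u} {Y : Type v} [TopologicalSpace X] [TopologicalSpace Y]
    (f : C(X, Y)) {k : ℕ} (σ : SingularSimplex X k) (a : ℤ) :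
    pushChain f k (Finsupp.single σ a) = Finsupp.single (f.comp σ) a := by
  simp [pushChain, Finsupp.mapDomain_single]

theorem pushChain_comp {X : Type u} {Y : Type v} {Z : Type w} [TopologicalSpace X]
    [TopologicalSpace Y] [TopologicalSpace Z] (g : C(Y, Z)) (f : C(X, Y)) (k : ℕ) (c : Chain X k) :
    pushChain (g.comp f) k c = pushChain g k (pushChain f k c) := by
  simp only [pushChain, Finsupp.lmapDomain_apply, ← Finsupp.mapDomain_comp]
  rfl

theorem pushChain_id {X : Type u} [TopologicalSpace X] (k : ℕ) (c : Chain X k) :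
    pushChain (ContinuousMap.id X) k c = c := by
  simp only [pushChain, Finsupp.lmapDomain_apply, ContinuousMap.id_comp]
  exact Finsupp.mapDomain_id

theorem chain_hom_ext {X : Type u} [TopologicalSpace X] {k : ℕ} {N : Type w} [AddCommGroup N]
    {f g : Chain X k →ₗ[ℤ] N} (h : ∀ σ, f (Finsupp.single σ 1) = g (Finsupp.single σ 1)) :
    f = g := by
  refine Finsupp.lhom_ext' fun v => LinearMap.ext_ring ?_
  simpa using h v

theorem boundary_single {X : Type u} [TopologicalSpace X] {k : ℕ} (σ : SingularSimplex X (k + 1)) :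
    boundary X k (Finsupp.single σ 1)
      = ∑ i : Fin (k + 2), ((-1 : ℤ) ^ (i : ℕ)) • Finsupp.single (face i σ) (1 : ℤ) := by
  simp [boundary]

/-- The singular chain of an affine chain. -/
def affineChain (m k : ℕ) : VertexChain (Splx m) k →ₗ[ℤ] Chain (Splx m) k :=
  Finsupp.lmapDomain ℤ ℤ affineSimplex

@[simp] theorem affineChain_single {m k : ℕ} (v : Fin (k + 1) → Splx m) (a : ℤ) :
    affineChain m k (Finsupp.single v a) = Finsupp.single (affineSimplex v) a := by
  simp [affineChain, Finsupp.mapDomain_single]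

theorem boundary_affineChain (m k : ℕ) (c : VertexChain (Splx m) (k + 1)) :
    boundary _ k (affineChain m (k + 1) c) = affineChain m k (VertexChain.bd _ k c) := by
  suffices boundary _ k ∘ₗ affineChain m (k + 1) = affineChain m k ∘ₗ VertexChain.bd _ k
    from LinearMap.congr_fun this c
  refine VertexChain.hom_ext fun v => ?_
  simp [VertexChain.bd_single, boundary_single, face_affineSimplex]

theorem pushChain_affineChain {l m k : ℕ} (v : Fin (m + 1) → Splx l) (c : VertexChain (Splx m) k) :
    pushChain (affineSimplex v) k (affineChain m k c)
      = affineChain l k (VertexChain.map (affineSimplex v) k c) := by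
  suffices pushChain (affineSimplex v) k ∘ₗ affineChain m k
      = affineChain l k ∘ₗ VertexChain.map (affineSimplex v) k from LinearMap.congr_fun this c
  refine VertexChain.hom_ext fun w => ?_
  simp [pushChain_single, affineSimplex_comp]

/-- The tautological singular simplex of the standard simplex, as an affine chain. -/
def fundamentalTuple (k : ℕ) : VertexChain (Splx k) k := Finsupp.single (vertices k) 1

/-- The operator on singular chains with given values on the tautological simplices. -/
def inducedOp (X : Type u) [TopologicalSpace X] {k l : ℕ} (c : VertexChain (Splx k) l) :
    Chain X k →ₗ[ℤ] Chain X l :=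
  Finsupp.linearCombination ℤ fun σ => pushChain σ l (affineChain k l c)

theorem inducedOp_single {X : Type u} [TopologicalSpace X] {k l : ℕ} (c : VertexChain (Splx k) l)
    (σ : SingularSimplex X k) :
    inducedOp X c (Finsupp.single σ 1) = pushChain σ l (affineChain k l c) := by
  simp [inducedOp]

theorem pushChain_inducedOp {X : Type u} {Y : Type v} [TopologicalSpace X] [TopologicalSpace Y]
    (f : C(X, Y)) {k l : ℕ} (c : VertexChain (Splx k) l) (a : Chain X k) :
    pushChain f l (inducedOp X c a) = inducedOp Y c (pushChain f k a) := by
  suffices pushChain f l ∘ₗ inducedOp X c = inducedOp Y c ∘ₗ pushChain f k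
    from LinearMap.congr_fun this a
  refine chain_hom_ext fun σ => ?_
  simp [inducedOp_single, pushChain_single, pushChain_comp]

/-- Every tuple `v` is the image of the tautological tuple under `affineSimplex v`. Hence an
operation that is natural for affine maps agrees on all affine chains with the singular operation
built from its single value on the tautological tuple. -/
theorem inducedOp_affineChain {m k l : ℕ} {op : (m : ℕ) → VertexChain (Splx m) k →ₗ[ℤ]
      VertexChain (Splx m) l}
    (hop : ∀ (n m : ℕ) (v : Fin (n + 1) → Splx m) (c : VertexChain (Splx n) k),
      VertexChain.map (affineSimplex v) l (op n c) = op m (VertexChain.map (affineSimplex v) k c))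
    (c : VertexChain (Splx m) k) :
    inducedOp _ (op k (fundamentalTuple k)) (affineChain m k c) = affineChain m l (op m c) := by
  suffices inducedOp _ (op k (fundamentalTuple k)) ∘ₗ affineChain m k = affineChain m l ∘ₗ op m
    from LinearMap.congr_fun this c
  refine VertexChain.hom_ext fun v => ?_
  simp only [LinearMap.comp_apply, affineChain_single, inducedOp_single, pushChain_affineChain,
    hop, fundamentalTuple, VertexChain.map_single, affineSimplex_comp_vertices]

/-- The universal example: every singular simplex is the image of the identity simplex. Natural
identities between operators on singular chains thus reduce to affine chains in a standard simplex.
-/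
theorem single_eq_pushChain {X : Type u} [TopologicalSpace X] {k : ℕ} (σ : SingularSimplex X k) :
    (Finsupp.single σ 1 : Chain X k) = pushChain σ k (affineChain k k (fundamentalTuple k)) := by
  rw [fundamentalTuple, affineChain_single, pushChain_single, affineSimplex_vertices,
    ContinuousMap.comp_id]

theorem boundary_boundary {X : Type u} [TopologicalSpace X] (k : ℕ) (c : Chain X (k + 2)) :
    boundary X k (boundary X (k + 1) c) = 0 := by
  suffices boundary X k ∘ₗ boundary X (k + 1) = 0 from LinearMap.congr_fun this c
  refine chain_hom_ext fun σ => ?_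
  rw [LinearMap.comp_apply, single_eq_pushChain, pushChain_boundary, pushChain_boundary,
    boundary_affineChain, boundary_affineChain, VertexChain.bd_bd]
  simp

/-! ### Barycentric subdivision -/

/-- The barycenter of a tuple of points of a simplex. -/
def barycenter (m k : ℕ) (v : Fin (k + 1) → Splx m) : Splx m :=
  affineSimplex v stdSimplex.barycenter

theorem affineSimplex_barycenter {n m k : ℕ} (v : Fin (n + 1) → Splx m)
    (w : Fin (k + 1) → Splx n) :
    affineSimplex v (barycenter n k w) = barycenter m k (affineSimplex v ∘ w) := by
  rw [barycenter, barycenter, ← affineSimplex_comp]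
  rfl

/-- Barycentric subdivision of singular chains. -/
def subdiv (X : Type u) [TopologicalSpace X] (k : ℕ) : Chain X k →ₗ[ℤ] Chain X k :=
  inducedOp X (VertexChain.sd (barycenter k) k (fundamentalTuple k))

/-- The chain homotopy between the identity and barycentric subdivision. -/
def subdivHtpy (X : Type u) [TopologicalSpace X] (k : ℕ) : Chain X k →ₗ[ℤ] Chain X (k + 1) :=
  inducedOp X (VertexChain.sdHtpy (barycenter k) k (fundamentalTuple k))

theorem pushChain_subdiv {X : Type u} {Y : Type v} [TopologicalSpace X] [TopologicalSpace Y]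
    (f : C(X, Y)) (k : ℕ) (c : Chain X k) :
    pushChain f k (subdiv X k c) = subdiv Y k (pushChain f k c) := pushChain_inducedOp f _ c

theorem pushChain_subdivHtpy {X : Type u} {Y : Type v} [TopologicalSpace X] [TopologicalSpace Y]
    (f : C(X, Y)) (k : ℕ) (c : Chain X k) :
    pushChain f (k + 1) (subdivHtpy X k c) = subdivHtpy Y k (pushChain f k c) :=
  pushChain_inducedOp f _ c

theorem subdiv_affineChain {m k : ℕ} (c : VertexChain (Splx m) k) :
    subdiv _ k (affineChain m k c) = affineChain m k (VertexChain.sd (barycenter m) k c) :=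
  inducedOp_affineChain (op := fun m => VertexChain.sd (barycenter m) k)
    (fun _ _ v c => VertexChain.map_sd (fun _ _ => affineSimplex_barycenter v _) k c) c

theorem subdivHtpy_affineChain {m k : ℕ} (c : VertexChain (Splx m) k) :
    subdivHtpy _ k (affineChain m k c)
      = affineChain m (k + 1) (VertexChain.sdHtpy (barycenter m) k c) :=
  inducedOp_affineChain (op := fun m => VertexChain.sdHtpy (barycenter m) k)
    (fun _ _ v c => VertexChain.map_sdHtpy (fun _ _ => affineSimplex_barycenter v _) k c) c

theorem boundary_subdiv {X : Type u} [TopologicalSpace X] (k : ℕ) (c : Chain X (k + 1)) :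
    boundary X k (subdiv X (k + 1) c) = subdiv X k (boundary X k c) := by
  suffices boundary X k ∘ₗ subdiv X (k + 1) = subdiv X k ∘ₗ boundary X k
    from LinearMap.congr_fun this c
  refine chain_hom_ext fun σ => ?_
  rw [LinearMap.comp_apply, LinearMap.comp_apply, single_eq_pushChain, ← pushChain_subdiv,
    pushChain_boundary, pushChain_boundary, ← pushChain_subdiv, subdiv_affineChain,
    boundary_affineChain, boundary_affineChain, subdiv_affineChain, VertexChain.bd_sd]

theorem boundary_subdivHtpy {X : Type u} [TopologicalSpace X] (k : ℕ) (c : Chain X (k + 1)) :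
    boundary X (k + 1) (subdivHtpy X (k + 1) c) + subdivHtpy X k (boundary X k c)
      = c - subdiv X (k + 1) c := by
  suffices boundary X (k + 1) ∘ₗ subdivHtpy X (k + 1) + subdivHtpy X k ∘ₗ boundary X k
    = LinearMap.id - subdiv X (k + 1) from LinearMap.congr_fun this c
  refine chain_hom_ext fun σ => ?_
  simp only [LinearMap.add_apply, LinearMap.sub_apply, LinearMap.comp_apply, LinearMap.id_apply]
  rw [single_eq_pushChain, ← pushChain_subdiv, pushChain_boundary, ← pushChain_subdivHtpy,
    pushChain_boundary, ← pushChain_subdivHtpy, subdiv_affineChain, subdivHtpy_affineChain,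
    boundary_affineChain, boundary_affineChain, subdivHtpy_affineChain, ← map_add, ← map_add,
    VertexChain.bd_sdHtpy, map_sub, map_sub]

theorem single_mem_chainsIn {X : Type u} [TopologicalSpace X] {A : Set X} {k : ℕ}
    {σ : SingularSimplex X k} (h : Set.range σ ⊆ A) (a : ℤ) :
    (Finsupp.single σ a : Chain X k) ∈ chainsIn A k :=
  Finsupp.single_mem_supported ℤ a h

/-- A linear map sends finitely supported functions on `A` into a submodule as soon as it does so
on basis elements. -/
theorem map_mem_of_supported {α : Type u} {A : Set α} {N : Type w} [AddCommGroup N]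
    (f : (α →₀ ℤ) →ₗ[ℤ] N) (S : Submodule ℤ N) (h : ∀ a ∈ A, f (Finsupp.single a 1) ∈ S)
    {c : α →₀ ℤ} (hc : c ∈ Finsupp.supported ℤ ℤ A) : f c ∈ S := by
  rw [Finsupp.supported_eq_span_single] at hc
  refine (Submodule.span_le (p := S.comap f)).2 ?_ hc
  rintro _ ⟨a, ha, rfl⟩
  exact h a ha

/-- A linear map sends chains in `A` into a submodule as soon as it does so on simplices. -/
theorem map_mem_of_chainsIn {X : Type u} [TopologicalSpace X] {A : Set X} {k : ℕ} {N : Type w}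
    [AddCommGroup N] (f : Chain X k →ₗ[ℤ] N) (S : Submodule ℤ N)
    (h : ∀ σ : SingularSimplex X k, Set.range σ ⊆ A → f (Finsupp.single σ 1) ∈ S)
    {c : Chain X k} (hc : c ∈ chainsIn A k) : f c ∈ S :=
  map_mem_of_supported f S h hc

theorem pushChain_mem_chainsIn {X : Type u} {Y : Type v} [TopologicalSpace X] [TopologicalSpace Y]
    (f : C(X, Y)) {A : Set X} {B : Set Y} (h : Set.MapsTo f A B) {k : ℕ} {c : Chain X k}
    (hc : c ∈ chainsIn A k) : pushChain f k c ∈ chainsIn B k := by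
  refine map_mem_of_chainsIn _ _ (fun σ hσ => ?_) hc
  rw [pushChain_single]
  refine single_mem_chainsIn ?_ _
  rintro _ ⟨t, rfl⟩
  exact h (hσ ⟨t, rfl⟩)

theorem mem_chainsIn_univ {X : Type u} [TopologicalSpace X] {k : ℕ} (c : Chain X k) :
    c ∈ chainsIn Set.univ k := by
  simp [chainsIn, Finsupp.supported_univ]

theorem pushChain_simplex_mem_chainsIn {X : Type u} [TopologicalSpace X] {A : Set X} {k l : ℕ}
    {σ : SingularSimplex X k} (h : Set.range σ ⊆ A) (c : Chain (Splx k) l) :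
    pushChain σ l c ∈ chainsIn A l :=
  pushChain_mem_chainsIn σ (fun t _ => h ⟨t, rfl⟩) (mem_chainsIn_univ c)

theorem subdiv_mem_chainsIn {X : Type u} [TopologicalSpace X] {A : Set X} {k : ℕ} {c : Chain X k}
    (hc : c ∈ chainsIn A k) : subdiv X k c ∈ chainsIn A k :=
  map_mem_of_chainsIn _ _ (fun σ hσ => by
    rw [subdiv, inducedOp_single]; exact pushChain_simplex_mem_chainsIn hσ _) hc

theorem subdivHtpy_mem_chainsIn {X : Type u} [TopologicalSpace X] {A : Set X} {k : ℕ}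
    {c : Chain X k} (hc : c ∈ chainsIn A k) : subdivHtpy X k c ∈ chainsIn A (k + 1) :=
  map_mem_of_chainsIn _ _ (fun σ hσ => by
    rw [subdivHtpy, inducedOp_single]; exact pushChain_simplex_mem_chainsIn hσ _) hc

theorem boundary_mem_chainsIn {X : Type u} [TopologicalSpace X] {A : Set X} {k : ℕ}
    {c : Chain X (k + 1)} (hc : c ∈ chainsIn A (k + 1)) : boundary X k c ∈ chainsIn A k :=
  map_mem_of_chainsIn _ _ (fun σ hσ => by
    rw [single_eq_pushChain, pushChain_boundary]; exact pushChain_simplex_mem_chainsIn hσ _) hc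

/-! ### The prism operator -/

/-- The affine simplex in a product of two standard simplices. -/
def affineSimplexProd {m n k : ℕ} (v : Fin (k + 1) → Splx m × Splx n) :
    C(Splx k, Splx m × Splx n) :=
  (affineSimplex (Prod.fst ∘ v)).prodMk (affineSimplex (Prod.snd ∘ v))

/-- The singular chain of an affine chain in a product of two standard simplices. -/
def affineChainProd (m n k : ℕ) :
    VertexChain (Splx m × Splx n) k →ₗ[ℤ] Chain (Splx m × Splx n) k :=
  Finsupp.lmapDomain ℤ ℤ affineSimplexProd

@[simp] theorem affineChainProd_single {m n k : ℕ} (v : Fin (k + 1) → Splx m × Splx n) (a : ℤ) :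
    affineChainProd m n k (Finsupp.single v a) = Finsupp.single (affineSimplexProd v) a := by
  simp [affineChainProd, Finsupp.mapDomain_single]

theorem boundary_affineChainProd (m n k : ℕ) (c : VertexChain (Splx m × Splx n) (k + 1)) :
    boundary _ k (affineChainProd m n (k + 1) c)
      = affineChainProd m n k (VertexChain.bd _ k c) := by
  suffices boundary _ k ∘ₗ affineChainProd m n (k + 1)
    = affineChainProd m n k ∘ₗ VertexChain.bd _ k from LinearMap.congr_fun this c
  refine VertexChain.hom_ext fun v => ?_
  simp only [LinearMap.comp_apply, affineChainProd_single, VertexChain.bd_single, boundary_single,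
    map_sum, map_smul]
  refine Finset.sum_congr rfl fun i _ => ?_
  congr 2
  rw [affineSimplexProd, affineSimplexProd, ← Function.comp_assoc, ← Function.comp_assoc,
    ← face_affineSimplex, ← face_affineSimplex]
  rfl

/-- A map of the first factor, applied to a product. -/
def prodMapLeft {X : Type u} {Y : Type v} {Z : Type w} [TopologicalSpace X] [TopologicalSpace Y]
    [TopologicalSpace Z] (f : C(X, Y)) : C(X × Z, Y × Z) := f.prodMap (ContinuousMap.id Z)

theorem pushChain_affineChainProd {l m n k : ℕ} (v : Fin (m + 1) → Splx l)
    (c : VertexChain (Splx m × Splx n) k) :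
    pushChain (prodMapLeft (affineSimplex v)) k (affineChainProd m n k c)
      = affineChainProd l n k (VertexChain.map (Prod.map (affineSimplex v) id) k c) := by
  suffices pushChain (prodMapLeft (affineSimplex v)) k ∘ₗ affineChainProd m n k
      = affineChainProd l n k ∘ₗ VertexChain.map (Prod.map (affineSimplex v) id) k
    from LinearMap.congr_fun this c
  refine VertexChain.hom_ext fun w => ?_
  simp only [LinearMap.comp_apply, affineChainProd_single, pushChain_single, VertexChain.map_single]
  congr 1
  have h₁ : Prod.fst ∘ Prod.map (affineSimplex v) id ∘ w = affineSimplex v ∘ Prod.fst ∘ w := rfl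
  have h₂ : Prod.snd ∘ Prod.map (affineSimplex v) id ∘ w = Prod.snd ∘ w := rfl
  rw [affineSimplexProd, affineSimplexProd, h₁, h₂, ← affineSimplex_comp]
  rfl

/-- The end point inclusion of a space into its product with the standard `1`-simplex. -/
def prodEnd (X : Type u) [TopologicalSpace X] (i : Fin 2) : C(X, X × Splx 1) :=
  (ContinuousMap.id X).prodMk (ContinuousMap.const X (vertices 1 i))

/-- The universal prism. -/
def universalPrism (k : ℕ) : Chain (Splx k × Splx 1) (k + 1) :=
  affineChainProd k 1 (k + 1)
    (VertexChain.prism (vertices 1 0) (vertices 1 1) k (fundamentalTuple k))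

/-- The prism operator. -/
def prismOp (X : Type u) [TopologicalSpace X] (k : ℕ) :
    Chain X k →ₗ[ℤ] Chain (X × Splx 1) (k + 1) :=
  Finsupp.linearCombination ℤ fun σ => pushChain (prodMapLeft σ) (k + 1) (universalPrism k)

theorem prismOp_single {X : Type u} [TopologicalSpace X] {k : ℕ} (σ : SingularSimplex X k) :
    prismOp X k (Finsupp.single σ 1) = pushChain (prodMapLeft σ) (k + 1) (universalPrism k) := by
  simp [prismOp]

theorem pushChain_prismOp {X : Type u} {Y : Type v} [TopologicalSpace X] [TopologicalSpace Y]
    (f : C(X, Y)) (k : ℕ) (c : Chain X k) :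
    pushChain (prodMapLeft f) (k + 1) (prismOp X k c) = prismOp Y k (pushChain f k c) := by
  suffices pushChain (prodMapLeft f) (k + 1) ∘ₗ prismOp X k = prismOp Y k ∘ₗ pushChain f k
    from LinearMap.congr_fun this c
  refine chain_hom_ext fun σ => ?_
  simp only [LinearMap.comp_apply, prismOp_single, pushChain_single, ← pushChain_comp]
  rfl

theorem prismOp_affineChain {m k : ℕ} (c : VertexChain (Splx m) k) :
    prismOp _ k (affineChain m k c)
      = affineChainProd m 1 (k + 1) (VertexChain.prism (vertices 1 0) (vertices 1 1) k c) := by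
  suffices prismOp _ k ∘ₗ affineChain m k
      = affineChainProd m 1 (k + 1) ∘ₗ VertexChain.prism (vertices 1 0) (vertices 1 1) k
    from LinearMap.congr_fun this c
  refine VertexChain.hom_ext fun v => ?_
  simp only [LinearMap.comp_apply, affineChain_single, prismOp_single, universalPrism,
    pushChain_affineChainProd, VertexChain.map_prism, fundamentalTuple, VertexChain.map_single,
    affineSimplex_comp_vertices]

theorem affineSimplex_const {m k : ℕ} (x : Splx m) :
    affineSimplex (fun _ : Fin (k + 1) => x) = ContinuousMap.const _ x := by
  ext t j
  change affineSimplex (fun _ => x) t j = x j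
  rw [affineSimplex_apply, ← Finset.sum_mul, stdSimplex.sum_eq_one, one_mul]

theorem affineChainProd_map_end {m k : ℕ} (i : Fin 2) (c : VertexChain (Splx m) k) :
    affineChainProd m 1 k (VertexChain.map (fun x => (x, vertices 1 i)) k c)
      = pushChain (prodEnd _ i) k (affineChain m k c) := by
  suffices affineChainProd m 1 k ∘ₗ VertexChain.map (fun x => (x, vertices 1 i)) k
      = pushChain (prodEnd _ i) k ∘ₗ affineChain m k from LinearMap.congr_fun this c
  refine VertexChain.hom_ext fun v => ?_
  simp only [LinearMap.comp_apply, VertexChain.map_single, affineChainProd_single,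
    affineChain_single, pushChain_single]
  congr 1
  have : Prod.snd ∘ (fun x : Splx m => (x, vertices 1 i)) ∘ v = fun _ => vertices 1 i := rfl
  rw [affineSimplexProd, this, affineSimplex_const]
  rfl

theorem boundary_prismOp {X : Type u} [TopologicalSpace X] (k : ℕ) (c : Chain X (k + 1)) :
    boundary _ (k + 1) (prismOp X (k + 1) c) + prismOp X k (boundary X k c)
      = pushChain (prodEnd X 1) (k + 1) c - pushChain (prodEnd X 0) (k + 1) c := by
  suffices boundary _ (k + 1) ∘ₗ prismOp X (k + 1) + prismOp X k ∘ₗ boundary X k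
      = pushChain (prodEnd X 1) (k + 1) - pushChain (prodEnd X 0) (k + 1)
    from LinearMap.congr_fun this c
  refine chain_hom_ext fun σ => ?_
  have h : ∀ i : Fin 2, ∀ c : Chain (Splx (k + 1)) (k + 1),
      pushChain (prodEnd X i) (k + 1) (pushChain σ (k + 1) c)
        = pushChain (prodMapLeft σ) (k + 1) (pushChain (prodEnd _ i) (k + 1) c) := by
    intro i c
    rw [← pushChain_comp, ← pushChain_comp]
    rfl
  simp only [LinearMap.add_apply, LinearMap.sub_apply, LinearMap.comp_apply]
  rw [single_eq_pushChain, ← pushChain_prismOp, pushChain_boundary, pushChain_boundary,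
    ← pushChain_prismOp, prismOp_affineChain, boundary_affineChain, boundary_affineChainProd,
    prismOp_affineChain, ← map_add, ← map_add, VertexChain.bd_prism, map_sub, map_sub, h, h,
    affineChainProd_map_end, affineChainProd_map_end]

theorem prismOp_mem_chainsIn {X : Type u} [TopologicalSpace X] {A : Set X} {k : ℕ}
    {c : Chain X k} (hc : c ∈ chainsIn A k) :
    prismOp X k c ∈ chainsIn (Prod.fst ⁻¹' A) (k + 1) := by
  refine map_mem_of_chainsIn _ _ (fun σ hσ => ?_) hc
  rw [prismOp_single]
  exact pushChain_mem_chainsIn (A := Set.univ) (prodMapLeft σ)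
    (fun (t : Splx k × Splx 1) _ => hσ ⟨t.1, rfl⟩) (mem_chainsIn_univ _)

/-- Homotopic maps induce the same map on the homology of pairs. -/
theorem exists_homotopy_chain {X : Type u} {Y : Type v} [TopologicalSpace X] [TopologicalSpace Y]
    (F : C(X × Splx 1, Y)) {A : Set X} {B : Set Y}
    (hF : ∀ x ∈ A, ∀ t, F (x, t) ∈ B) {k : ℕ} {c : Chain X (k + 1)}
    (hc : boundary X k c ∈ chainsIn A k) :
    ∃ b : Chain Y (k + 2), ∃ e ∈ chainsIn B (k + 1),
      pushChain (F.comp (prodEnd X 1)) (k + 1) c - pushChain (F.comp (prodEnd X 0)) (k + 1) c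
        = boundary Y (k + 1) b + e := by
  refine ⟨pushChain F _ (prismOp X (k + 1) c), pushChain F _ (prismOp X k (boundary X k c)),
    pushChain_mem_chainsIn F (fun x hx => hF x.1 hx x.2) (prismOp_mem_chainsIn hc), ?_⟩
  rw [pushChain_boundary, ← map_add, boundary_prismOp, map_sub, pushChain_comp, pushChain_comp]

/-! ### Small chains -/

theorem dist_affineSimplex_le {m k : ℕ} {v : Fin (k + 1) → Splx m} {x : Splx m} {r : ℝ}
    (h : ∀ i, dist (v i) x ≤ r) (t : Splx k) : dist (affineSimplex v t) x ≤ r := by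
  have hr : 0 ≤ r := dist_nonneg.trans (h 0)
  rw [Subtype.dist_eq, dist_pi_le_iff hr]
  intro j
  have hj : ∀ i, |v i j - x j| ≤ r := fun i => by
    have := h i
    rw [Subtype.dist_eq, dist_pi_le_iff hr] at this
    exact this j
  change |affineSimplex v t j - x j| ≤ r
  have hx : x j = ∑ i, t i * x j := by
    rw [← Finset.sum_mul, stdSimplex.sum_eq_one, one_mul]
  rw [affineSimplex_apply, hx, ← Finset.sum_sub_distrib]
  refine (Finset.abs_sum_le_sum_abs _ _).trans ?_
  calc ∑ i, |t i * v i j - t i * x j| ≤ ∑ i, t i * r := by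
        refine Finset.sum_le_sum fun i _ => ?_
        rw [← mul_sub, abs_mul, abs_of_nonneg (stdSimplex.zero_le t i)]
        exact mul_le_mul_of_nonneg_left (hj i) (stdSimplex.zero_le t i)
    _ = r := by rw [← Finset.sum_mul, stdSimplex.sum_eq_one, one_mul]

theorem dist_barycenter_le {m k : ℕ} {v : Fin (k + 1) → Splx m} {d : ℝ}
    (h : ∀ i j, dist (v i) (v j) ≤ d) (i : Fin (k + 1)) :
    dist (v i) (barycenter m k v) ≤ k / (k + 1) * d := by
  have hd : 0 ≤ d := dist_nonneg.trans (h 0 0)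
  rw [Subtype.dist_eq, dist_pi_le_iff (by positivity)]
  intro j
  change |v i j - affineSimplex v stdSimplex.barycenter j| ≤ _
  have hb : ∀ l : Fin (k + 1), (stdSimplex.barycenter : Splx k) l = ((k : ℝ) + 1)⁻¹ := fun l => by
    change (stdSimplex.barycenter : Splx k).val l = _
    rw [stdSimplex.barycenter_apply]
    simp
  have hx : v i j = ∑ _l : Fin (k + 1), ((k : ℝ) + 1)⁻¹ * v i j := by
    rw [Finset.sum_const, Finset.card_univ, Fintype.card_fin, nsmul_eq_mul]
    push_cast
    field_simp
  rw [affineSimplex_apply, hx, ← Finset.sum_sub_distrib]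
  refine (Finset.abs_sum_le_sum_abs _ _).trans ?_
  -- Of the `k + 1` terms in the average, the one with `l = i` vanishes and each other is at most `d
  -- / (k + 1)`; this gives the factor `k / (k + 1)`.
  have hl : ∀ l, |((k : ℝ) + 1)⁻¹ * v i j - (stdSimplex.barycenter : Splx k) l * v l j|
      ≤ if l = i then 0 else ((k : ℝ) + 1)⁻¹ * d := by
    intro l
    rw [hb, ← mul_sub, abs_mul, abs_of_nonneg (by positivity)]
    split_ifs with hli
    · simp [hli]
    · refine mul_le_mul_of_nonneg_left ?_ (by positivity)
      have := h i l
      rw [Subtype.dist_eq, dist_pi_le_iff hd] at this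
      exact this j
  refine (Finset.sum_le_sum fun l _ => hl l).trans (le_of_eq ?_)
  rw [Finset.sum_ite, Finset.sum_const_zero, zero_add, Finset.sum_const,
    Finset.filter_ne' Finset.univ i, Finset.card_erase_of_mem (Finset.mem_univ i),
    Finset.card_univ, Fintype.card_fin, nsmul_eq_mul, Nat.add_sub_cancel]
  ring

namespace VertexChain

theorem cone_mem_supported {V : Type u} {b : V} {k : ℕ} {S : Set (Fin (k + 1) → V)}
    {S' : Set (Fin (k + 2) → V)} (h : ∀ w ∈ S, (Fin.cons b w : Fin (k + 2) → V) ∈ S')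
    {c : VertexChain V k} (hc : c ∈ Finsupp.supported ℤ ℤ S) :
    cone b k c ∈ Finsupp.supported ℤ ℤ S' := by
  refine map_mem_of_supported _ _ (fun w hw => ?_) hc
  rw [cone_single]
  exact Finsupp.single_mem_supported ℤ _ (h w hw)

/-- The second condition, that subdivision stays in every ball containing the vertices, is what
makes the induction run. Applied to the ball around the barycenter, it bounds the edges issuing from
the cone apex. -/
theorem sd_single_mem {m k : ℕ} {v : Fin (k + 1) → Splx m} {d : ℝ}
    (h : ∀ i j, dist (v i) (v j) ≤ d) :
    sd (barycenter m) k (Finsupp.single v 1) ∈ Finsupp.supported ℤ ℤ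
      {w | (∀ i j, dist (w i) (w j) ≤ k / (k + 1) * d) ∧
        ∀ x r, (∀ i, dist (v i) x ≤ r) → ∀ i, dist (w i) x ≤ r} := by
  induction k with
  | zero =>
    refine Finsupp.single_mem_supported ℤ _ ⟨fun i j => ?_, fun x r h => h⟩
    have : i = j := Subsingleton.elim (α := Fin 1) i j
    simp [this]
  | succ k ih =>
    have hd : 0 ≤ d := dist_nonneg.trans (h 0 0)
    have hk : (k : ℝ) / (k + 1) * d ≤ (k + 1 : ℕ) / ((k + 1 : ℕ) + 1) * d := by
      refine mul_le_mul_of_nonneg_right ?_ hd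
      rw [div_le_div_iff₀ (by positivity) (by positivity)]
      push_cast
      nlinarith
    rw [sd_succ_single]
    refine cone_mem_supported (S := {w | (∀ i j, dist (w i) (w j) ≤ k / (k + 1) * d) ∧
        ∀ x r, (∀ i, dist (v i) x ≤ r) → ∀ i, dist (w i) x ≤ r}) ?_ ?_
    · rintro w ⟨hw, hw'⟩
      have hb : ∀ i, dist (w i) (barycenter m (k + 1) v) ≤ (k + 1 : ℕ) / ((k + 1 : ℕ) + 1) * d :=
        hw' _ _ (dist_barycenter_le h)
      refine ⟨fun i j => ?_, fun x r hr i => ?_⟩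
      · refine Fin.cases ?_ (fun i => ?_) i <;> refine Fin.cases ?_ (fun j => ?_) j
        · simp only [Fin.cons_zero, dist_self]
          positivity
        · simpa [dist_comm] using hb j
        · simpa using hb i
        · simpa using (hw i j).trans hk
      · refine Fin.cases ?_ (fun i => ?_) i
        · exact dist_affineSimplex_le hr _
        · exact hw' x r hr i
    · rw [bd_single, map_sum]
      refine Submodule.sum_mem _ fun i _ => ?_
      rw [map_smul]
      refine Submodule.smul_mem _ _ ?_
      refine Finsupp.supported_mono ?_ (ih (v := v ∘ i.succAbove) fun a b => h _ _)
      rintro w ⟨hw, hw'⟩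
      exact ⟨hw, fun x r hr => hw' x r fun i => hr _⟩

theorem sd_pow_mem {m k : ℕ} (v : Fin (k + 1) → Splx m) (l : ℕ) :
    (sd (barycenter m) k ^ l) (Finsupp.single v 1) ∈ Finsupp.supported ℤ ℤ
      {w | ∀ i j, dist (w i) (w j) ≤ ((k : ℝ) / (k + 1)) ^ l} := by
  induction l with
  | zero =>
    refine Finsupp.single_mem_supported ℤ _ fun i j => ?_
    rw [pow_zero, Subtype.dist_eq, dist_pi_le_iff zero_le_one]
    intro a
    change |v i a - v j a| ≤ 1
    rw [abs_le]
    constructor <;> linarith [stdSimplex.zero_le (v i) a, stdSimplex.zero_le (v j) a,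
      stdSimplex.le_one (v i) a, stdSimplex.le_one (v j) a]
  | succ l ih =>
    rw [pow_succ' (sd (barycenter m) k), Module.End.mul_apply]
    refine map_mem_of_supported _ _ (fun w hw => ?_) ih
    refine Finsupp.supported_mono ?_ (sd_single_mem hw)
    rintro w' ⟨hw', -⟩ i j
    rw [pow_succ']
    exact hw' i j

end VertexChain

theorem subdiv_pow_affineChain {m k : ℕ} (l : ℕ) (c : VertexChain (Splx m) k) :
    (subdiv _ k ^ l) (affineChain m k c)
      = affineChain m k ((VertexChain.sd (barycenter m) k ^ l) c) := by
  induction l with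
  | zero => rfl
  | succ l ih =>
    rw [pow_succ', pow_succ', Module.End.mul_apply, Module.End.mul_apply, ih, subdiv_affineChain]

theorem pushChain_subdiv_pow {X : Type u} {Y : Type v} [TopologicalSpace X] [TopologicalSpace Y]
    (f : C(X, Y)) (k l : ℕ) (c : Chain X k) :
    pushChain f k ((subdiv X k ^ l) c) = (subdiv Y k ^ l) (pushChain f k c) := by
  induction l with
  | zero => rfl
  | succ l ih =>
    rw [pow_succ', pow_succ', Module.End.mul_apply, Module.End.mul_apply, pushChain_subdiv, ih]

section

variable {X : Type u} [TopologicalSpace X]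

theorem subdiv_pow_mem_chainsIn {A : Set X} {k : ℕ} (l : ℕ) {c : Chain X k}
    (hc : c ∈ chainsIn A k) : (subdiv X k ^ l) c ∈ chainsIn A k := by
  induction l with
  | zero => exact hc
  | succ l ih =>
    rw [pow_succ', Module.End.mul_apply]
    exact subdiv_mem_chainsIn ih

theorem boundary_subdiv_pow (k l : ℕ) (c : Chain X (k + 1)) :
    boundary X k ((subdiv X (k + 1) ^ l) c) = (subdiv X k ^ l) (boundary X k c) := by
  induction l with
  | zero => rfl
  | succ l ih =>
    rw [pow_succ', pow_succ', Module.End.mul_apply, Module.End.mul_apply, boundary_subdiv, ih]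

/-- A sufficiently fine iterated subdivision of a simplex is small with respect to a cover by two
open sets. -/
theorem exists_subdiv_pow_single_mem {U V : Set X} (hU : IsOpen U) (hV : IsOpen V) {k : ℕ}
    {σ : SingularSimplex X k} (hσ : Set.range σ ⊆ U ∪ V) :
    ∃ l, (subdiv X k ^ l) (Finsupp.single σ 1) ∈ chainsIn U k ⊔ chainsIn V k := by
  obtain ⟨δ, hδ, hball⟩ := lebesgue_number_lemma_of_metric (s := (Set.univ : Set (Splx k)))
    (c := fun b : Bool => cond b (σ ⁻¹' U) (σ ⁻¹' V)) isCompact_univ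
    (by rintro (_ | _); exacts [hV.preimage σ.continuous, hU.preimage σ.continuous])
    (by
      intro t _
      rcases hσ ⟨t, rfl⟩ with h | h
      · exact Set.mem_iUnion.2 ⟨true, h⟩
      · exact Set.mem_iUnion.2 ⟨false, h⟩)
  obtain ⟨l, hl⟩ := exists_pow_lt_of_lt_one hδ
    (show (k : ℝ) / (k + 1) < 1 by rw [div_lt_one (by positivity)]; linarith)
  refine ⟨l, ?_⟩
  rw [single_eq_pushChain, ← pushChain_subdiv_pow, subdiv_pow_affineChain, fundamentalTuple]
  refine map_mem_of_supported (pushChain σ k ∘ₗ affineChain k k) _ (fun w hw => ?_)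
    (VertexChain.sd_pow_mem (vertices k) l)
  rw [LinearMap.comp_apply, affineChain_single, pushChain_single]
  have hw' : ∀ t, affineSimplex w t ∈ Metric.ball (w 0) δ := fun t =>
    (dist_affineSimplex_le (fun i => hw i 0) t).trans_lt hl
  obtain ⟨b, hb⟩ := hball (w 0) (Set.mem_univ _)
  cases b with
  | false =>
    refine Submodule.mem_sup_right (single_mem_chainsIn ?_ _)
    rintro _ ⟨t, rfl⟩
    exact hb (hw' t)
  | true =>
    refine Submodule.mem_sup_left (single_mem_chainsIn ?_ _)
    rintro _ ⟨t, rfl⟩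
    exact hb (hw' t)

theorem exists_subdiv_pow_mem {U V : Set X} (hU : IsOpen U) (hV : IsOpen V) {k : ℕ}
    {c : Chain X k} (hc : c ∈ chainsIn (U ∪ V) k) :
    ∃ l, (subdiv X k ^ l) c ∈ chainsIn U k ⊔ chainsIn V k := by
  -- Small chains remain small under further subdivision, so the exponents found for two summands
  -- can be added.
  have hmono : ∀ (a : Chain X k) (l l' : ℕ), (subdiv X k ^ l) a ∈ chainsIn U k ⊔ chainsIn V k →
      (subdiv X k ^ (l' + l)) a ∈ chainsIn U k ⊔ chainsIn V k := by
    intro a l l' h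
    obtain ⟨x, hx, y, hy, hxy⟩ := Submodule.mem_sup.1 h
    rw [pow_add, Module.End.mul_apply, ← hxy, map_add]
    exact Submodule.add_mem_sup (subdiv_pow_mem_chainsIn l' hx) (subdiv_pow_mem_chainsIn l' hy)
  rw [chainsIn, Finsupp.supported_eq_span_single] at hc
  induction hc using Submodule.span_induction with
  | mem x hx =>
    obtain ⟨σ, hσ, rfl⟩ := hx
    exact exists_subdiv_pow_single_mem hU hV hσ
  | zero => exact ⟨0, by simp⟩
  | add x y _ _ hx hy =>
    obtain ⟨l, hl⟩ := hx
    obtain ⟨l', hl'⟩ := hy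
    refine ⟨l + l', ?_⟩
    rw [map_add]
    refine Submodule.add_mem _ ?_ (hmono _ _ _ hl')
    rw [add_comm]
    exact hmono _ _ _ hl
  | smul a x _ hx =>
    obtain ⟨l, hl⟩ := hx
    refine ⟨l, ?_⟩
    rw [map_smul]
    exact Submodule.smul_mem _ _ hl

/-- The chain homotopy between the identity and the `l`-fold iterated subdivision. -/
def iterHtpy (X : Type u) [TopologicalSpace X] (k l : ℕ) : Chain X k →ₗ[ℤ] Chain X (k + 1) :=
  ∑ i ∈ Finset.range l, subdivHtpy X k ∘ₗ subdiv X k ^ i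

theorem iterHtpy_mem_chainsIn {A : Set X} {k : ℕ} (l : ℕ) {c : Chain X k}
    (hc : c ∈ chainsIn A k) : iterHtpy X k l c ∈ chainsIn A (k + 1) := by
  rw [iterHtpy, LinearMap.sum_apply]
  exact Submodule.sum_mem _ fun i _ => subdivHtpy_mem_chainsIn (subdiv_pow_mem_chainsIn i hc)

theorem boundary_iterHtpy (k l : ℕ) (c : Chain X (k + 1)) :
    c = (subdiv X (k + 1) ^ l) c + boundary X (k + 1) (iterHtpy X (k + 1) l c)
      + iterHtpy X k l (boundary X k c) := by
  induction l with
  | zero => simp [iterHtpy]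
  | succ l ih =>
    have h := boundary_subdivHtpy k ((subdiv X (k + 1) ^ l) c)
    rw [boundary_subdiv_pow] at h
    simp only [iterHtpy, LinearMap.sum_apply, Finset.sum_range_succ, LinearMap.add_apply,
      LinearMap.comp_apply, map_add] at ih ⊢
    rw [pow_succ', Module.End.mul_apply]
    generalize (subdiv X (k + 1) ^ l) c = s at *
    generalize (subdiv X k ^ l) (boundary X k c) = s' at *
    calc c = (s - subdiv X (k + 1) s) + subdiv X (k + 1) s + _ + _ := by
          rw [sub_add_cancel]; exact ih
      _ = _ := by rw [← h]; abel

/-- Chains in the union of two open sets can be made small, by a subdivision which is compatible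
with all subspaces. -/
theorem exists_small {U V : Set X} (hU : IsOpen U) (hV : IsOpen V) {k : ℕ}
    {c : Chain X (k + 1)} (hc : c ∈ chainsIn (U ∪ V) (k + 1)) :
    ∃ l, ∃ a ∈ chainsIn U (k + 1), ∃ b ∈ chainsIn V (k + 1),
      c = a + b + boundary X (k + 1) (iterHtpy X (k + 1) l c)
        + iterHtpy X k l (boundary X k c) := by
  obtain ⟨l, hl⟩ := exists_subdiv_pow_mem hU hV hc
  obtain ⟨a, ha, b, hb, hab⟩ := Submodule.mem_sup.1 hl
  refine ⟨l, a, ha, b, hb, ?_⟩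
  rw [hab]
  exact boundary_iterHtpy k l c

/-! ### Excision and the Mayer–Vietoris principle -/

theorem mem_relBoundaries {A : Set X} {k : ℕ} {c : Chain X k} :
    c ∈ relBoundaries A k ↔ ∃ b, ∃ e ∈ chainsIn A k, c = boundary X k b + e := by
  constructor
  · intro h
    obtain ⟨_, ⟨b, rfl⟩, e, he, rfl⟩ := Submodule.mem_sup.1 h
    exact ⟨b, e, he, rfl⟩
  · rintro ⟨b, e, he, rfl⟩
    exact Submodule.add_mem_sup ⟨b, rfl⟩ he

theorem mem_relCycles {A : Set X} {k : ℕ} {c : Chain X (k + 1)} :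
    c ∈ relCycles A (k + 1) ↔ boundary X k c ∈ chainsIn A k := Iff.rfl

theorem chainsIn_mono {A B : Set X} (h : A ⊆ B) (k : ℕ) : chainsIn A k ≤ chainsIn B k :=
  Finsupp.supported_mono fun _ hσ => hσ.trans h

theorem chainsIn_inter {A B : Set X} {k : ℕ} {c : Chain X k} (hA : c ∈ chainsIn A k)
    (hB : c ∈ chainsIn B k) : c ∈ chainsIn (A ∩ B) k := by
  rw [chainsIn, Finsupp.mem_supported] at *
  exact fun σ hσ => Set.subset_inter (hA hσ) (hB hσ)

theorem chainsIn_empty {k : ℕ} {c : Chain X k} (h : c ∈ chainsIn (∅ : Set X) k) : c = 0 := by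
  rw [chainsIn, Finsupp.mem_supported] at h
  rw [← Finsupp.support_eq_empty, Finset.eq_empty_iff_forall_notMem]
  intro σ hσ
  exact h hσ ⟨vertices k 0, rfl⟩

theorem relBoundaries_mono {A B : Set X} (h : A ⊆ B) (k : ℕ) :
    relBoundaries A k ≤ relBoundaries B k :=
  sup_le_sup le_rfl (chainsIn_mono h k)

theorem relCycles_mono {A B : Set X} (h : A ⊆ B) (k : ℕ) : relCycles A k ≤ relCycles B k := by
  cases k with
  | zero => exact le_rfl
  | succ k => exact Submodule.comap_mono (chainsIn_mono h k)

theorem boundary_mem_relCycles (A : Set X) (k : ℕ) (b : Chain X (k + 1)) :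
    boundary X k b ∈ relCycles A k := by
  cases k with
  | zero => trivial
  | succ k =>
    rw [mem_relCycles, boundary_boundary]
    exact zero_mem _

theorem chainsIn_le_relCycles (A : Set X) (k : ℕ) : chainsIn A k ≤ relCycles A k := by
  cases k with
  | zero => exact le_top
  | succ k => exact fun c hc => boundary_mem_chainsIn hc

theorem relBoundaries_le_relCycles (A : Set X) (k : ℕ) : relBoundaries A k ≤ relCycles A k :=
  sup_le (by rintro _ ⟨b, rfl⟩; exact boundary_mem_relCycles A k b) (chainsIn_le_relCycles A k)

/-- Relative cycles can be made small: they are homologous to relative cycles in a given open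
neighbourhood. -/
theorem exists_relCycle_in {W A : Set X} (hW : IsOpen W) (hA : IsClosed A) (hAW : A ⊆ W) {k : ℕ}
    {c : Chain X (k + 1)} (hc : c ∈ relCycles Aᶜ (k + 1)) :
    ∃ a ∈ chainsIn W (k + 1), c - a ∈ relBoundaries Aᶜ (k + 1) := by
  have hWA : W ∪ Aᶜ = Set.univ := by
    rw [← Set.compl_subset_iff_union]
    exact Set.compl_subset_compl.2 hAW
  obtain ⟨l, a, ha, b, hb, h⟩ := exists_small hW hA.isOpen_compl (hWA ▸ mem_chainsIn_univ c)
  refine ⟨a, ha, mem_relBoundaries.2 ⟨iterHtpy X (k + 1) l c, b + iterHtpy X k l (boundary X k c),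
    add_mem hb (iterHtpy_mem_chainsIn l hc), ?_⟩⟩
  rw [sub_eq_iff_eq_add]
  nth_rw 1 [h]
  abel

/-- A chain in an open neighbourhood `W` of a closed set `A` which bounds relative to the complement
of `A` also does so inside of `W`. -/
theorem exists_boundary_in {W A : Set X} (hW : IsOpen W) (hA : IsClosed A) (hAW : A ⊆ W) {k : ℕ}
    {c : Chain X k} (hcW : c ∈ chainsIn W k) (hc : c ∈ relBoundaries Aᶜ k) :
    ∃ b ∈ chainsIn W (k + 1), ∃ e ∈ chainsIn (W ∩ Aᶜ) k, c = boundary X k b + e := by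
  have hWA : W ∪ Aᶜ = Set.univ := by
    rw [← Set.compl_subset_iff_union]
    exact Set.compl_subset_compl.2 hAW
  obtain ⟨β, e, he, rfl⟩ := mem_relBoundaries.1 hc
  obtain ⟨l, a, ha, b, hb, h⟩ := exists_small hW hA.isOpen_compl (hWA ▸ mem_chainsIn_univ β)
  set c := boundary X k β + e with hcdef
  have hβ : boundary X k β = c - e := by rw [hcdef, add_sub_cancel_right]
  have hbW : a + iterHtpy X k l c ∈ chainsIn W (k + 1) :=
    add_mem ha (iterHtpy_mem_chainsIn l hcW)
  -- The remainder of `c` after removing the boundary of a chain in `W` lies in `W` by its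
  -- definition, and in the complement of `A` by this second expression.
  have hce : c - boundary X k (a + iterHtpy X k l c)
      = boundary X k b - boundary X k (iterHtpy X k l e) + e := by
    have := congrArg (boundary X k) h
    rw [hβ] at this
    simp only [map_add, map_sub, boundary_boundary] at this ⊢
    rw [sub_eq_iff_eq_add] at this
    nth_rw 1 [this]
    abel
  refine ⟨_, hbW, c - boundary X k (a + iterHtpy X k l c),
    chainsIn_inter (sub_mem hcW (boundary_mem_chainsIn hbW)) ?_, by abel⟩
  rw [hce]
  exact add_mem (sub_mem (boundary_mem_chainsIn hb)
    (boundary_mem_chainsIn (iterHtpy_mem_chainsIn l he))) he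

/-- A class which vanishes at `A` and at `B` vanishes at `A ∪ B` if the homology at `A ∩ B` in the
next degree is trivial. -/
theorem mem_relBoundaries_union {A B : Set X} (hA : IsClosed A) (hB : IsClosed B) {k : ℕ}
    (h0 : relCycles (A ∩ B)ᶜ (k + 1) ≤ relBoundaries (A ∩ B)ᶜ (k + 1)) {c : Chain X k}
    (hcA : c ∈ relBoundaries Aᶜ k) (hcB : c ∈ relBoundaries Bᶜ k) :
    c ∈ relBoundaries (A ∪ B)ᶜ k := by
  obtain ⟨b₁, e₁, he₁, h₁⟩ := mem_relBoundaries.1 hcA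
  obtain ⟨b₂, e₂, he₂, h₂⟩ := mem_relBoundaries.1 hcB
  have hbb : boundary X k (b₁ - b₂) = e₂ - e₁ := by
    rw [map_sub, sub_eq_sub_iff_add_eq_add, ← h₁, add_comm, ← h₂]
  -- The difference of the two bounding chains is the connecting cycle at `A ∩ B`. Its triviality
  -- allows `b₁` and `b₂` to be corrected by pieces that avoid `A` and `B` respectively.
  have hcyc : b₁ - b₂ ∈ relCycles (A ∩ B)ᶜ (k + 1) := by
    rw [mem_relCycles, hbb]
    exact sub_mem (chainsIn_mono (Set.compl_subset_compl.2 Set.inter_subset_right) _ he₂)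
      (chainsIn_mono (Set.compl_subset_compl.2 Set.inter_subset_left) _ he₁)
  obtain ⟨w, e, he, hw⟩ := mem_relBoundaries.1 (h0 hcyc)
  rw [Set.compl_inter] at he
  obtain ⟨l, a, ha, b, hb, hab⟩ := exists_small hA.isOpen_compl hB.isOpen_compl he
  have hbe : boundary X k e = e₂ - e₁ := by
    rw [← hbb, hw, map_add, boundary_boundary, zero_add]
  set T := iterHtpy X k l
  have hf : a - T e₁ ∈ chainsIn Aᶜ (k + 1) := sub_mem ha (iterHtpy_mem_chainsIn l he₁)
  have hf' : b + T e₂ ∈ chainsIn Bᶜ (k + 1) := add_mem hb (iterHtpy_mem_chainsIn l he₂)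
  have hsum : boundary X k (a - T e₁) + boundary X k (b + T e₂) = e₂ - e₁ := by
    have := congrArg (boundary X k) hab
    rw [hbe] at this
    rw [← map_add, this]
    simp only [map_add, map_sub, boundary_boundary]
    abel
  -- The corrected remainder written in two ways: the left side avoids `A`, the right side avoids
  -- `B`.
  have heq : e₁ + boundary X k (a - T e₁) = e₂ - boundary X k (b + T e₂) := by
    rw [eq_sub_iff_add_eq, add_assoc, hsum]
    abel
  refine mem_relBoundaries.2 ⟨b₁ - (a - T e₁), e₁ + boundary X k (a - T e₁), ?_, ?_⟩
  · rw [Set.compl_union]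
    refine chainsIn_inter (add_mem he₁ (boundary_mem_chainsIn hf)) ?_
    rw [heq]
    exact sub_mem he₂ (boundary_mem_chainsIn hf')
  · rw [h₁, map_sub]
    abel

/-- Classes at `A` and at `B` which agree at `A ∩ B` come from a class at `A ∪ B`. -/
theorem exists_relCycle_union {A B : Set X} (hA : IsClosed A) (hB : IsClosed B) {k : ℕ}
    {α β : Chain X (k + 1)} (hα : α ∈ relCycles Aᶜ (k + 1)) (hβ : β ∈ relCycles Bᶜ (k + 1))
    (h : α - β ∈ relBoundaries (A ∩ B)ᶜ (k + 1)) :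
    ∃ γ ∈ relCycles (A ∪ B)ᶜ (k + 1), γ - α ∈ relBoundaries Aᶜ (k + 1) ∧
      γ - β ∈ relBoundaries Bᶜ (k + 1) := by
  obtain ⟨w, e, he, hw⟩ := mem_relBoundaries.1 h
  rw [Set.compl_inter] at he
  obtain ⟨l, a, ha, b, hb, hab⟩ := exists_small hA.isOpen_compl hB.isOpen_compl he
  have hbe : boundary X k e = boundary X k α - boundary X k β := by
    rw [← map_sub, hw, map_add, boundary_boundary, zero_add]
  set T := iterHtpy X k l
  rw [mem_relCycles] at hα hβ
  have hTα := iterHtpy_mem_chainsIn l hα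
  have hTβ := iterHtpy_mem_chainsIn l hβ
  -- The glued cycle, seen from `α` and from `β`: up to a boundary the two descriptions differ from
  -- `α` and `β` only by chains avoiding `A` and `B` respectively.
  have key : α - a - T (boundary X k α) = β + b - T (boundary X k β)
      + boundary X (k + 1) (w + iterHtpy X (k + 1) l e) := by
    rw [hbe, map_sub] at hab
    calc α - a - T (boundary X k α) = (α - β) + β - a - T (boundary X k α) := by abel
      _ = boundary X (k + 1) w + (a + b + boundary X (k + 1) (iterHtpy X (k + 1) l e)
          + (T (boundary X k α) - T (boundary X k β))) + β - a - T (boundary X k α) := by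
        rw [hw, ← hab]
      _ = _ := by rw [map_add]; abel
  refine ⟨α - a - T (boundary X k α), ?_, ?_, ?_⟩
  · rw [mem_relCycles, Set.compl_union]
    refine chainsIn_inter ?_ ?_
    · rw [map_sub, map_sub]
      exact sub_mem (sub_mem hα (boundary_mem_chainsIn ha)) (boundary_mem_chainsIn hTα)
    · rw [key, map_add, boundary_boundary, add_zero, map_sub, map_add]
      exact sub_mem (add_mem hβ (boundary_mem_chainsIn hb)) (boundary_mem_chainsIn hTβ)
  · refine mem_relBoundaries.2 ⟨0, -a - T (boundary X k α), sub_mem (neg_mem ha) hTα, ?_⟩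
    rw [map_zero]
    abel
  · refine mem_relBoundaries.2 ⟨w + iterHtpy X (k + 1) l e, b - T (boundary X k β),
      sub_mem hb hTβ, ?_⟩
    rw [key]
    abel

end

/-! ### Excision along open embeddings. -/

section OpenEmbedding

variable {U : Type v} {X : Type u} [TopologicalSpace U] [TopologicalSpace X]

theorem pushChain_injective {i : C(U, X)} (hi : Function.Injective i) (k : ℕ) :
    Function.Injective (pushChain i k) := by
  refine Finsupp.mapDomain_injective fun σ τ h => ?_
  ext t
  exact hi (DFunLike.congr_fun h t)

/-- Chains in the image of an embedding come from chains of the source. -/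
theorem exists_pushChain_eq {i : C(U, X)} (hi : Topology.IsEmbedding i) {B : Set U} {k : ℕ}
    {c : Chain X k} (hc : c ∈ chainsIn (i '' B) k) :
    ∃ c' ∈ chainsIn B k, pushChain i k c' = c := by
  suffices c ∈ (chainsIn B k).map (pushChain i k) by simpa using this
  refine map_mem_of_chainsIn LinearMap.id _ (fun σ hσ => ?_) hc
  have hσ' : ∀ t, σ t ∈ Set.range i := fun t => Set.image_subset_range _ _ (hσ ⟨t, rfl⟩)
  choose f hf using hσ'
  have hfc : Continuous f := by
    rw [hi.continuous_iff]
    exact σ.continuous.congr fun t => (hf t).symm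
  refine ⟨Finsupp.single ⟨f, hfc⟩ 1, single_mem_chainsIn ?_ _, ?_⟩
  · rintro _ ⟨t, rfl⟩
    obtain ⟨u, hu, hut⟩ := hσ ⟨t, rfl⟩
    rw [← hf t] at hut
    change f t ∈ B
    rwa [← hi.injective hut]
  · rw [pushChain_single, LinearMap.id_apply]
    congr 1
    ext t
    exact hf t

theorem mem_chainsIn_of_pushChain {i : C(U, X)} (hi : Function.Injective i) {B : Set X} {k : ℕ}
    {c : Chain U k} (hc : pushChain i k c ∈ chainsIn B k) : c ∈ chainsIn (i ⁻¹' B) k := by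
  rw [chainsIn, Finsupp.mem_supported] at *
  intro σ hσ
  have : i.comp σ ∈ (pushChain i k c).support := by
    rw [Finsupp.mem_support_iff, pushChain, Finsupp.lmapDomain_apply,
      Finsupp.mapDomain_apply (fun σ τ h => by ext t; exact hi (DFunLike.congr_fun h t))]
    simpa using hσ
  rintro _ ⟨t, rfl⟩
  exact hc this ⟨t, rfl⟩

theorem pushChain_mem_relBoundaries (f : C(U, X)) {A : Set U} {B : Set X} (h : Set.MapsTo f A B)
    {k : ℕ} {c : Chain U k} (hc : c ∈ relBoundaries A k) :
    pushChain f k c ∈ relBoundaries B k := by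
  obtain ⟨b, e, he, rfl⟩ := mem_relBoundaries.1 hc
  exact mem_relBoundaries.2 ⟨pushChain f _ b, _, pushChain_mem_chainsIn f h he, by
    rw [map_add, pushChain_boundary]⟩

theorem pushChain_mem_relCycles (f : C(U, X)) {A : Set U} {B : Set X} (h : Set.MapsTo f A B)
    {k : ℕ} {c : Chain U k} (hc : c ∈ relCycles A k) :
    pushChain f k c ∈ relCycles B k := by
  cases k with
  | zero => trivial
  | succ k =>
    rw [mem_relCycles, pushChain_boundary]
    exact pushChain_mem_chainsIn f h hc

/-- Excision, surjectivity. -/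
theorem exists_pushChain_sub_mem {i : C(U, X)} (hi : Topology.IsOpenEmbedding i) {A : Set U}
    (hA : IsClosed (i '' A)) {k : ℕ} {c : Chain X (k + 1)} (hc : c ∈ relCycles (i '' A)ᶜ (k + 1)) :
    ∃ a ∈ relCycles Aᶜ (k + 1), c - pushChain i (k + 1) a ∈ relBoundaries (i '' A)ᶜ (k + 1) := by
  obtain ⟨a, ha, h⟩ := exists_relCycle_in hi.isOpen_range hA (Set.image_subset_range _ _) hc
  rw [← Set.image_univ] at ha
  obtain ⟨a', -, rfl⟩ := exists_pushChain_eq hi.isEmbedding ha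
  refine ⟨a', ?_, h⟩
  have hcyc := sub_mem hc (relBoundaries_le_relCycles _ _ h)
  rw [sub_sub_cancel, mem_relCycles, pushChain_boundary] at hcyc
  have := mem_chainsIn_of_pushChain hi.injective hcyc
  rwa [Set.preimage_compl, Set.preimage_image_eq _ hi.injective] at this

/-- Excision, injectivity. -/
theorem mem_relBoundaries_of_pushChain {i : C(U, X)} (hi : Topology.IsOpenEmbedding i) {A : Set U}
    (hA : IsClosed (i '' A)) {k : ℕ} {c : Chain U k}
    (hc : pushChain i k c ∈ relBoundaries (i '' A)ᶜ k) : c ∈ relBoundaries Aᶜ k := by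
  obtain ⟨b, hb, e, he, h⟩ := exists_boundary_in hi.isOpen_range hA (Set.image_subset_range _ _)
    (pushChain_mem_chainsIn (A := Set.univ) (B := Set.range i) i (fun x _ => Set.mem_range_self x)
      (mem_chainsIn_univ c)) hc
  rw [← Set.image_univ] at hb
  have he' : e ∈ chainsIn (i '' Aᶜ) k := by
    refine chainsIn_mono ?_ _ he
    rintro _ ⟨⟨x, rfl⟩, hx⟩
    exact ⟨x, fun hxA => hx ⟨x, hxA, rfl⟩, rfl⟩
  obtain ⟨b', -, rfl⟩ := exists_pushChain_eq hi.isEmbedding hb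
  obtain ⟨e', he'', rfl⟩ := exists_pushChain_eq hi.isEmbedding he'
  refine mem_relBoundaries.2 ⟨b', e', he'', pushChain_injective hi.injective k ?_⟩
  rw [h, map_add, pushChain_boundary]

end OpenEmbedding

/-! ### Local homology of Euclidean space -/

section

variable {X : Type u} {Y : Type v} [TopologicalSpace X] [TopologicalSpace Y]

/-- A chain involves finitely many simplices with compact images. Compactness of the support turns
pointwise separation from a closed set into a uniform distance, so that a deformation of bounded
size can push the chain off. -/
theorem exists_isCompact_chainsIn {A : Set X} {k : ℕ} {c : Chain X k} (hc : c ∈ chainsIn A k) :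
    ∃ K ⊆ A, IsCompact K ∧ c ∈ chainsIn K k := by
  refine ⟨⋃ σ ∈ c.support, Set.range σ, Set.iUnion₂_subset fun σ hσ => ?_,
    c.support.isCompact_biUnion fun σ _ => isCompact_range σ.continuous, ?_⟩
  · rw [chainsIn, Finsupp.mem_supported] at hc
    exact hc hσ
  · rw [chainsIn, Finsupp.mem_supported]
    exact fun σ hσ => Set.subset_biUnion_of_mem (u := fun σ : SingularSimplex X k => Set.range σ) hσ

theorem relBoundaries_univ (k : ℕ) : relBoundaries (Set.univ : Set X) k = ⊤ :=
  eq_top_iff.2 fun c _ => mem_relBoundaries.2 ⟨0, c, mem_chainsIn_univ c, by simp⟩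

/-- If a deformation preserves the complement of `A` and moves a relative cycle to a relative
boundary, then the relative cycle is a relative boundary. -/
theorem mem_relBoundaries_of_deformation (F : C(X × Splx 1, X)) {A : Set X}
    (h0 : ∀ x, F (x, vertices 1 0) = x) (hF : ∀ x ∈ A, ∀ t, F (x, t) ∈ A) {k : ℕ}
    {c : Chain X (k + 1)} (hc : c ∈ relCycles A (k + 1))
    (h1 : pushChain (F.comp (prodEnd X 1)) (k + 1) c ∈ relBoundaries A (k + 1)) :
    c ∈ relBoundaries A (k + 1) := by
  obtain ⟨b, e, he, h⟩ := exists_homotopy_chain F hF hc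
  have hid : F.comp (prodEnd X 0) = ContinuousMap.id X := by
    ext x
    exact h0 x
  rw [hid, pushChain_id] at h
  have := sub_mem h1 (mem_relBoundaries.2 ⟨b, e, he, h⟩)
  rwa [sub_sub_cancel] at this

theorem relCycles_le_of_homeomorph (e : X ≃ₜ Y) {A : Set X} {k : ℕ}
    (h : relCycles Aᶜ k ≤ relBoundaries Aᶜ k) :
    relCycles (e '' A)ᶜ k ≤ relBoundaries (e '' A)ᶜ k := by
  intro c hc
  have h1 : Set.MapsTo e.symm (e '' A)ᶜ Aᶜ := fun y hy hA => hy ⟨e.symm y, hA, by simp⟩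
  have h2 : Set.MapsTo e Aᶜ (e '' A)ᶜ := by
    rintro x hx ⟨y, hy, hxy⟩
    exact hx (e.injective hxy ▸ hy)
  have := pushChain_mem_relBoundaries ⟨e, e.continuous⟩ h2
    (h (pushChain_mem_relCycles ⟨e.symm, e.symm.continuous⟩ h1 hc))
  rw [← pushChain_comp] at this
  convert this
  conv_lhs => rw [← pushChain_id k c]
  congr 1
  ext y
  simp

/-- Start of the induction on the dimension. Over a point there is one simplex in each degree and
the boundary is alternately zero and the identity: for even `k` a chain of degree `k + 1` is a
boundary, for odd `k` a cycle of that degree is zero. -/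
theorem relCycles_le_of_subsingleton [Subsingleton X] (A : Set X) (k : ℕ) :
    relCycles Aᶜ (k + 1) ≤ relBoundaries Aᶜ (k + 1) := by
  intro c hc
  by_cases hA : A = ∅
  · rw [hA, Set.compl_empty, relBoundaries_univ]
    trivial
  have hA' : Aᶜ = ∅ := by
    obtain ⟨x, hx⟩ := Set.nonempty_iff_ne_empty.2 hA
    exact Set.eq_empty_of_forall_notMem fun y hy => hy (Subsingleton.elim x y ▸ hx)
  rw [hA', mem_relCycles] at hc
  have hc := chainsIn_empty hc
  obtain ⟨x, -⟩ := Set.nonempty_iff_ne_empty.2 hA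
  have hconst : ∀ (l : ℕ) (σ : SingularSimplex X l), σ = ContinuousMap.const _ x := fun l σ => by
    ext t
    exact Subsingleton.elim _ _
  have hbd : ∀ l, boundary X l (Finsupp.single (ContinuousMap.const _ x) 1)
      = (if Even (l + 2) then 0 else 1 : ℤ) • Finsupp.single (ContinuousMap.const _ x) 1 := by
    intro l
    rw [boundary_single, ← Fin.sum_neg_one_pow, Finset.sum_smul]
    refine Finset.sum_congr rfl fun i _ => ?_
    rw [hconst l (face i _)]
  obtain ⟨a, rfl⟩ : ∃ a : ℤ, c = a • Finsupp.single (ContinuousMap.const _ x) 1 := by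
    refine ⟨c (ContinuousMap.const _ x), ?_⟩
    ext σ
    rw [hconst _ σ]
    simp
  rw [map_smul, hbd] at hc
  by_cases hk : Even k
  · have hk2 : ¬ Even (k + 1 + 2) := by
      rw [Nat.even_iff] at *
      omega
    refine mem_relBoundaries.2 ⟨a • Finsupp.single (ContinuousMap.const _ x) 1, 0, zero_mem _, ?_⟩
    rw [map_smul, hbd, if_neg hk2, one_smul, add_zero]
  · have hk2 : ¬ Even (k + 2) := by
      rw [Nat.even_iff] at *
      omega
    rw [if_neg hk2, one_smul] at hc
    have := DFunLike.congr_fun hc (ContinuousMap.const _ x)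
    simp only [Finsupp.smul_apply, Finsupp.single_eq_same, Finsupp.coe_zero, Pi.zero_apply,
      smul_eq_mul, mul_one] at this
    rw [this, zero_smul]
    exact zero_mem _

/-- The second barycentric coordinate on the standard `1`-simplex. -/
def param : C(Splx 1, ℝ) := ⟨fun t => t 1, (continuous_apply 1).comp continuous_subtype_val⟩

theorem param_nonneg (t : Splx 1) : 0 ≤ param t := stdSimplex.zero_le t 1

theorem param_zero : param (vertices 1 0) = 0 := by
  change (vertices 1 0) 1 = 0
  simp [vertices]

theorem param_one : param (vertices 1 1) = 1 := by
  change (vertices 1 1) 1 = 1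
  simp [vertices]

end

section LocalHomology

variable {E : Type u} [NormedAddCommGroup E]

/-- The half line in the last coordinate direction with sign `s`. -/
def halfLine (E : Type u) [NormedAddCommGroup E] (s : ℝ) : Set (E × ℝ) :=
  {p | p.1 = 0 ∧ 0 ≤ s * p.2}

theorem isClosed_halfLine (s : ℝ) : IsClosed (halfLine E s) :=
  (isClosed_eq continuous_fst continuous_const).inter
    (isClosed_le continuous_const (continuous_const.mul continuous_snd))

/-- There is no homology relative to the complement of a half line. -/
theorem relCycles_halfLine_le {s : ℝ} (hs : s ≠ 0) (k : ℕ) :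
    relCycles (halfLine E s)ᶜ (k + 1) ≤ relBoundaries (halfLine E s)ᶜ (k + 1) := by
  intro c hc
  obtain ⟨K, -, hK, hcK⟩ := exists_isCompact_chainsIn (mem_chainsIn_univ c)
  obtain ⟨L, hL⟩ := (hK.image (f := fun p : E × ℝ => s * p.2) (by fun_prop)).bddAbove
  -- A translation that lowers `s * p.2` by `|L| + 1` at time `1`. Points off the half line stay off
  -- it, and the support of `c`, where `s * p.2 ≤ L`, ends up entirely off it.
  let F : C((E × ℝ) × Splx 1, E × ℝ) :=
    ⟨fun q => (q.1.1, q.1.2 - s * (|L| + 1) / s ^ 2 * param q.2), by fun_prop⟩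
  have hFs : ∀ p t, s * (F (p, t)).2 = s * p.2 - (|L| + 1) * param t := by
    intro p t
    change s * (p.2 - s * (|L| + 1) / s ^ 2 * param t) = _
    field_simp
  refine mem_relBoundaries_of_deformation (A := (halfLine E s)ᶜ) F (fun x => ?_)
    (fun p hp t hpt => hp ⟨hpt.1, ?_⟩) hc ?_
  · change (x.1, x.2 - s * (|L| + 1) / s ^ 2 * param (vertices 1 0)) = x
    rw [param_zero, mul_zero, sub_zero]
  · have := hpt.2
    rw [hFs] at this
    have h2 : 0 ≤ (|L| + 1) * param t := mul_nonneg (by positivity) (param_nonneg t)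
    linarith
  · refine mem_relBoundaries.2 ⟨0, _, pushChain_mem_chainsIn _ ?_ hcK, by rw [map_zero, zero_add]⟩
    intro p hp hp'
    have h1 : 0 ≤ s * (F (p, vertices 1 1)).2 := hp'.2
    rw [hFs, param_one] at h1
    have h2 : s * p.2 ≤ L := hL ⟨p, hp, rfl⟩
    linarith [le_abs_self L]

/-- Contracting the `ℝ`-factor preserves the complement of the line and factors, at time `1`,
through `E` with its punctured complement. -/
theorem relCycles_line_le {k : ℕ}
    (h : relCycles ({0}ᶜ : Set E) (k + 1) ≤ relBoundaries {0}ᶜ (k + 1)) :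
    relCycles ({p : E × ℝ | p.1 = 0}ᶜ) (k + 1) ≤ relBoundaries {p : E × ℝ | p.1 = 0}ᶜ (k + 1) := by
  intro c hc
  let F : C((E × ℝ) × Splx 1, E × ℝ) :=
    ⟨fun q => (q.1.1, q.1.2 * (1 - param q.2)), by fun_prop⟩
  let p : C(E × ℝ, E) := ⟨Prod.fst, continuous_fst⟩
  let j : C(E, E × ℝ) := ⟨fun x => (x, 0), by fun_prop⟩
  refine mem_relBoundaries_of_deformation (A := {p : E × ℝ | p.1 = 0}ᶜ) F (fun x => ?_)
    (fun p hp t hpt => hp hpt) hc ?_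
  · change (x.1, x.2 * (1 - param (vertices 1 0))) = x
    rw [param_zero, sub_zero, mul_one]
  · have hF : F.comp (prodEnd _ 1) = j.comp p := by
      ext x
      · rfl
      · change x.2 * (1 - param (vertices 1 1)) = 0
        rw [param_one, sub_self, mul_zero]
    rw [hF, pushChain_comp]
    refine pushChain_mem_relBoundaries j (A := {0}ᶜ) (B := {p : E × ℝ | p.1 = 0}ᶜ) (fun x hx hx' => hx hx') (h ?_)
    exact pushChain_mem_relCycles p (A := {p : E × ℝ | p.1 = 0}ᶜ) (B := {0}ᶜ)
      (fun x hx hx' => hx hx') hc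

/-- Suspension by Mayer–Vietoris: the punctured product is the union of the complements of two
opposite half lines, and these meet in the complement of the line. Splitting the boundary of `c` as
`a + b` produces a relative cycle `a` of the line complement. It bounds by `relCycles_line_le`, and
the resulting chain `w` splits `c` into two relative cycles, one for each half line, both of which
bound. -/
theorem relCycles_prod_le {k : ℕ}
    (h : relCycles ({0}ᶜ : Set E) (k + 1) ≤ relBoundaries {0}ᶜ (k + 1)) :
    relCycles ({0}ᶜ : Set (E × ℝ)) (k + 2) ≤ relBoundaries {0}ᶜ (k + 2) := by
  intro c hc
  have hinter : ({0}ᶜ : Set (E × ℝ)) = (halfLine E 1)ᶜ ∪ (halfLine E (-1))ᶜ := by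
    rw [← Set.compl_inter]
    congr 1
    ext ⟨x, r⟩
    simp only [halfLine, Set.mem_singleton_iff, Prod.mk_eq_zero, Set.mem_inter_iff,
      Set.mem_ofPred_eq]
    constructor
    · rintro ⟨rfl, rfl⟩
      simp
    · rintro ⟨⟨rfl, h1⟩, -, h2⟩
      exact ⟨rfl, by linarith⟩
  have hline : {p : E × ℝ | p.1 = 0}ᶜ = (halfLine E 1)ᶜ ∩ (halfLine E (-1))ᶜ := by
    rw [← Set.compl_union]
    congr 1
    ext ⟨x, r⟩
    simp only [halfLine, Set.mem_union, Set.mem_ofPred_eq]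
    constructor
    · rintro rfl
      rcases le_total 0 r with h | h
      · exact Or.inl ⟨rfl, by linarith⟩
      · exact Or.inr ⟨rfl, by linarith⟩
    · rintro (h | h) <;> exact h.1
  have hsub : ∀ s : ℝ, (halfLine E s)ᶜ ⊆ ({0}ᶜ : Set (E × ℝ)) := by
    intro s p hp h0
    rw [Set.mem_singleton_iff] at h0
    exact hp (by simp [halfLine, h0])
  have hc' := mem_relCycles.1 hc
  have hcu := hc'
  rw [hinter] at hcu
  obtain ⟨l, a, ha, b, hb, hab⟩ := exists_small (isClosed_halfLine 1).isOpen_compl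
    (isClosed_halfLine (-1)).isOpen_compl hcu
  rw [boundary_boundary, map_zero, add_zero] at hab
  have hT := iterHtpy_mem_chainsIn l hc'
  set T := iterHtpy (E × ℝ) (k + 1) l (boundary _ (k + 1) c)
  have hab0 : boundary _ k a = - boundary _ k b := by
    have := congrArg (boundary _ k) hab
    rw [map_add, map_add, boundary_boundary, boundary_boundary, add_zero] at this
    rw [eq_neg_iff_add_eq_zero, this]
  have haz : a ∈ relCycles {p : E × ℝ | p.1 = 0}ᶜ (k + 1) := by
    rw [mem_relCycles, hline]
    refine chainsIn_inter (boundary_mem_chainsIn ha) ?_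
    rw [hab0]
    exact neg_mem (boundary_mem_chainsIn hb)
  obtain ⟨w, a', ha', haw⟩ := mem_relBoundaries.1 (relCycles_line_le h haz)
  rw [hline] at ha'
  have hw : w ∈ relBoundaries ({0}ᶜ : Set (E × ℝ)) (k + 2) := by
    refine relBoundaries_mono (hsub 1) _ (relCycles_halfLine_le one_ne_zero _ ?_)
    rw [mem_relCycles, eq_sub_of_add_eq haw.symm]
    exact sub_mem ha (chainsIn_mono Set.inter_subset_left _ ha')
  have hcw : c - T - w ∈ relBoundaries ({0}ᶜ : Set (E × ℝ)) (k + 2) := by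
    refine relBoundaries_mono (hsub (-1)) _ (relCycles_halfLine_le (by norm_num) _ ?_)
    rw [mem_relCycles, map_sub, map_sub, hab, add_sub_cancel_right, haw]
    have : boundary _ (k + 1) w + a' + b - boundary _ (k + 1) w = a' + b := by abel
    rw [this]
    exact add_mem (chainsIn_mono Set.inter_subset_right _ ha') hb
  have hTb : T ∈ relBoundaries ({0}ᶜ : Set (E × ℝ)) (k + 2) :=
    mem_relBoundaries.2 ⟨0, T, hT, by simp⟩
  have := add_mem (add_mem hcw hw) hTb
  simpa using this

/-- The local homology of Euclidean space vanishes above the dimension. -/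
theorem relCycles_point_le (n : ℕ) (x : EuclideanSpace ℝ (Fin n)) (k : ℕ) (hk : n ≤ k) :
    relCycles {x}ᶜ (k + 1) ≤ relBoundaries {x}ᶜ (k + 1) := by
  have h0 : ∀ k, n ≤ k → relCycles ({0}ᶜ : Set (EuclideanSpace ℝ (Fin n))) (k + 1)
      ≤ relBoundaries {0}ᶜ (k + 1) := by
    clear hk k x
    induction n with
    | zero => exact fun k _ => relCycles_le_of_subsingleton _ k
    | succ n ih =>
      intro k hk
      obtain ⟨k, rfl⟩ : ∃ l, k = l + 1 := ⟨k - 1, by omega⟩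
      have e : (EuclideanSpace ℝ (Fin n) × ℝ) ≃L[ℝ] EuclideanSpace ℝ (Fin (n + 1)) :=
        ContinuousLinearEquiv.ofFinrankEq (by simp)
      have := relCycles_le_of_homeomorph e.toHomeomorph (relCycles_prod_le (ih k (by omega)))
      simpa using this
  have := relCycles_le_of_homeomorph (Homeomorph.addRight x) (h0 k hk)
  simpa using this

variable [NormedSpace ℝ E]

/-- A relative cycle which bounds at a point of a convex compact set bounds at the whole set. -/
theorem mem_relBoundaries_of_convex {A : Set E} (hA : Convex ℝ A) (hAc : IsCompact A) {x : E}
    (hx : x ∈ A) {k : ℕ} {c : Chain E (k + 1)} (hc : c ∈ relCycles Aᶜ (k + 1))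
    (h : c ∈ relBoundaries {x}ᶜ (k + 1)) : c ∈ relBoundaries Aᶜ (k + 1) := by
  obtain ⟨b, e, he, rfl⟩ := mem_relBoundaries.1 h
  obtain ⟨K, hKx, hK, heK⟩ := exists_isCompact_chainsIn he
  obtain ⟨δ, hδ, hKδ⟩ : ∃ δ > 0, ∀ y ∈ K, δ ≤ ‖y - x‖ := by
    obtain ⟨δ, hδ, h⟩ := Metric.isOpen_iff.1 hK.isClosed.isOpen_compl x (fun hxK => hKx hxK rfl)
    refine ⟨δ, hδ, fun y hy => ?_⟩
    by_contra! hlt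
    exact h (mem_ball_iff_norm.2 hlt) hy
  obtain ⟨R, hR⟩ := hAc.isBounded.subset_closedBall x
  -- Radial expansion away from `x`. Factors are at least `1`, so by convexity no point outside `A`
  -- enters `A`. The final factor `2 + |R| / δ` moves points at distance at least `δ` from `x` to
  -- distance at least `|R| + 2 * δ`, beyond a ball containing `A`.
  let F : C(E × Splx 1, E) := ⟨fun q => x + (1 + |R| / δ * param q.2 + param q.2) • (q.1 - x), by
    fun_prop⟩
  have hFx : ∀ y t, F (y, t) = x + (1 + |R| / δ * param t + param t) • (y - x) := fun _ _ => rfl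
  refine mem_relBoundaries_of_deformation (A := Aᶜ) F (fun y => ?_) (fun y hy t hyt => hy ?_) hc ?_
  · rw [hFx, param_zero]
    simp
  · have hp := param_nonneg t
    have hpos : 1 ≤ 1 + |R| / δ * param t + param t := by
      have : 0 ≤ |R| / δ * param t := by positivity
      linarith
    rw [hFx] at hyt
    set s := 1 + |R| / δ * param t + param t
    have : y = x + s⁻¹ • ((x + s • (y - x)) - x) := by
      rw [add_sub_cancel_left, smul_smul, inv_mul_cancel₀ (by linarith), one_smul]
      abel
    rw [this]
    exact hA.add_smul_sub_mem hx hyt ⟨by positivity, inv_le_one_of_one_le₀ hpos⟩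
  · refine mem_relBoundaries.2 ⟨pushChain (F.comp (prodEnd E 1)) _ b, _,
      pushChain_mem_chainsIn (F.comp (prodEnd E 1)) ?_ heK, by rw [map_add, pushChain_boundary]⟩
    intro y hy hyA
    have h1 := hR hyA
    change F (y, vertices 1 1) ∈ _ at h1
    rw [hFx, param_one, mem_closedBall_iff_norm, add_sub_cancel_left, norm_smul,
      Real.norm_eq_abs, mul_one, abs_of_nonneg (by positivity)] at h1
    have h2 := hKδ y hy
    have h3 : (1 + |R| / δ + 1) * δ ≤ (1 + |R| / δ + 1) * ‖y - x‖ :=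
      mul_le_mul_of_nonneg_left h2 (by positivity)
    have h4 : (1 + |R| / δ + 1) * δ = |R| + 2 * δ := by
      field_simp
      ring
    linarith [le_abs_self R]

end LocalHomology

/-! ### Homology of a manifold relative to the complement of a compact set -/

section Manifold

variable {X : Type u} [TopologicalSpace X]

/-- The homology of `X` relative to the complement of `A` vanishes above degree `m + 1` and is
detected at the points of `A` in degree `m + 1`. -/
structure IsControlled (m : ℕ) (A : Set X) : Prop where
  le : ∀ k, m + 1 ≤ k → relCycles Aᶜ (k + 1) ≤ relBoundaries Aᶜ (k + 1)
  mem : ∀ c ∈ relCycles Aᶜ (m + 1), (∀ x ∈ A, c ∈ relBoundaries {x}ᶜ (m + 1)) →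
    c ∈ relBoundaries Aᶜ (m + 1)

variable {m : ℕ}

theorem IsControlled.empty : IsControlled m (∅ : Set X) := by
  constructor <;> simp [relBoundaries_univ]

/-- Mayer–Vietoris. A class that dies at `A` and at `B` can only come from homology at `A ∩ B` one
degree higher, and there the vanishing part of control applies. -/
theorem IsControlled.union {A B : Set X} (hA : IsClosed A) (hB : IsClosed B)
    (h : IsControlled m A) (h' : IsControlled m B) (hAB : IsControlled m (A ∩ B)) :
    IsControlled m (A ∪ B) := by
  have h1 : (A ∪ B)ᶜ ⊆ Aᶜ := Set.compl_subset_compl.2 Set.subset_union_left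
  have h2 : (A ∪ B)ᶜ ⊆ Bᶜ := Set.compl_subset_compl.2 Set.subset_union_right
  refine ⟨fun k hk c hc => ?_, fun c hc hx => ?_⟩
  · exact mem_relBoundaries_union hA hB (hAB.le (k + 1) (by omega))
      (h.le k hk (relCycles_mono h1 _ hc)) (h'.le k hk (relCycles_mono h2 _ hc))
  · exact mem_relBoundaries_union hA hB (hAB.le (m + 1) le_rfl)
      (h.mem c (relCycles_mono h1 _ hc) fun x hxA => hx x (Or.inl hxA))
      (h'.mem c (relCycles_mono h2 _ hc) fun x hxB => hx x (Or.inr hxB))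

theorem IsControlled.of_convex {A : Set (EuclideanSpace ℝ (Fin (m + 1)))} (hA : Convex ℝ A)
    (hAc : IsCompact A) : IsControlled m A := by
  obtain rfl | ⟨x, hx⟩ := A.eq_empty_or_nonempty
  · exact IsControlled.empty
  have hsub : Aᶜ ⊆ {x}ᶜ := Set.compl_subset_compl.2 (Set.singleton_subset_iff.2 hx)
  exact ⟨fun k hk c hc => mem_relBoundaries_of_convex hA hAc hx hc
    (relCycles_point_le _ x k hk (relCycles_mono hsub _ hc)),
    fun c hc h => mem_relBoundaries_of_convex hA hAc hx hc (h x hx)⟩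

/-- Induction on the number of sets, for all families at once: meeting the union with the new set
gives a union of fewer convex compact sets. -/
theorem IsControlled.biUnion_convex {ι : Type v} (s : Finset ι)
    {B : ι → Set (EuclideanSpace ℝ (Fin (m + 1)))} (hB : ∀ i, Convex ℝ (B i))
    (hBc : ∀ i, IsCompact (B i)) : IsControlled m (⋃ i ∈ s, B i) := by
  classical
  induction s using Finset.induction_on generalizing B with
  | empty => simpa using IsControlled.empty
  | insert a s _ ih =>
    rw [Finset.set_biUnion_insert]
    refine IsControlled.union (hBc a).isClosed
      (s.isCompact_biUnion fun i _ => hBc i).isClosed (.of_convex (hB a) (hBc a)) (ih hB hBc) ?_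
    rw [Set.inter_iUnion₂]
    exact ih (fun i => (hB a).inter (hB i)) (fun i => (hBc a).inter (hBc i))

/-- The boundary of a relative cycle has compact support disjoint from `A`. The cycle is therefore
already relative to the complement of a finite union of closed balls centred in `A`, where the
convex case applies. Vanishing at the centres spreads to all points of the balls by convexity. -/
theorem IsControlled.of_isCompact {A : Set (EuclideanSpace ℝ (Fin (m + 1)))} (hA : IsCompact A) :
    IsControlled m A := by
  have key : ∀ {k : ℕ} {c : Chain (EuclideanSpace ℝ (Fin (m + 1))) (k + 1)},
      c ∈ relCycles Aᶜ (k + 1) → ∃ (t : Finset (EuclideanSpace ℝ (Fin (m + 1))))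
        (r : EuclideanSpace ℝ (Fin (m + 1)) → ℝ), (∀ x ∈ t, x ∈ A ∧ 0 ≤ r x) ∧
        A ⊆ (⋃ x ∈ t, Metric.closedBall x (r x)) ∧
        c ∈ relCycles (⋃ x ∈ t, Metric.closedBall x (r x))ᶜ (k + 1) := by
    intro k c hc
    obtain ⟨K, hKA, hK, hcK⟩ := exists_isCompact_chainsIn (mem_relCycles.1 hc)
    have : ∀ x, ∃ r > 0, x ∈ A → Metric.closedBall x r ⊆ Kᶜ := fun x => by
      by_cases hx : x ∈ A
      · obtain ⟨r, hr, h⟩ := Metric.nhds_basis_closedBall.mem_iff.1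
          (hK.isClosed.isOpen_compl.mem_nhds (show x ∈ Kᶜ from fun hxK => hKA hxK hx))
        exact ⟨r, hr, fun _ => h⟩
      · exact ⟨1, one_pos, fun h => (hx h).elim⟩
    choose r hr hrK using this
    obtain ⟨t, htA, ht⟩ := hA.elim_nhds_subcover (fun x => Metric.closedBall x (r x))
      fun x _ => Metric.closedBall_mem_nhds x (hr x)
    refine ⟨t, r, fun x hx => ⟨htA x hx, (hr x).le⟩, ht, chainsIn_mono ?_ _ hcK⟩
    rw [Set.subset_compl_comm]
    exact Set.iUnion₂_subset fun x hx => hrK x (htA x hx)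
  refine ⟨fun k hk c hc => ?_, fun c hc hx => ?_⟩
  · obtain ⟨t, r, -, htA, hct⟩ := key hc
    exact relBoundaries_mono (Set.compl_subset_compl.2 htA) _
      ((biUnion_convex t (fun x => convex_closedBall x (r x))
        (fun x => isCompact_closedBall x (r x))).le k hk hct)
  · obtain ⟨t, r, ht, htA, hct⟩ := key hc
    refine relBoundaries_mono (Set.compl_subset_compl.2 htA) _
      ((biUnion_convex t (fun x => convex_closedBall x (r x))
        (fun x => isCompact_closedBall x (r x))).mem c hct fun y hy => ?_)
    obtain ⟨x, hxt, hyx⟩ := Set.mem_iUnion₂.1 hy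
    have hmem := mem_relBoundaries_of_convex (convex_closedBall x (r x))
      (isCompact_closedBall x (r x)) (Metric.mem_closedBall_self (ht x hxt).2)
      (relCycles_mono (Set.compl_subset_compl.2 (Set.subset_biUnion_of_mem
        (u := fun x => Metric.closedBall x (r x)) hxt)) _ hct) (hx x (ht x hxt).1)
    exact relBoundaries_mono (Set.compl_subset_compl.2 (Set.singleton_subset_iff.2 hyx)) _ hmem

/-- Excision along `i` and along `j` transports the statement from Euclidean space to the manifold.
-/
theorem IsControlled.of_chart [T2Space X] {U : Type v} [TopologicalSpace U] {i : C(U, X)}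
    {j : C(U, EuclideanSpace ℝ (Fin (m + 1)))} (hi : Topology.IsOpenEmbedding i)
    (hj : Topology.IsOpenEmbedding j) {A : Set U} (hA : IsCompact A) :
    IsControlled m (i '' A) := by
  have hj' : IsControlled m (j '' A) := .of_isCompact (hA.image j.continuous)
  have hiA : IsClosed (i '' A) := (hA.image i.continuous).isClosed
  have hjA : IsClosed (j '' A) := (hA.image j.continuous).isClosed
  have hmi : ∀ B : Set U, Set.MapsTo i Bᶜ (i '' B)ᶜ := by
    rintro B x hx ⟨y, hy, hxy⟩
    exact hx (hi.injective hxy ▸ hy)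
  have hmj : ∀ B : Set U, Set.MapsTo j Bᶜ (j '' B)ᶜ := by
    rintro B x hx ⟨y, hy, hxy⟩
    exact hx (hj.injective hxy ▸ hy)
  refine ⟨fun k hk c hc => ?_, fun c hc hx => ?_⟩
  · obtain ⟨a, ha, hac⟩ := exists_pushChain_sub_mem hi hiA hc
    have := mem_relBoundaries_of_pushChain hj hjA
      (hj'.le k hk (pushChain_mem_relCycles j (hmj A) ha))
    have := add_mem hac (pushChain_mem_relBoundaries i (hmi A) this)
    rwa [sub_add_cancel] at this
  · obtain ⟨a, ha, hac⟩ := exists_pushChain_sub_mem hi hiA hc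
    have hja : pushChain j (m + 1) a ∈ relBoundaries (j '' A)ᶜ (m + 1) := by
      refine hj'.mem _ (pushChain_mem_relCycles j (hmj A) ha) ?_
      rintro _ ⟨x, hxA, rfl⟩
      have h1 := sub_mem (hx (i x) ⟨x, hxA, rfl⟩) (relBoundaries_mono
        (Set.compl_subset_compl.2 (Set.singleton_subset_iff.2 (Set.mem_image_of_mem i hxA))) _ hac)
      rw [sub_sub_cancel, ← Set.image_singleton] at h1
      have h2 := mem_relBoundaries_of_pushChain hi
        (by rw [Set.image_singleton]; exact isClosed_singleton) h1
      have h3 := pushChain_mem_relBoundaries j (hmj {x}) h2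
      rwa [Set.image_singleton] at h3
    have := add_mem hac (pushChain_mem_relBoundaries i (hmi A)
      (mem_relBoundaries_of_pushChain hj hjA hja))
    rwa [sub_add_cancel] at this

/-- Every point has an open neighbourhood which embeds as an open subset into `ℝⁿ`. -/
def LocallyEuclidean (X : Type u) [TopologicalSpace X] (n : ℕ) : Prop :=
  ∀ x : X, ∃ U : Set X, IsOpen U ∧ x ∈ U ∧
    ∃ j : C(U, EuclideanSpace ℝ (Fin n)), Topology.IsOpenEmbedding j

theorem LocallyEuclidean.of_chartedSpace {n : ℕ} [ChartedSpace (EuclideanSpace ℝ (Fin n)) X] :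
    LocallyEuclidean X n := by
  intro x
  let e := chartAt (EuclideanSpace ℝ (Fin n)) x
  exact ⟨e.source, e.open_source, mem_chart_source _ x,
    ⟨e.source.domRestrict e, e.continuousOn.domRestrict⟩, e.isOpenEmbedding_restrict⟩

theorem LocallyEuclidean.isControlled [CompactSpace X] [T2Space X]
    (hX : LocallyEuclidean X (m + 1)) {A : Set X} (hA : IsCompact A) : IsControlled m A := by
  -- Control is required of every compact subset of `K`, not only of `K` itself: gluing two pieces
  -- also needs control of their intersection.
  suffices ∃ K, IsCompact K ∧ Set.univ ⊆ K ∧ ∀ C ⊆ K, IsCompact C → IsControlled m C by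
    obtain ⟨K, -, hK, h⟩ := this
    exact h A ((Set.subset_univ _).trans hK) hA
  refine isCompact_univ.induction_on
    (p := fun s => ∃ K, IsCompact K ∧ s ⊆ K ∧ ∀ C ⊆ K, IsCompact C → IsControlled m C) ?_ ?_ ?_ ?_
  · refine ⟨∅, isCompact_empty, le_rfl, fun C hC _ => ?_⟩
    rw [Set.subset_empty_iff.1 hC]
    exact .empty
  · rintro s t hst ⟨K, hK, htK, h⟩
    exact ⟨K, hK, hst.trans htK, h⟩
  · rintro s t ⟨K, hK, hsK, h⟩ ⟨L, hL, htL, h'⟩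
    refine ⟨K ∪ L, hK.union hL, Set.union_subset_union hsK htL, fun C hC hCc => ?_⟩
    have hCU : C = (C ∩ K) ∪ (C ∩ L) := by
      rw [← Set.inter_union_distrib_left, Set.inter_eq_left.2 hC]
    rw [hCU]
    exact IsControlled.union (hCc.inter hK).isClosed (hCc.inter hL).isClosed
      (h _ Set.inter_subset_right (hCc.inter hK)) (h' _ Set.inter_subset_right (hCc.inter hL))
      (h _ (Set.inter_subset_left.trans Set.inter_subset_right)
        ((hCc.inter hK).inter (hCc.inter hL)))
  · rintro x -
    obtain ⟨U, hU, hxU, j, hj⟩ := hX x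
    obtain ⟨K, hKn, hKU, hK⟩ := local_compact_nhds (hU.mem_nhds hxU)
    refine ⟨K, mem_nhdsWithin_of_mem_nhds hKn, K, hK, le_rfl, fun C hC hCc => ?_⟩
    have hi : Topology.IsOpenEmbedding (⟨((↑) : U → X), continuous_subtype_val⟩ : C(U, X)) :=
      hU.isOpenEmbedding_subtypeVal
    have hCr : C ⊆ Set.range ((↑) : U → X) := by
      rw [Subtype.range_coe]
      exact hC.trans hKU
    have := IsControlled.of_chart hi hj
      ((hi.isEmbedding.isInducing.isCompact_preimage_iff hCr).2 hCc)
    change IsControlled m (((↑) : U → X) '' (((↑) : U → X) ⁻¹' C)) at this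
    rwa [Set.image_preimage_eq_of_subset hCr] at this

end Manifold

/-! ### Fundamental cycles -/

section FundamentalCycle

variable {X : Type u} [TopologicalSpace X]

theorem Represents.sub_mem {A : Set X} {k : ℕ} {c c' : Chain X k} {h : RelHomology A k}
    (hc : Represents c h) (hc' : Represents c' h) : c - c' ∈ relBoundaries A k := by
  obtain ⟨hc, rfl⟩ := hc
  obtain ⟨hc', h⟩ := hc'
  exact (Submodule.Quotient.eq ((relBoundaries A k).submoduleOf (relCycles A k))).1 h.symm

theorem Represents.of_sub_mem {A : Set X} {k : ℕ} {c c' : Chain X k} {h : RelHomology A k}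
    (hc : Represents c h) (hcc' : c - c' ∈ relBoundaries A k) : Represents c' h := by
  obtain ⟨hc, rfl⟩ := hc
  have hc' : c' ∈ relCycles A k := by
    have := _root_.sub_mem hc (relBoundaries_le_relCycles _ _ hcc')
    rwa [sub_sub_cancel] at this
  exact ⟨hc', ((Submodule.Quotient.eq ((relBoundaries A k).submoduleOf (relCycles A k))).2
    (show (⟨c, hc⟩ - ⟨c', hc'⟩ : relCycles A k) ∈ _ from hcc')).symm⟩

theorem exists_represents {A : Set X} {k : ℕ} (h : RelHomology A k) : ∃ c, Represents c h := by
  obtain ⟨⟨c, hc⟩, rfl⟩ := Submodule.Quotient.mk_surjective _ h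
  exact ⟨c, hc, rfl⟩

variable {m : ℕ} [CompactSpace X] [T2Space X]

/-- Two fundamental cycles of a closed manifold are homologous. -/
theorem IsFundamentalCycle.exists_eq_add_boundary (hX : LocallyEuclidean X (m + 1))
    {o : Orientation X (m + 1)} {c c' : Chain X (m + 1)} (hc : IsFundamentalCycle o c)
    (hc' : IsFundamentalCycle o c') : ∃ b, c = c' + boundary X (m + 1) b := by
  have h := (hX.isControlled isCompact_univ).mem (c - c')
    (by rw [Set.compl_univ]; exact sub_mem hc.1 hc'.1)
    fun x _ => (hc.2 x).sub_mem (hc'.2 x)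
  rw [Set.compl_univ] at h
  obtain ⟨b, e, he, h⟩ := mem_relBoundaries.1 h
  rw [chainsIn_empty he, add_zero, sub_eq_iff_eq_add'] at h
  exact ⟨b, h⟩

/-- An oriented closed manifold has a fundamental cycle. -/
theorem exists_isFundamentalCycle (hX : LocallyEuclidean X (m + 1)) (o : Orientation X (m + 1)) :
    ∃ c, IsFundamentalCycle o c := by
  suffices ∃ K, IsCompact K ∧ Set.univ ⊆ K ∧ ∃ c ∈ relCycles Kᶜ (m + 1),
      ∀ x ∈ K, Represents c (o.gen x) by
    obtain ⟨K, -, hK, c, hc, h⟩ := this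
    rw [Set.univ_subset_iff] at hK
    subst hK
    rw [Set.compl_univ] at hc
    exact ⟨c, hc, fun x => h x trivial⟩
  refine isCompact_univ.induction_on (p := fun s => ∃ K, IsCompact K ∧ s ⊆ K ∧
    ∃ c ∈ relCycles Kᶜ (m + 1), ∀ x ∈ K, Represents c (o.gen x)) ?_ ?_ ?_ ?_
  · exact ⟨∅, isCompact_empty, le_rfl, 0, zero_mem _, by simp⟩
  · rintro s t hst ⟨K, hK, htK, h⟩
    exact ⟨K, hK, hst.trans htK, h⟩
  · rintro s t ⟨K, hK, hsK, α, hα, hKα⟩ ⟨L, hL, htL, β, hβ, hLβ⟩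
    -- The local cycles represent the same generator at each point of `K ∩ L`, and top-degree
    -- classes are detected at points, so the two cycles agree at `K ∩ L` and can be glued.
    have hαβ : α - β ∈ relBoundaries (K ∩ L)ᶜ (m + 1) := by
      refine (hX.isControlled (hK.inter hL)).mem _ (sub_mem
        (relCycles_mono (Set.compl_subset_compl.2 Set.inter_subset_left) _ hα)
        (relCycles_mono (Set.compl_subset_compl.2 Set.inter_subset_right) _ hβ)) fun x hx => ?_
      exact (hKα x hx.1).sub_mem (hLβ x hx.2)
    obtain ⟨γ, hγ, hγα, hγβ⟩ := exists_relCycle_union hK.isClosed hL.isClosed hα hβ hαβ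
    refine ⟨K ∪ L, hK.union hL, Set.union_subset_union hsK htL, γ, hγ, ?_⟩
    rintro x (hx | hx)
    · refine (hKα x hx).of_sub_mem ?_
      rw [← neg_sub]
      exact neg_mem (relBoundaries_mono
        (Set.compl_subset_compl.2 (Set.singleton_subset_iff.2 hx)) _ hγα)
    · refine (hLβ x hx).of_sub_mem ?_
      rw [← neg_sub]
      exact neg_mem (relBoundaries_mono
        (Set.compl_subset_compl.2 (Set.singleton_subset_iff.2 hx)) _ hγβ)
  · rintro x -
    obtain ⟨U, hU, hxU, c, hc, h⟩ := o.consistent x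
    obtain ⟨K, hKn, hKU, hK⟩ := local_compact_nhds (hU.mem_nhds hxU)
    exact ⟨K, mem_nhdsWithin_of_mem_nhds hKn, K, hK, le_rfl, c,
      relCycles_mono (Set.compl_subset_compl.2 hKU) _ hc, fun y hy => h y (hKU hy)⟩

end FundamentalCycle

/-! ### Coverings -/

section Covering

open Topology

variable {X : Type u} [TopologicalSpace X]

theorem isCoveringMap_of_local {E : Type w} [TopologicalSpace E] {p : E → X}
    (H : ∀ x, ∃ (B : Type) (_ : TopologicalSpace B) (F : Type v) (_ : TopologicalSpace F)
      (_ : DiscreteTopology F) (h : B → X) (θ : B × F → E), IsOpenEmbedding h ∧ x ∈ Set.range h ∧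
      IsOpenEmbedding θ ∧ Set.range θ = p ⁻¹' Set.range h ∧ ∀ b f, p (θ (b, f)) = h b) :
    IsCoveringMap p := by
  intro x
  obtain ⟨B, _, F, _, _, h, θ, hh, hx, hθ, hr, hp⟩ := H x
  refine IsEvenlyCovered.to_isEvenlyCovered_preimage (I := F)
    ⟨inferInstance, Set.range h, hx, hh.isOpen_range, hr ▸ hθ.isOpen_range,
      (Homeomorph.setCongr hr.symm).trans (hθ.isEmbedding.toHomeomorph.symm.trans
        (hh.isEmbedding.toHomeomorph.prodCongr (Homeomorph.refl F))), ?_⟩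
  rintro ⟨e, he⟩
  obtain ⟨⟨b, f⟩, rfl⟩ : e ∈ Set.range θ := hr ▸ he
  have : hθ.isEmbedding.toHomeomorph.symm ⟨θ (b, f), ⟨_, rfl⟩⟩ = (b, f) :=
    hθ.isEmbedding.toHomeomorph_symm_apply _
  change ((hh.isEmbedding.toHomeomorph
    (hθ.isEmbedding.toHomeomorph.symm ⟨θ (b, f), _⟩).1 : Set.range h) : X) = _
  rw [this, hp]
  rfl

/-- Every point has arbitrarily small simply connected, locally path connected open
neighbourhoods. -/
def LocallySimple (X : Type u) [TopologicalSpace X] : Prop :=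
  ∀ (x : X) (V : Set X), IsOpen V → x ∈ V → ∃ (B : Type) (_ : TopologicalSpace B)
    (_ : SimplyConnectedSpace B) (_ : LocallyPathConnectedSpace B) (h : C(B, X)),
    IsOpenEmbedding h ∧ x ∈ Set.range h ∧ Set.range h ⊆ V

theorem LocallyEuclidean.locallySimple {n : ℕ} (hX : LocallyEuclidean X n) : LocallySimple X := by
  intro x V hV hxV
  obtain ⟨U, hU, hxU, j, hj⟩ := hX x
  have ho : IsOpen (j '' (Subtype.val ⁻¹' V)) := hj.isOpenMap _ (hV.preimage continuous_subtype_val)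
  obtain ⟨r, hr, hball⟩ := Metric.isOpen_iff.1 ho (j ⟨x, hxU⟩) ⟨⟨x, hxU⟩, hxV, rfl⟩
  have hsub : Metric.ball (j ⟨x, hxU⟩) r ⊆ Set.range j := hball.trans (Set.image_subset_range _ _)
  have hc : Convex ℝ (Metric.ball (j ⟨x, hxU⟩) r) := convex_ball _ _
  have : ContractibleSpace (Metric.ball (j ⟨x, hxU⟩) r) :=
    hc.contractibleSpace ⟨_, Metric.mem_ball_self hr⟩
  have : LocallyPathConnectedSpace (Metric.ball (j ⟨x, hxU⟩) r) := hc.locallyPathConnectedSpace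
  have hemb : IsOpenEmbedding (fun b : Metric.ball (j ⟨x, hxU⟩) r =>
      ((hj.isEmbedding.toHomeomorph.symm (Set.inclusion hsub b) : U) : X)) :=
    (hU.isOpenEmbedding_subtypeVal.comp
      hj.isEmbedding.toHomeomorph.symm.isOpenEmbedding).comp
      (IsOpenEmbedding.inclusion hsub (Metric.isOpen_ball.preimage continuous_subtype_val))
  refine ⟨Metric.ball (j ⟨x, hxU⟩) r, inferInstance, inferInstance, inferInstance,
    ⟨_, hemb.continuous⟩, hemb, ⟨⟨_, Metric.mem_ball_self hr⟩, ?_⟩, ?_⟩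
  · exact congrArg Subtype.val (hj.isEmbedding.toHomeomorph_symm_apply ⟨x, hxU⟩)
  · rintro _ ⟨⟨b, hb⟩, rfl⟩
    obtain ⟨y, hy, rfl⟩ := hball hb
    have := congrArg Subtype.val (hj.isEmbedding.toHomeomorph_symm_apply y)
    change ((hj.isEmbedding.toHomeomorph.symm ⟨j y, _⟩ : U) : X) ∈ V
    rw [this]
    exact hy

/-! ### The universal covering: lifts, deck transformations and local triviality. -/

namespace UniversalCover

variable {x₀ : X} {B : Type v} [TopologicalSpace B]

theorem isOpen_sheet (a : UniversalCover x₀) {U : Set X} (hU : IsOpen U) : IsOpen (sheet a U) :=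
  TopologicalSpace.isOpen_generateFrom_of_mem ⟨a, U, hU, rfl⟩

/-- The lift of a map from a simply connected space. -/
def lift [SimplyConnectedSpace B] [LocallyPathConnectedSpace B] (h : C(B, X)) (b₀ : B)
    (α : Path.Homotopic.Quotient x₀ (h b₀)) : C(B, UniversalCover x₀) where
  toFun b := ⟨h b, α.trans ((Path.Homotopic.Quotient.mk (PathConnectedSpace.somePath b₀ b)).map h)⟩
  continuous_toFun := by
    refine continuous_generateFrom_iff.2 ?_
    rintro _ ⟨a, U, hU, rfl⟩
    refine isOpen_iff_mem_nhds.2 fun b hb => ?_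
    obtain ⟨δ, hδ, e⟩ := hb
    have hbU : h b ∈ U := by simpa using hδ 1
    obtain ⟨s, ⟨hs, hsp⟩, hsU⟩ := (LocallyPathConnectedSpace.path_connected_basis b).mem_iff.1
      ((hU.preimage h.continuous).mem_nhds hbU)
    filter_upwards [hs] with b' hb'
    obtain ⟨ε, hε⟩ := hsp.joinedIn b (mem_of_mem_nhds hs) b' hb'
    refine ⟨δ.trans (ε.map h.continuous), fun t => ?_, ?_⟩
    · have : δ.trans (ε.map h.continuous) t ∈ Set.range (δ.trans (ε.map h.continuous)) := ⟨t, rfl⟩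
      rw [Path.trans_range] at this
      rcases this with ⟨t, ht⟩ | ⟨t, ht⟩
      · exact ht ▸ hδ t
      · rw [← ht]
        exact hsU (hε t)
    -- In a simply connected space the chosen path to `b'` is homotopic to the chosen path to `b`
    -- followed by `ε`.
    · have h1 : Path.Homotopic.Quotient.mk (PathConnectedSpace.somePath b₀ b')
          = (Path.Homotopic.Quotient.mk (PathConnectedSpace.somePath b₀ b)).trans (Path.Homotopic.Quotient.mk ε) :=
        Subsingleton.elim _ _
      change α.trans _ = _
      change α.trans _ = _ at e
      rw [Path.Homotopic.Quotient.mk_trans, ← Path.Homotopic.Quotient.trans_assoc, ← e, h1, Path.Homotopic.Quotient.trans_assoc,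
        ← Path.Homotopic.Quotient.mk_trans]
      refine congrArg α.trans (congrArg Path.Homotopic.Quotient.mk ?_)
      exact Path.map_trans _ _ h.continuous

theorem proj_lift [SimplyConnectedSpace B] [LocallyPathConnectedSpace B] (h : C(B, X)) (b₀ : B)
    (α : Path.Homotopic.Quotient x₀ (h b₀)) (b : B) : proj x₀ (lift h b₀ α b) = h b := rfl

theorem lift_eq [SimplyConnectedSpace B] [LocallyPathConnectedSpace B] (h : C(B, X)) (b₀ : B)
    (α : Path.Homotopic.Quotient x₀ (h b₀)) (b : B) (ε : Path b₀ b) :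
    lift h b₀ α b = ⟨h b, α.trans ((Path.Homotopic.Quotient.mk ε).map h)⟩ := by
  have : Path.Homotopic.Quotient.mk (PathConnectedSpace.somePath b₀ b) = Path.Homotopic.Quotient.mk ε := Subsingleton.elim _ _
  rw [← this]
  rfl

theorem lift_self [SimplyConnectedSpace B] [LocallyPathConnectedSpace B] (h : C(B, X)) (b₀ : B)
    (α : Path.Homotopic.Quotient x₀ (h b₀)) : lift h b₀ α b₀ = ⟨h b₀, α⟩ := by
  rw [lift_eq h b₀ α b₀ (Path.refl b₀)]
  exact congrArg (Sigma.mk (h b₀)) (Path.Homotopic.Quotient.trans_refl α)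

/-- A path inside the image of the embedding `h` comes from a path in `B`, so the lift reaches the
whole sheet. For open embeddings its image is thus one of the generating open sets of the topology.
-/
theorem range_lift [SimplyConnectedSpace B] [LocallyPathConnectedSpace B] {h : C(B, X)}
    (hh : IsEmbedding h) (b₀ : B) (α : Path.Homotopic.Quotient x₀ (h b₀)) :
    Set.range (lift h b₀ α) = sheet ⟨h b₀, α⟩ (Set.range h) := by
  ext e
  constructor
  · rintro ⟨b, rfl⟩
    exact ⟨(PathConnectedSpace.somePath b₀ b).map h.continuous, fun t => ⟨_, rfl⟩, rfl⟩
  · obtain ⟨x, e⟩ := e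
    rintro ⟨δ, hδ, he⟩
    have hx : x ∈ Set.range h := by simpa using hδ 1
    obtain ⟨b, rfl⟩ := hx
    let ε : Path b₀ b :=
      { toFun := fun t => hh.toHomeomorph.symm ⟨δ t, hδ t⟩
        continuous_toFun := hh.toHomeomorph.symm.continuous.comp
          (Continuous.subtype_mk δ.continuous _)
        source' := by
          refine (hh.toHomeomorph.symm_apply_eq).2 (Subtype.ext ?_)
          exact δ.source
        target' := by
          refine (hh.toHomeomorph.symm_apply_eq).2 (Subtype.ext ?_)
          exact δ.target }
    refine ⟨b, ?_⟩
    rw [lift_eq h b₀ α b ε]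
    refine congrArg (Sigma.mk (h b)) ?_
    change e = α.trans _ at he
    rw [he]
    congr 1
    refine congrArg Path.Homotopic.Quotient.mk (Path.ext (funext fun t => ?_))
    exact congrArg Subtype.val (hh.toHomeomorph.apply_symm_apply ⟨δ t, hδ t⟩)

theorem isOpenEmbedding_lift [SimplyConnectedSpace B] [LocallyPathConnectedSpace B] {h : C(B, X)}
    (hh : IsOpenEmbedding h) (b₀ : B) (α : Path.Homotopic.Quotient x₀ (h b₀)) :
    IsOpenEmbedding (lift h b₀ α) := by
  refine .of_continuous_injective_isOpenMap (lift h b₀ α).continuous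
    (fun b b' e => hh.injective (congrArg (proj x₀) e)) fun W hW => ?_
  have : lift h b₀ α '' W = proj x₀ ⁻¹' (h '' W) ∩ Set.range (lift h b₀ α) := by
    ext e
    constructor
    · rintro ⟨b, hb, rfl⟩
      exact ⟨⟨b, hb, rfl⟩, b, rfl⟩
    · rintro ⟨⟨b, hb, e1⟩, b', rfl⟩
      rw [proj_lift] at e1
      exact ⟨b', hh.injective e1 ▸ hb, rfl⟩
  rw [this, range_lift hh.isEmbedding]
  exact ((hh.isOpenMap _ hW).preimage (proj x₀).continuous).inter (isOpen_sheet _ hh.isOpen_range)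

theorem smul_left_cancel {g : FundamentalGroup X x₀} {a : UniversalCover x₀} (h : g • a = a) :
    g = 1 := by
  obtain ⟨x, a⟩ := a
  have h1 : Path.Homotopic.Quotient.trans (Path.Homotopic.Quotient.symm (FundamentalGroup.toPath g)) a = a :=
    eq_of_heq (Sigma.mk.inj_iff.1 h).2
  have h2 : Path.Homotopic.Quotient.symm (FundamentalGroup.toPath g) = Path.Homotopic.Quotient.refl x₀ := by
    have := congrArg (fun b => Path.Homotopic.Quotient.trans b (Path.Homotopic.Quotient.symm a)) h1
    simpa only [Path.Homotopic.Quotient.trans_assoc, Path.Homotopic.Quotient.trans_symm, Path.Homotopic.Quotient.trans_refl] using this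
  have h3 : g⁻¹ = 1 := h2
  exact inv_eq_one.1 h3

theorem smul_injective (a : UniversalCover x₀) :
    Function.Injective fun g : FundamentalGroup X x₀ => g • a := by
  intro g g' e
  have : (g'⁻¹ * g) • a = a := by
    rw [mul_smul]
    exact (inv_smul_eq_iff).2 e
  exact (inv_mul_eq_one.1 (smul_left_cancel this)).symm

theorem exists_smul_eq {a b : UniversalCover x₀} (h : proj x₀ a = proj x₀ b) :
    ∃ g : FundamentalGroup X x₀, g • a = b := by
  obtain ⟨x, a⟩ := a
  obtain ⟨y, b⟩ := b
  obtain rfl : x = y := h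
  refine ⟨FundamentalGroup.fromPath (Path.Homotopic.Quotient.trans a (Path.Homotopic.Quotient.symm b)), ?_⟩
  refine congrArg (Sigma.mk x) ?_
  have : (FundamentalGroup.fromPath (Path.Homotopic.Quotient.trans a (Path.Homotopic.Quotient.symm b)))⁻¹
      = FundamentalGroup.fromPath (Path.Homotopic.Quotient.trans b (Path.Homotopic.Quotient.symm a)) := by
    refine inv_eq_of_mul_eq_one_right ?_
    change Path.Homotopic.Quotient.trans (Path.Homotopic.Quotient.trans b (Path.Homotopic.Quotient.symm a))
      (Path.Homotopic.Quotient.trans a (Path.Homotopic.Quotient.symm b)) = Path.Homotopic.Quotient.refl x₀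
    rw [Path.Homotopic.Quotient.trans_assoc, ← Path.Homotopic.Quotient.trans_assoc (Path.Homotopic.Quotient.symm a), Path.Homotopic.Quotient.symm_trans,
      Path.Homotopic.Quotient.refl_trans, Path.Homotopic.Quotient.trans_symm]
  change Path.Homotopic.Quotient.trans (FundamentalGroup.toPath
    (FundamentalGroup.fromPath (Path.Homotopic.Quotient.trans a (Path.Homotopic.Quotient.symm b)))⁻¹) a = b
  rw [this]
  change Path.Homotopic.Quotient.trans (Path.Homotopic.Quotient.trans b (Path.Homotopic.Quotient.symm a)) a = b
  rw [Path.Homotopic.Quotient.trans_assoc, Path.Homotopic.Quotient.symm_trans, Path.Homotopic.Quotient.trans_refl]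

/-- The path `γ` is itself a map from a simply connected space, and its lift is the required path
upstairs. -/
theorem joined_trans {x y : X} (α : Path.Homotopic.Quotient x₀ x) (γ : Path x y) :
    Joined (X := UniversalCover x₀) ⟨x, α⟩ ⟨y, α.trans (Path.Homotopic.Quotient.mk γ)⟩ := by
  obtain ⟨f, rfl, rfl⟩ := γ
  let ι : Path (0 : unitInterval) 1 := ⟨ContinuousMap.id _, rfl, rfl⟩
  have : LocallyPathConnectedSpace unitInterval := (convex_Icc (0 : ℝ) 1).locallyPathConnectedSpace
  have : ContractibleSpace unitInterval :=
    (convex_Icc (0 : ℝ) 1).contractibleSpace ⟨0, by simp⟩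
  refine ⟨⟨lift f 0 α, lift_self f 0 α, ?_⟩⟩
  change lift f 0 α 1 = _
  rw [lift_eq f 0 α 1 ι]
  rfl

theorem pathConnectedSpace [PathConnectedSpace X] : PathConnectedSpace (UniversalCover x₀) := by
  have key : ∀ a : UniversalCover x₀, Joined (X := UniversalCover x₀)
      ⟨x₀, Path.Homotopic.Quotient.refl x₀⟩ a := by
    rintro ⟨x, a⟩
    induction a using Path.Homotopic.Quotient.ind with | mk γ =>
    have := joined_trans (Path.Homotopic.Quotient.refl x₀) γ
    rwa [Path.Homotopic.Quotient.refl_trans] at this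
  exact ⟨⟨⟨x₀, Path.Homotopic.Quotient.refl x₀⟩⟩, fun a b => (key a).symm.trans (key b)⟩

theorem proj_surjective [PathConnectedSpace X] : Function.Surjective (proj x₀) :=
  fun x => ⟨⟨x, Path.Homotopic.Quotient.mk (PathConnectedSpace.somePath x₀ x)⟩, rfl⟩

theorem exists_section (hX : LocallySimple X) (a : UniversalCover x₀) :
    ∃ (B : Type) (_ : TopologicalSpace B) (g : C(B, UniversalCover x₀)),
      IsOpenEmbedding g ∧ IsOpenEmbedding (proj x₀ ∘ g) ∧ a ∈ Set.range g := by
  obtain ⟨x, a⟩ := a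
  obtain ⟨B, _, _, _, h, hh, ⟨b, rfl⟩, -⟩ := hX x Set.univ isOpen_univ trivial
  exact ⟨B, inferInstance, lift h b a, isOpenEmbedding_lift hh b a, hh, b, lift_self h b a⟩

/-- The translates of one local section by deck transformations trivialize the projection: they are
disjoint since the action is free and exhaust the preimage since it is transitive on fibres. -/
theorem isCoveringMap_proj [PathConnectedSpace X] (hX : LocallySimple X) :
    IsCoveringMap (proj x₀) := by
  refine isCoveringMap_of_local fun x => ?_
  obtain ⟨a, rfl⟩ := proj_surjective (x₀ := x₀) x
  obtain ⟨B, _, g, hg, hh, b₀, hb₀⟩ := exists_section hX a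
  let _ : TopologicalSpace (FundamentalGroup X x₀) := ⊥
  have : DiscreteTopology (FundamentalGroup X x₀) := ⟨rfl⟩
  refine ⟨B, inferInstance, FundamentalGroup X x₀, inferInstance, inferInstance, proj x₀ ∘ g,
    fun z => z.2 • g z.1, hh, ⟨b₀, congrArg (proj x₀) hb₀⟩, ?_, ?_, fun b γ => rfl⟩
  · refine .of_continuous_injective_isOpenMap ?_ ?_ ?_
    · refine continuous_prod_of_discrete_right.2 fun γ => ?_
      exact (continuous_const_smul γ).comp g.continuous
    · rintro ⟨b, γ⟩ ⟨b', γ'⟩ e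
      have e' : proj x₀ (γ • g b) = proj x₀ (γ' • g b') := congrArg (proj x₀) e
      obtain rfl : b = b' := hh.injective e'
      obtain rfl : γ = γ' := smul_injective _ e
      rfl
    · refine isOpenMap_iff_nhds_le.2 ?_
      rintro ⟨b, γ⟩
      rw [nhds_prod_eq, nhds_discrete (FundamentalGroup X x₀), Filter.prod_pure, Filter.map_map]
      exact ((isOpenMap_smul γ).comp hg.isOpenMap).nhds_le b
  · ext e
    constructor
    · rintro ⟨⟨b, γ⟩, rfl⟩
      exact ⟨b, rfl⟩
    · rintro ⟨b, hb⟩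
      obtain ⟨γ, hγ⟩ := exists_smul_eq hb
      exact ⟨⟨b, γ⟩, hγ⟩

end UniversalCover

/-! ### Coverings associated with `Γ`-sets, and monodromy. -/

open UniversalCover

variable {x₀ : X} {Y : Type v} [TopologicalSpace Y]

/-- `q : Y → X` is the covering which is associated with the action of the fundamental group on `F`;
the map `Φ` is the projection `X~ × F → X~ ×_Γ F = Y`. -/
structure IsAssociated {F : Type w} [MulAction (FundamentalGroup X x₀) F] (q : C(Y, X))
    (Φ : F → C(UniversalCover x₀, Y)) : Prop where
  covering : IsCoveringMap q
  proj_eq : ∀ f a, q (Φ f a) = proj x₀ a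
  smul_eq : ∀ (γ : FundamentalGroup X x₀) f a, Φ (γ • f) (γ • a) = Φ f a
  injective : ∀ a, Function.Injective fun f => Φ f a
  surjective : ∀ a y, q y = proj x₀ a → ∃ f, Φ f a = y

/-- Each `Φ f` is a local homeomorphism, so its image is open, and the images of two such maps can
only meet if their indices lie in one orbit. The image of one `Φ f` is therefore clopen, and
connectedness of `Y` leaves a single orbit. -/
theorem IsAssociated.isPretransitive [PathConnectedSpace X] (hX : LocallySimple X) [ConnectedSpace Y]
    {F : Type w} [MulAction (FundamentalGroup X x₀) F] {q : C(Y, X)}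
    {Φ : F → C(UniversalCover x₀, Y)} (h : IsAssociated q Φ) :
    MulAction.IsPretransitive (FundamentalGroup X x₀) F := by
  have hopen : ∀ f, IsOpen (Set.range (Φ f)) := fun f => by
    have : IsLocalHomeomorph (Φ f) := by
      refine IsLocalHomeomorph.of_comp (f := Φ f)
        (hg := h.covering.isLocalHomeomorph) ?_ (Φ f).continuous
      have : ⇑q ∘ Φ f = proj x₀ := funext (h.proj_eq f)
      rw [this]
      exact (isCoveringMap_proj hX).isLocalHomeomorph
    exact this.isOpenMap.isOpen_range
  have hsurj : ∀ y, ∃ f a, Φ f a = y := fun y => by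
    obtain ⟨a, ha⟩ := proj_surjective (x₀ := x₀) (q y)
    obtain ⟨f, hf⟩ := h.surjective a y ha.symm
    exact ⟨f, a, hf⟩
  have horb : ∀ f f' a a', Φ f a = Φ f' a' → ∃ γ : FundamentalGroup X x₀, γ • f = f' := by
    intro f f' a a' e
    obtain ⟨γ, rfl⟩ : ∃ γ : FundamentalGroup X x₀, γ • a = a' := exists_smul_eq (by
      rw [← h.proj_eq f, e, h.proj_eq])
    refine ⟨γ, h.injective (γ • a) ?_⟩
    change Φ (γ • f) (γ • a) = Φ f' (γ • a)
    rw [h.smul_eq, e]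
  refine ⟨fun f f' => ?_⟩
  have hne : Nonempty (UniversalCover x₀) := ⟨⟨x₀, Path.Homotopic.Quotient.refl x₀⟩⟩
  obtain ⟨a⟩ := hne
  have hclopen : IsClopen (Set.range (Φ f)) := by
    refine ⟨⟨?_⟩, hopen f⟩
    have : (Set.range (Φ f))ᶜ = ⋃ (f' : F) (_ : ∀ γ : FundamentalGroup X x₀, γ • f ≠ f'),
        Set.range (Φ f') := by
      ext y
      simp only [Set.mem_compl_iff, Set.mem_iUnion]
      constructor
      · intro hy
        obtain ⟨f', a, rfl⟩ := hsurj y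
        refine ⟨f', fun γ e => hy ⟨γ⁻¹ • a, ?_⟩, a, rfl⟩
        rw [← e, ← h.smul_eq γ, smul_inv_smul]
      · rintro ⟨f', hf', a', rfl⟩ ⟨a, e⟩
        obtain ⟨γ, hγ⟩ := horb _ _ _ _ e
        exact hf' γ hγ
    rw [this]
    exact isOpen_iUnion fun f' => isOpen_iUnion fun _ => hopen f'
  have hu := hclopen.eq_univ ⟨_, a, rfl⟩
  have : Φ f' a ∈ Set.range (Φ f) := hu ▸ Set.mem_univ _
  obtain ⟨a', e⟩ := this
  exact horb _ _ _ _ e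

section AssociatedCovering

variable (x₀) (F : Type w) [MulAction (FundamentalGroup X x₀) F] [TopologicalSpace F]
  [DiscreteTopology F] [ContinuousConstSMul (FundamentalGroup X x₀) F]

/-- The total space `X~ ×_Γ F` of the covering of `X` associated with a `Γ`-set `F`. -/
def AssociatedSpace : Type (max u w) :=
  MulAction.orbitRel.Quotient (FundamentalGroup X x₀) (UniversalCover x₀ × F)

instance : TopologicalSpace (AssociatedSpace x₀ F) :=
  inferInstanceAs (TopologicalSpace
    (_root_.Quotient (MulAction.orbitRel (FundamentalGroup X x₀) (UniversalCover x₀ × F))))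

namespace AssociatedSpace

/-- The class of a pair. -/
def mk (z : UniversalCover x₀ × F) : AssociatedSpace x₀ F :=
  _root_.Quotient.mk (MulAction.orbitRel (FundamentalGroup X x₀) (UniversalCover x₀ × F)) z

omit [DiscreteTopology F] [ContinuousConstSMul (FundamentalGroup X x₀) F] in
theorem continuous_mk : Continuous (mk x₀ F) := continuous_quotient_mk'

omit [DiscreteTopology F] in
theorem isOpenMap_mk : IsOpenMap (mk x₀ F) :=
  isOpenMap_quotient_mk'_mul (Γ := FundamentalGroup X x₀) (T := UniversalCover x₀ × F)

variable {x₀ F} in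
omit [TopologicalSpace F] [DiscreteTopology F] [ContinuousConstSMul (FundamentalGroup X x₀) F] in
theorem mk_eq_iff {a b : UniversalCover x₀ × F} :
    mk x₀ F a = mk x₀ F b ↔ ∃ γ : FundamentalGroup X x₀, γ • b = a :=
  _root_.Quotient.eq

/-- The covering map. -/
def covering : C(AssociatedSpace x₀ F, X) where
  toFun := _root_.Quotient.lift (fun z => proj x₀ z.1) (by
    rintro _ b ⟨γ, rfl⟩
    rfl)
  continuous_toFun := ((proj x₀).continuous.comp continuous_fst).quotient_lift _

/-- The restriction of the quotient map to a copy of the universal covering. -/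
def incl (f : F) : C(UniversalCover x₀, AssociatedSpace x₀ F) where
  toFun a := mk x₀ F (a, f)
  continuous_toFun := (continuous_mk x₀ F).comp (by fun_prop)

theorem isAssociated [PathConnectedSpace X] (hX : LocallySimple X) :
    IsAssociated (covering x₀ F) (incl x₀ F) where
  covering := by
    refine isCoveringMap_of_local fun x => ?_
    obtain ⟨a, rfl⟩ := proj_surjective (x₀ := x₀) x
    obtain ⟨B, _, g, hg, hh, b₀, hb₀⟩ := exists_section hX a
    refine ⟨B, inferInstance, F, inferInstance, inferInstance, proj x₀ ∘ g,
      fun z => mk x₀ F (g z.1, z.2), hh, ⟨b₀, congrArg (proj x₀) hb₀⟩, ?_, ?_, fun b γ => rfl⟩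
    · refine .of_continuous_injective_isOpenMap ?_ ?_ ?_
      · exact (continuous_mk x₀ F).comp (by fun_prop)
      · rintro ⟨b, f⟩ ⟨b', f'⟩ e
        obtain ⟨γ, hγ⟩ := mk_eq_iff.1 e
        obtain ⟨h1, h2⟩ := Prod.mk_inj.1 hγ
        have e' : proj x₀ (γ • g b') = proj x₀ (g b) := congrArg (proj x₀) h1
        obtain rfl : b' = b := hh.injective e'
        obtain rfl : γ = 1 := smul_left_cancel h1
        exact Prod.ext rfl (h2.symm.trans (one_smul _ f'))
      · exact (isOpenMap_mk x₀ F).comp (hg.isOpenMap.prodMap IsOpenMap.id)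
    · ext e
      constructor
      · rintro ⟨⟨b, γ⟩, rfl⟩
        exact ⟨b, rfl⟩
      · rintro ⟨b, hb⟩
        obtain ⟨⟨a', f⟩, rfl⟩ := _root_.Quotient.exists_rep e
        obtain ⟨γ, hγ⟩ := exists_smul_eq (a := a') (b := g b) hb.symm
        refine ⟨⟨b, γ • f⟩, mk_eq_iff.2 ⟨γ, ?_⟩⟩
        rw [← hγ]
        rfl
  proj_eq f a := rfl
  smul_eq γ f a := mk_eq_iff.2 ⟨γ, rfl⟩
  injective a := by
    intro f f' e
    obtain ⟨γ, hγ⟩ := mk_eq_iff.1 e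
    obtain ⟨h1, h2⟩ := Prod.mk_inj.1 hγ
    obtain rfl : γ = 1 := smul_left_cancel h1
    exact h2.symm.trans (one_smul _ f')
  surjective a y hy := by
    obtain ⟨⟨a', f⟩, rfl⟩ := _root_.Quotient.exists_rep y
    obtain ⟨γ, hγ⟩ := exists_smul_eq (a := a') (b := a) hy
    refine ⟨γ • f, mk_eq_iff.2 ⟨γ, ?_⟩⟩
    rw [← hγ]
    rfl

omit [DiscreteTopology F] [ContinuousConstSMul (FundamentalGroup X x₀) F] in
theorem connectedSpace [PathConnectedSpace X] [Nonempty F]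
    [MulAction.IsPretransitive (FundamentalGroup X x₀) F] :
    ConnectedSpace (AssociatedSpace x₀ F) := by
  have : PathConnectedSpace (UniversalCover x₀) := pathConnectedSpace
  obtain ⟨f⟩ := ‹Nonempty F›
  have hs : Function.Surjective (incl x₀ F f) := fun y => by
    obtain ⟨⟨a, f'⟩, rfl⟩ := _root_.Quotient.exists_rep y
    obtain ⟨γ, hγ⟩ := MulAction.exists_smul_eq (FundamentalGroup X x₀) f' f
    refine ⟨γ • a, mk_eq_iff.2 ⟨γ, ?_⟩⟩
    rw [← hγ]
    rfl
  exact hs.connectedSpace (incl x₀ F f).continuous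

end AssociatedSpace

end AssociatedCovering

/-- The projection `X~ × q⁻¹(x₀) → Y` for a covering `q : Y → X`, given by monodromy. -/
def monodromyMap {q : C(Y, X)} (hq : IsCoveringMap q) (f : q ⁻¹' {x₀}) :
    C(UniversalCover x₀, Y) where
  toFun a := hq.monodromy a.2 f
  continuous_toFun := by
    refine continuous_def.2 fun W hW => isOpen_iff_mem_nhds.2 fun a ha => ?_
    obtain ⟨e, hae, he⟩ := hq.isLocalHomeomorph (hq.monodromy a.2 f : Y)
    have ho : IsOpen (q '' (W ∩ e.source)) := hq.isOpenMap _ (hW.inter e.open_source)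
    have haq : a.1 ∈ q '' (W ∩ e.source) := ⟨_, ⟨ha, hae⟩, (hq.monodromy a.2 f).2⟩
    refine Filter.mem_of_superset ((isOpen_sheet a ho).mem_nhds
      ⟨Path.refl _, fun _ => haq, (Path.Homotopic.Quotient.trans_refl _).symm⟩) ?_
    rintro b ⟨δ, hδ, hb⟩
    have hsymm : ∀ t, e.symm (δ t) ∈ W ∩ e.source ∧ q (e.symm (δ t)) = δ t := by
      intro t
      obtain ⟨y, hy, hyt⟩ := hδ t
      have : e.symm (δ t) = y := by
        rw [← hyt, he]
        exact e.left_inv hy.2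
      rw [this]
      exact ⟨hy, hyt⟩
    have htarget : ∀ t, δ t ∈ e.target := fun t => by
      rw [← (hsymm t).2, he]
      exact e.map_source (hsymm t).1.2
    have h0 : e.symm (δ 0) = hq.monodromy a.2 f := by
      have : δ 0 = q (hq.monodromy a.2 f) := δ.source.trans (hq.monodromy a.2 f).2.symm
      rw [this]
      refine (congrFun (congrArg (e.symm ∘ ·) he) _).trans (e.left_inv hae)
    have h1 : q (e.symm (δ 1)) = b.1 := (hsymm 1).2.trans δ.target
    -- On a small sheet the path `δ` lifts through the local inverse of `q`, so monodromy along it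
    -- stays in `W`.
    let δ' : Path (hq.monodromy a.2 f : Y) (e.symm (δ 1)) :=
      { toFun := fun t => e.symm (δ t)
        continuous_toFun := e.continuousOn_symm.comp_continuous δ.continuous htarget
        source' := h0
        target' := rfl }
    have key : hq.monodromy (Path.Homotopic.Quotient.mk δ) (hq.monodromy a.2 f)
        = (⟨e.symm (δ 1), h1⟩ : q ⁻¹' {b.1}) := by
      refine hq.monodromy_eq_of_map_eq (Path.Homotopic.Quotient.mk δ') ?_
      refine congrArg Path.Homotopic.Quotient.mk (Path.ext (funext fun t => ?_))
      exact (hsymm t).2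
    change (hq.monodromy b.2 f : Y) ∈ W
    rw [hb, hq.monodromy_trans_apply, key]
    exact (hsymm 1).1.1

/-- A deck transformation puts the inverse loop in front of a path class, while the action on the
fibre is monodromy along the loop itself; the two cancel. The remaining conditions hold because
monodromy is a bijection between fibres. -/
theorem isAssociated_monodromyMap {q : C(Y, X)} (hq : IsCoveringMap q) :
    letI := hq.fundamentalGroupMulAction x₀
    IsAssociated q (monodromyMap (x₀ := x₀) hq) := by
  let _ := hq.fundamentalGroupMulAction x₀
  refine ⟨hq, fun f a => (hq.monodromy a.2 f).2, fun γ f a => ?_, fun a f f' e => ?_,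
    fun a y hy => ?_⟩
  · change (hq.monodromy (Path.Homotopic.Quotient.trans (Path.Homotopic.Quotient.symm
      (FundamentalGroup.toPath γ)) a.2) (hq.monodromy (FundamentalGroup.toPath γ) f) : Y) = _
    rw [← hq.monodromy_trans_apply, ← Path.Homotopic.Quotient.trans_assoc,
      Path.Homotopic.Quotient.trans_symm, Path.Homotopic.Quotient.refl_trans]
    rfl
  · exact (hq.monodromy_bijective a.2).1 (Subtype.ext e)
  · obtain ⟨f, hf⟩ := (hq.monodromy_bijective a.2).2 ⟨y, hy⟩
    exact ⟨f, congrArg Subtype.val hf⟩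

/-! ### Properties of the base inherited by coverings. -/

theorem LocallyEuclidean.of_isLocalHomeomorph {n : ℕ} (hX : LocallyEuclidean X n) {q : Y → X}
    (hq : IsLocalHomeomorph q) : LocallyEuclidean Y n := by
  intro y
  obtain ⟨U, hU, hyU, j, hj⟩ := hX (q y)
  obtain ⟨W, hW, hqW⟩ := isLocalHomeomorph_iff_isOpenEmbedding_restrict.1 hq y
  obtain ⟨W', hW', hWo, hy⟩ := mem_nhds_iff.1 hW
  let V := W' ∩ q ⁻¹' U
  have hV : IsOpen V := hWo.inter (hU.preimage hq.continuous)
  have h1 : IsOpenEmbedding (V.domRestrict q) := by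
    refine .of_continuous_injective_isOpenMap (hq.continuous.comp continuous_subtype_val) ?_
      (hq.isOpenMap.comp hV.isOpenMap_subtype_val)
    intro a b e
    have := @hqW.injective ⟨a.1, hW' a.2.1⟩ ⟨b.1, hW' b.2.1⟩ e
    exact Subtype.ext (congrArg (fun z : W => z.1) this)
  have h2 : IsOpenEmbedding (fun v : V => (⟨q v, v.2.2⟩ : U)) :=
    hU.isOpenEmbedding_subtypeVal.of_comp _ h1
  exact ⟨V, hV, ⟨hy, hyU⟩, ⟨_, (hj.comp h2).continuous⟩, hj.comp h2⟩

theorem t2Space_of_isCoveringMap [T2Space X] {q : Y → X} (hq : IsCoveringMap q) : T2Space Y := by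
  refine ⟨fun y y' hne => ?_⟩
  by_cases e : q y = q y'
  · exact hq.isSeparatedMap y y' e hne
  · exact separated_by_continuous hq.continuous e

theorem compactSpace_of_isCoveringMap [T2Space X] [CompactSpace X] {q : Y → X}
    (hq : IsCoveringMap q) (hfin : ∀ x, Finite (q ⁻¹' {x})) : CompactSpace Y := by
  have key : ∀ x ∈ (Set.univ : Set X), ∃ t ∈ nhdsWithin x Set.univ, IsCompact (q ⁻¹' t) := by
    intro x _
    obtain ⟨_, U, hxU, hU, hqU, H, hH⟩ := hq x
    obtain ⟨K, hK, hKU, hKc⟩ := LocallyCompactSpace.local_compact_nhds x U (hU.mem_nhds hxU)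
    refine ⟨K, mem_nhdsWithin_of_mem_nhds hK, ?_⟩
    have := hfin x
    have hc : IsCompact ((Subtype.val ⁻¹' K : Set U) ×ˢ (Set.univ : Set (q ⁻¹' {x}))) := by
      refine IsCompact.prod ?_ Set.finite_univ.isCompact
      exact (Topology.IsInducing.subtypeVal.isCompact_preimage_iff
        (by simpa using hKU)).2 hKc
    have := (hc.image H.symm.continuous).image continuous_subtype_val
    convert this using 1
    ext y
    constructor
    · intro hy
      exact ⟨⟨y, hKU hy⟩, ⟨H ⟨y, hKU hy⟩, ⟨by
        change (H ⟨y, hKU hy⟩).1.1 ∈ K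
        rw [hH]
        exact hy, trivial⟩, H.symm_apply_apply _⟩, rfl⟩
    · rintro ⟨_, ⟨z, ⟨hz, -⟩, rfl⟩, rfl⟩
      have := hH (H.symm z)
      rw [H.apply_symm_apply] at this
      change q (H.symm z).1 ∈ K
      rw [← this]
      exact hz
  suffices IsCompact (q ⁻¹' Set.univ) by
    exact ⟨by simpa using this⟩
  refine isCompact_univ.induction_on (p := fun t => ∃ t', t ⊆ t' ∧ IsCompact (q ⁻¹' t'))
    ⟨∅, subset_rfl, by simp⟩ ?_ ?_ ?_ |>.elim fun t ht => ?_
  · rintro s t hst ⟨t', h, h'⟩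
    exact ⟨t', hst.trans h, h'⟩
  · rintro s t ⟨s', h1, h2⟩ ⟨t', h3, h4⟩
    exact ⟨s' ∪ t', Set.union_subset_union h1 h3, by
      rw [Set.preimage_union]
      exact h2.union h4⟩
  · intro x hx
    obtain ⟨t, ht, htc⟩ := key x hx
    exact ⟨t, ht, t, subset_rfl, htc⟩
  · rw [← Set.univ_subset_iff.1 ht.1]
    exact ht.2

end Covering

/-! ### Lifts of simplices and the transfer -/

section Transfer

open UniversalCover Topology

variable {X : Type u} [TopologicalSpace X] {x₀ : X}

instance (k : ℕ) : ContractibleSpace (Splx k) :=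
  (convex_stdSimplex ℝ (Fin (k + 1))).contractibleSpace ⟨_, single_mem_stdSimplex ℝ 0⟩

instance (k : ℕ) : LocallyPathConnectedSpace (Splx k) :=
  (convex_stdSimplex ℝ (Fin (k + 1))).locallyPathConnectedSpace

instance : Nonempty (UniversalCover x₀) := ⟨⟨x₀, Path.Homotopic.Quotient.refl x₀⟩⟩

instance (k : ℕ) : Nonempty (SingularSimplex (UniversalCover x₀) k) :=
  ⟨ContinuousMap.const _ (Classical.arbitrary _)⟩

theorem leftAct_single {k : ℕ} (γ : FundamentalGroup X x₀)
    (σ : SingularSimplex (UniversalCover x₀) k) (a : ℤ) :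
    leftAct γ k (Finsupp.single σ a) = Finsupp.single (γ • σ) a :=
  pushChain_single _ σ a

/-- Two lifts of a simplex which agree in a point are equal. -/
theorem lift_unique {Y : Type v} [TopologicalSpace Y] {q : C(Y, X)} (hq : IsCoveringMap q) {k : ℕ}
    {σ τ : SingularSimplex Y k} (h : q.comp σ = q.comp τ) {t : Splx k} (ht : σ t = τ t) : σ = τ :=
  DFunLike.coe_injective (hq.eq_of_comp_eq σ.continuous τ.continuous
    (congrArg DFunLike.coe h) t ht)

/-- A chosen lift of a simplex to the universal covering. -/
def simplexLift (x₀ : X) {k : ℕ} (s : SingularSimplex X k) :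
    SingularSimplex (UniversalCover x₀) k :=
  Classical.epsilon fun σ => (proj x₀).comp σ = s

/-- The deck transformation which sends the chosen lift to the given one. -/
def deck {k : ℕ} (σ : SingularSimplex (UniversalCover x₀) k) : FundamentalGroup X x₀ :=
  Classical.epsilon fun γ => γ • simplexLift x₀ ((proj x₀).comp σ) = σ

theorem smul_simplex_injective {k : ℕ} (σ : SingularSimplex (UniversalCover x₀) k) :
    Function.Injective fun γ : FundamentalGroup X x₀ => γ • σ := fun _ _ h =>
  smul_injective _ (DFunLike.congr_fun h (Classical.arbitrary (Splx k)))

section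

variable [PathConnectedSpace X] (hX : LocallySimple X)

include hX

theorem proj_comp_simplexLift {k : ℕ} (s : SingularSimplex X k) :
    (proj x₀).comp (simplexLift x₀ s) = s := by
  refine Classical.epsilon_spec (p := fun σ => (proj x₀).comp σ = s) ?_
  let t : Splx k := Classical.arbitrary _
  obtain ⟨a, ha⟩ := proj_surjective (x₀ := x₀) (s t)
  obtain ⟨σ, hσ, -⟩ := (isCoveringMap_proj (x₀ := x₀) hX).existsUnique_continuousMap_lifts s t a ha
  exact ⟨σ, ContinuousMap.ext (congrFun hσ.2)⟩

theorem exists_smul_simplex_eq {k : ℕ} {σ τ : SingularSimplex (UniversalCover x₀) k}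
    (h : (proj x₀).comp σ = (proj x₀).comp τ) : ∃ γ : FundamentalGroup X x₀, γ • σ = τ := by
  let t : Splx k := Classical.arbitrary _
  obtain ⟨γ, hγ⟩ := exists_smul_eq (a := σ t) (b := τ t) (DFunLike.congr_fun h t)
  exact ⟨γ, lift_unique (isCoveringMap_proj (x₀ := x₀) hX) (t := t) h hγ⟩

theorem deck_smul {k : ℕ} (σ : SingularSimplex (UniversalCover x₀) k) :
    deck σ • simplexLift x₀ ((proj x₀).comp σ) = σ :=
  Classical.epsilon_spec (p := fun γ => γ • simplexLift x₀ ((proj x₀).comp σ) = σ)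
    (exists_smul_simplex_eq hX (proj_comp_simplexLift hX _))

theorem exists_pushChain_proj_eq {k : ℕ} (c : Chain X k) :
    ∃ z : Chain (UniversalCover x₀) k, pushChain (proj x₀) k z = c := by
  refine ⟨Finsupp.mapDomain (simplexLift x₀) c, ?_⟩
  rw [pushChain, Finsupp.lmapDomain_apply, ← Finsupp.mapDomain_comp]
  have : (fun σ => (proj x₀).comp σ) ∘ simplexLift x₀ (k := k) = id :=
    funext fun s => proj_comp_simplexLift hX s
  rw [this, Finsupp.mapDomain_id]

end

variable {Y : Type u} [TopologicalSpace Y] {F : Type w} [Fintype F]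

/-- The chain `∑ φ(f) Φ_f(c)`. -/
def fibreSum (Φ : F → C(UniversalCover x₀, Y)) (φ : F → ℤ) (k : ℕ) :
    Chain (UniversalCover x₀) k →ₗ[ℤ] Chain Y k :=
  ∑ f, φ f • pushChain (Φ f) k

theorem fibreSum_apply (Φ : F → C(UniversalCover x₀, Y)) (φ : F → ℤ) (k : ℕ)
    (c : Chain (UniversalCover x₀) k) :
    fibreSum Φ φ k c = ∑ f, φ f • pushChain (Φ f) k c := by
  simp [fibreSum]

theorem boundary_fibreSum (Φ : F → C(UniversalCover x₀, Y)) (φ : F → ℤ) (k : ℕ)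
    (c : Chain (UniversalCover x₀) (k + 1)) :
    boundary Y k (fibreSum Φ φ (k + 1) c) = fibreSum Φ φ k (boundary _ k c) := by
  simp [fibreSum_apply, pushChain_boundary]

/-- The transfer of chains to a finite covering. -/
def transfer (Φ : F → C(UniversalCover x₀, Y)) (k : ℕ) : Chain X k →ₗ[ℤ] Chain Y k :=
  Finsupp.linearCombination ℤ fun s => ∑ f, Finsupp.single ((Φ f).comp (simplexLift x₀ s)) 1

theorem transfer_single (Φ : F → C(UniversalCover x₀, Y)) {k : ℕ} (s : SingularSimplex X k) :
    transfer Φ k (Finsupp.single s 1) = ∑ f, Finsupp.single ((Φ f).comp (simplexLift x₀ s)) 1 := by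
  simp [transfer]

omit [TopologicalSpace X] [TopologicalSpace Y] in
theorem preimage_compl_singleton_subset (q : Y → X) (y : Y) : q ⁻¹' {q y}ᶜ ⊆ ({y}ᶜ : Set Y) := by
  rintro y' hy' rfl
  exact hy' rfl

namespace IsAssociated

variable [MulAction (FundamentalGroup X x₀) F] {q : C(Y, X)} {Φ : F → C(UniversalCover x₀, Y)}
  (h : IsAssociated q Φ)

include h

omit [Fintype F] in
theorem comp_smul {k : ℕ} (γ : FundamentalGroup X x₀) (f : F)
    (σ : SingularSimplex (UniversalCover x₀) k) :
    (Φ f).comp (γ • σ) = (Φ (γ⁻¹ • f)).comp σ := by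
  ext t
  have := h.smul_eq γ (γ⁻¹ • f) (σ t)
  rw [smul_inv_smul] at this
  exact this

theorem fibreSum_leftAct (φ : F → ℤ) (k : ℕ) (γ : FundamentalGroup X x₀)
    (c : Chain (UniversalCover x₀) k) :
    fibreSum Φ φ k (leftAct γ k c) = fibreSum Φ (fun f => φ (γ • f)) k c := by
  suffices fibreSum Φ φ k ∘ₗ leftAct γ k = fibreSum Φ (fun f => φ (γ • f)) k from
    LinearMap.congr_fun this c
  refine chain_hom_ext fun σ => ?_
  rw [LinearMap.comp_apply, leftAct_single, fibreSum_apply, fibreSum_apply]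
  refine Fintype.sum_equiv (MulAction.toPerm γ⁻¹) _ _ fun f => ?_
  simp only [pushChain_single, MulAction.toPerm_apply, smul_inv_smul, h.comp_smul]

omit [Fintype F] in
theorem comp_eq {k : ℕ} (f : F) (σ : SingularSimplex (UniversalCover x₀) k) :
    q.comp ((Φ f).comp σ) = (proj x₀).comp σ :=
  ContinuousMap.ext fun t => h.proj_eq f (σ t)

omit [Fintype F] in
theorem comp_injective {k : ℕ} {σ : SingularSimplex (UniversalCover x₀) k} {f f' : F}
    (e : (Φ f).comp σ = (Φ f').comp σ) : f = f' :=
  h.injective _ (DFunLike.congr_fun e (Classical.arbitrary (Splx k)))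

variable [PathConnectedSpace X] (hX : LocallySimple X)

include hX

/-- Replacing the chosen lift by another one permutes the maps `Φ f`, and the constant weight `1`
does not notice. The transfer is thus independent of the choice of lifts. -/
theorem transfer_proj (k : ℕ) (c : Chain (UniversalCover x₀) k) :
    transfer Φ k (pushChain (proj x₀) k c) = fibreSum Φ (fun _ => 1) k c := by
  suffices transfer Φ k ∘ₗ pushChain (proj x₀) k = fibreSum Φ (fun _ => 1) k from
    LinearMap.congr_fun this c
  refine chain_hom_ext fun σ => ?_
  have h1 := h.fibreSum_leftAct (fun _ => 1) k (deck σ)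
    (Finsupp.single (simplexLift x₀ ((proj x₀).comp σ)) 1)
  rw [leftAct_single, deck_smul hX] at h1
  rw [LinearMap.comp_apply, pushChain_single, transfer_single, h1, fibreSum_apply]
  simp [pushChain_single]

/-- The faces of a chosen lift need not be the chosen lifts of the faces. Writing the chain as a
projection replaces the transfer by `fibreSum`, which involves no choices and visibly commutes with
the boundary. -/
theorem boundary_transfer (k : ℕ) (c : Chain X (k + 1)) :
    boundary Y k (transfer Φ (k + 1) c) = transfer Φ k (boundary X k c) := by
  obtain ⟨z, rfl⟩ := exists_pushChain_proj_eq (x₀ := x₀) hX c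
  rw [h.transfer_proj hX, boundary_fibreSum, pushChain_boundary, h.transfer_proj hX]

theorem transfer_mem_chainsIn {A : Set X} {k : ℕ} {c : Chain X k} (hc : c ∈ chainsIn A k) :
    transfer Φ k c ∈ chainsIn (q ⁻¹' A) k := by
  refine map_mem_of_chainsIn _ _ (fun s hs => ?_) hc
  rw [transfer_single]
  refine sum_mem fun f _ => single_mem_chainsIn ?_ _
  rintro _ ⟨t, rfl⟩
  have h1 := DFunLike.congr_fun (h.comp_eq f (simplexLift x₀ s)) t
  rw [proj_comp_simplexLift hX] at h1
  exact hs ⟨t, h1.symm⟩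

theorem transfer_mem_relCycles {A : Set X} {k : ℕ} {c : Chain X (k + 1)}
    (hc : c ∈ relCycles A (k + 1)) : transfer Φ (k + 1) c ∈ relCycles (q ⁻¹' A) (k + 1) := by
  rw [mem_relCycles, h.boundary_transfer hX]
  exact h.transfer_mem_chainsIn hX hc

theorem transfer_mem_relBoundaries {A : Set X} {k : ℕ} {c : Chain X k}
    (hc : c ∈ relBoundaries A k) : transfer Φ k c ∈ relBoundaries (q ⁻¹' A) k := by
  obtain ⟨b, e, he, rfl⟩ := mem_relBoundaries.1 hc
  exact mem_relBoundaries.2 ⟨transfer Φ (k + 1) b, _, h.transfer_mem_chainsIn hX he, by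
    rw [map_add, h.boundary_transfer hX]⟩

omit [Fintype F] in
/-- Every simplex of the covering is one of the lifts that occur in the transfer. -/
theorem exists_comp_simplexLift {k : ℕ} (σ : SingularSimplex Y k) :
    ∃ f, (Φ f).comp (simplexLift x₀ (q.comp σ)) = σ := by
  let t : Splx k := Classical.arbitrary _
  have h1 := DFunLike.congr_fun (proj_comp_simplexLift (x₀ := x₀) hX (q.comp σ)) t
  obtain ⟨f, hf⟩ := h.surjective (simplexLift x₀ (q.comp σ) t) (σ t) h1.symm
  refine ⟨f, lift_unique h.covering ?_ hf⟩
  rw [h.comp_eq, proj_comp_simplexLift hX]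

/-- Among the lifts of `q ∘ σ` one is `σ`. Any other lift meeting `V` would agree with `σ` at that
parameter, since `q` is injective on `V`, and would then equal `σ` by uniqueness of lifts. -/
theorem transfer_pushChain_sub_mem {V : Set Y} (hV : Set.InjOn q V) {k : ℕ} {c : Chain Y k}
    (hc : c ∈ chainsIn V k) : transfer Φ k (pushChain q k c) - c ∈ chainsIn Vᶜ k := by
  classical
  refine map_mem_of_chainsIn (transfer Φ k ∘ₗ pushChain q k - LinearMap.id) _ (fun σ hσ => ?_) hc
  obtain ⟨f, hf⟩ := h.exists_comp_simplexLift hX σ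
  rw [LinearMap.sub_apply, LinearMap.comp_apply, pushChain_single, transfer_single,
    LinearMap.id_apply, ← Finset.add_sum_erase _ _ (Finset.mem_univ f), hf, add_sub_cancel_left]
  refine sum_mem fun f' hf' => single_mem_chainsIn ?_ _
  rintro _ ⟨t, rfl⟩ ht
  refine (Finset.ne_of_mem_erase hf') (h.comp_injective (σ := simplexLift x₀ (q.comp σ)) ?_)
  have h1 : q.comp ((Φ f').comp (simplexLift x₀ (q.comp σ))) = q.comp σ := by
    rw [h.comp_eq, proj_comp_simplexLift hX]
  rw [hf]
  exact lift_unique h.covering h1 (hV ht (hσ ⟨t, rfl⟩) (DFunLike.congr_fun h1 t))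

theorem represents_transfer {k : ℕ} {y : Y} {g : RelHomology ({y}ᶜ : Set Y) k}
    {g' : RelHomology ({q y}ᶜ : Set X) k} {V : Set Y} (hy : y ∈ V) (hV : Set.InjOn q V)
    {a : Chain Y k} (haV : a ∈ chainsIn V k) (ha : Represents a g)
    (ha' : Represents (pushChain q k a) g') {c : Chain X k} (hc : Represents c g') :
    Represents (transfer Φ k c) g := by
  refine ha.of_sub_mem ?_
  have h1 := relBoundaries_mono (preimage_compl_singleton_subset q y) k
    (h.transfer_mem_relBoundaries hX (ha'.sub_mem hc))
  have h2 : transfer Φ k (pushChain q k a) - a ∈ relBoundaries ({y}ᶜ : Set Y) k :=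
    mem_relBoundaries.2 ⟨0, _, chainsIn_mono (Set.compl_subset_compl.2
      (Set.singleton_subset_iff.2 hy)) k (h.transfer_pushChain_sub_mem hX hV haV), by simp⟩
  have := _root_.sub_mem h1 h2
  rw [map_sub] at this
  convert this using 1
  abel

variable {m : ℕ} {o : Orientation X (m + 1)}

/-- The transfer of a fundamental cycle is a fundamental cycle. -/
theorem isFundamentalCycle_transfer {o' : Orientation Y (m + 1)} (ho : IsPullback o' q o)
    {c : Chain X (m + 1)} (hc : IsFundamentalCycle o c) :
    IsFundamentalCycle o' (transfer Φ (m + 1) c) := by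
  refine ⟨h.transfer_mem_relCycles hX hc.1, fun y => ?_⟩
  obtain ⟨V, -, hy, hV, a, haV, ha, ha'⟩ := ho y
  exact h.represents_transfer hX hy hV haV ha ha' (hc.2 (q y))

/-- Local homology classes of a covering come from chains on which the covering is injective. -/
theorem exists_local_relCycle [T1Space X] [T1Space Y] (y : Y) :
    ∃ V : Set Y, IsOpen V ∧ y ∈ V ∧ Set.InjOn q V ∧
      (∀ c ∈ relCycles ({y}ᶜ : Set Y) (m + 1), ∃ a ∈ chainsIn V (m + 1),
        c - a ∈ relBoundaries ({y}ᶜ : Set Y) (m + 1)) ∧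
      (∀ c ∈ relCycles ({q y}ᶜ : Set X) (m + 1), ∃ a ∈ chainsIn V (m + 1),
        c - pushChain q (m + 1) a ∈ relBoundaries ({q y}ᶜ : Set X) (m + 1)) ∧
      ∀ a ∈ chainsIn V (m + 1), a ∈ relCycles ({y}ᶜ : Set Y) (m + 1) →
        pushChain q (m + 1) a ∈ relCycles ({q y}ᶜ : Set X) (m + 1) := by
  obtain ⟨e, hye, he⟩ := h.covering.isLocalHomeomorph y
  have hinj : Set.InjOn q e.source := by
    rw [he]
    exact e.injOn
  refine ⟨e.source, e.open_source, hye, hinj, fun c hc => ?_, fun c hc => ?_, fun a haV ha => ?_⟩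
  · exact exists_relCycle_in e.open_source isClosed_singleton (by simpa using hye) hc
  · have hi : IsOpenEmbedding (q.comp ⟨Subtype.val, continuous_subtype_val⟩ : C(e.source, X)) := by
      refine .of_continuous_injective_isOpenMap (ContinuousMap.continuous _) ?_
        (h.covering.isOpenMap.comp e.open_source.isOpenMap_subtype_val)
      intro a b hab
      exact Subtype.ext (hinj a.2 b.2 hab)
    have hyi : q y ∈ Set.range (q.comp ⟨Subtype.val, continuous_subtype_val⟩ : C(e.source, X)) :=
      ⟨⟨y, hye⟩, rfl⟩
    obtain ⟨a, ha, hca⟩ := exists_relCycle_in hi.isOpen_range isClosed_singleton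
      (by simpa using hyi) hc
    rw [← Set.image_univ] at ha
    obtain ⟨a', -, rfl⟩ := exists_pushChain_eq hi.isEmbedding ha
    refine ⟨pushChain ⟨Subtype.val, continuous_subtype_val⟩ _ a', ?_, ?_⟩
    · exact pushChain_mem_chainsIn (A := Set.univ) _ (fun v _ => v.2) (mem_chainsIn_univ _)
    · rwa [← pushChain_comp]
  · have h1 := chainsIn_inter (boundary_mem_chainsIn haV) (mem_relCycles.1 ha)
    rw [mem_relCycles, pushChain_boundary]
    refine pushChain_mem_chainsIn (B := {q y}ᶜ) q ?_ h1
    rintro v ⟨hv, hvy⟩ e'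
    exact hvy (hinj hv hye e')

/-- The pull-back of an orientation to a finite covering. -/
theorem exists_isPullback [T1Space X] [T1Space Y] (o : Orientation X (m + 1)) :
    ∃ o' : Orientation Y (m + 1), IsPullback o' q o := by
  choose c hc using fun x => exists_represents (o.gen x)
  have hcyc : ∀ y, transfer Φ (m + 1) (c (q y)) ∈ relCycles ({y}ᶜ : Set Y) (m + 1) := fun y =>
    relCycles_mono (preimage_compl_singleton_subset q y) _
      (h.transfer_mem_relCycles hX (hc (q y)).1)
  -- The generator at `y` is the transfer of a representative at `q y`. Relative to the complement
  -- of `y` only the sheet through `y` matters; `hloc` below expresses this.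
  obtain ⟨gen, hgen₀⟩ : ∃ gen : (y : Y) → RelHomology ({y}ᶜ : Set Y) (m + 1),
      ∀ y, Represents (transfer Φ (m + 1) (c (q y))) (gen y) :=
    ⟨fun y => Submodule.Quotient.mk ⟨transfer Φ (m + 1) (c (q y)), hcyc y⟩,
      fun y => ⟨hcyc y, rfl⟩⟩
  have hgen : ∀ y (c' : Chain X (m + 1)), Represents c' (o.gen (q y)) →
      Represents (transfer Φ (m + 1) c') (gen y) := by
    intro y c' hc'
    refine (hgen₀ y).of_sub_mem ?_
    rw [← map_sub]
    exact relBoundaries_mono (preimage_compl_singleton_subset q y) _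
      (h.transfer_mem_relBoundaries hX ((hc (q y)).sub_mem hc'))
  have hloc : ∀ y (V : Set Y), y ∈ V → Set.InjOn q V → ∀ a ∈ chainsIn V (m + 1),
      transfer Φ (m + 1) (pushChain q (m + 1) a) - a ∈ relBoundaries ({y}ᶜ : Set Y) (m + 1) :=
    fun y V hy hV a ha => mem_relBoundaries.2 ⟨0, _, chainsIn_mono (Set.compl_subset_compl.2
      (Set.singleton_subset_iff.2 hy)) _ (h.transfer_pushChain_sub_mem hX hV ha), by simp⟩
  refine ⟨⟨gen, fun y => ?_, fun y => ?_⟩, fun y => ?_⟩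
  · obtain ⟨V, -, hy, hV, h1, -, h3⟩ := h.exists_local_relCycle hX (m := m) y
    refine eq_top_iff.2 fun g _ => ?_
    -- An arbitrary class at `y` is represented inside `V`. Its image downstairs is a multiple `r`
    -- of the generator, and the transfer brings this relation back to `y`.
    obtain ⟨z, hz, rfl⟩ := exists_represents g
    obtain ⟨a, haV, hza⟩ := h1 z hz
    have ha : a ∈ relCycles ({y}ᶜ : Set Y) (m + 1) := by
      have := sub_mem hz (relBoundaries_le_relCycles _ _ hza)
      rwa [sub_sub_cancel] at this
    have hqa := h3 a haV ha
    have hspan : (Submodule.Quotient.mk ⟨pushChain q (m + 1) a, hqa⟩ :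
        RelHomology ({q y}ᶜ : Set X) (m + 1)) ∈ Submodule.span ℤ {o.gen (q y)} := by
      rw [o.span_gen]
      trivial
    obtain ⟨r, hr⟩ := Submodule.mem_span_singleton.1 hspan
    have h4 : r • c (q y) - pushChain q (m + 1) a ∈ relBoundaries ({q y}ᶜ : Set X) (m + 1) := by
      obtain ⟨hcc, hcg⟩ := hc (q y)
      rw [← hcg] at hr
      exact (Submodule.Quotient.eq ((relBoundaries ({q y}ᶜ : Set X) (m + 1)).submoduleOf
        (relCycles ({q y}ᶜ : Set X) (m + 1)))).1 hr
    have h5 := relBoundaries_mono (preimage_compl_singleton_subset q y) _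
      (h.transfer_mem_relBoundaries hX h4)
    rw [map_sub, map_smul] at h5
    have h6 := sub_mem (add_mem h5 (hloc y V hy hV a haV)) hza
    refine Submodule.mem_span_singleton.2 ⟨r, ?_⟩
    obtain ⟨hyc, hyg⟩ := hgen₀ y
    rw [← hyg]
    refine (Submodule.Quotient.eq ((relBoundaries ({y}ᶜ : Set Y) (m + 1)).submoduleOf
        (relCycles ({y}ᶜ : Set Y) (m + 1)))).2 ?_
    change r • transfer Φ (m + 1) (c (q y)) - z ∈ relBoundaries ({y}ᶜ : Set Y) (m + 1)
    convert h6 using 1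
    abel
  · obtain ⟨U, hU, hyU, c', hc', h1⟩ := o.consistent (q y)
    have h2 : transfer Φ (m + 1) c' ∈ relCycles (q ⁻¹' U)ᶜ (m + 1) := by
      rw [← Set.preimage_compl]
      exact h.transfer_mem_relCycles hX hc'
    exact ⟨q ⁻¹' U, hU.preimage q.continuous, hyU, transfer Φ (m + 1) c', h2,
      fun y' hy' => hgen y' c' (h1 (q y') hy')⟩
  · obtain ⟨V, hVo, hy, hV, -, h2, -⟩ := h.exists_local_relCycle hX (m := m) y
    obtain ⟨a, haV, hca⟩ := h2 (c (q y)) (hc (q y)).1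
    have h1 : Represents (pushChain q (m + 1) a) (o.gen (q y)) := (hc (q y)).of_sub_mem hca
    have h2 : Represents a (gen y) := (hgen y _ h1).of_sub_mem (hloc y V hy hV a haV)
    exact ⟨V, hVo, hy, hV, a, haV, h2, h1⟩

end IsAssociated

end Transfer

/-! ### Reduced forms of parametrized chains -/

section Reduced

open UniversalCover

theorem l1Norm_eq_sum {Z : Type u} [TopologicalSpace Z] {k : ℕ} (c : Chain Z k)
    {J : Finset (SingularSimplex Z k)} (hJ : c.support ⊆ J) : l1Norm c = ∑ σ ∈ J, ‖c σ‖ₑ :=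
  Finset.sum_subset hJ fun σ _ hσ => by simp [Finsupp.notMem_support_iff.1 hσ]

section RightAct

variable {Γ : Type u} [Group Γ] {S : Type v} [MeasurableSpace S] [MulAction Γ S]
  [MeasurableConstSMul Γ S] {μ : Measure S} [SMulInvariantMeasure Γ S μ]

theorem coeFn_zsmul_linfty (n : ℤ) (f : LInfty μ) : ⇑(n • f) =ᵐ[μ] fun x => n * f x := by
  induction n using Int.induction_on with
  | zero =>
    rw [zero_smul]
    filter_upwards [Lp.coeFn_zero ℤ ∞ μ] with x hx
    rw [hx]
    simp
  | succ n ih =>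
    rw [add_smul, one_smul]
    filter_upwards [ih, Lp.coeFn_add ((n : ℤ) • f) f] with x h1 h2
    rw [h2, Pi.add_apply, h1]
    ring
  | pred n ih =>
    rw [sub_smul, one_smul]
    filter_upwards [ih, Lp.coeFn_sub ((-n : ℤ) • f) f] with x h1 h2
    rw [h2, Pi.sub_apply, h1]
    ring

theorem coeFn_rightAct (f : LInfty μ) (g : Γ) : ⇑(rightAct f g) =ᵐ[μ] fun x => f (g • x) :=
  Lp.coeFn_compMeasurePreserving f (measurePreserving_smul g μ)

theorem ae_smul {p : S → Prop} (h : ∀ᵐ x ∂μ, p x) (g : Γ) : ∀ᵐ x ∂μ, p (g • x) :=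
  (measurePreserving_smul g μ).quasiMeasurePreserving.ae h

/-- The right action as a linear map. -/
def rightActHom (g : Γ) : LInfty μ →ₗ[ℤ] LInfty μ :=
  (Lp.compMeasurePreserving (g • ·) (measurePreserving_smul g μ)).toIntLinearMap

theorem rightAct_rightAct (f : LInfty μ) (g h : Γ) :
    rightAct (rightAct f g) h = rightAct f (g * h) := by
  refine Lp.ext ?_
  filter_upwards [coeFn_rightAct (rightAct f g) h, coeFn_rightAct f (g * h),
    ae_smul (coeFn_rightAct f g) h] with x h1 h2 h3
  rw [h1, h2, h3, mul_smul]

theorem lintegral_rightAct (f : LInfty μ) (g : Γ) :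
    ∫⁻ x, ‖rightAct f g x‖ₑ ∂μ = ∫⁻ x, ‖f x‖ₑ ∂μ := by
  rw [← (measurePreserving_smul g μ).lintegral_comp (Lp.stronglyMeasurable f).enorm]
  refine lintegral_congr_ae ?_
  filter_upwards [coeFn_rightAct f g] with x hx
  rw [hx]

end RightAct

variable {X : Type u} [TopologicalSpace X] {x₀ : X} [PathConnectedSpace X] (hX : LocallySimple X)
  {S : Type v} [MeasurableSpace S] [MulAction (FundamentalGroup X x₀) S]
  [MeasurableConstSMul (FundamentalGroup X x₀) S] {μ : Measure S}
  [SMulInvariantMeasure (FundamentalGroup X x₀) S μ]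

/-- The coefficients of the chosen lifts in an elementary tensor. -/
def preCoeffAux (x₀ : X) {S : Type v} [MeasurableSpace S] [MulAction (FundamentalGroup X x₀) S]
    [MeasurableConstSMul (FundamentalGroup X x₀) S] (μ : Measure S)
    [SMulInvariantMeasure (FundamentalGroup X x₀) S μ] (k : ℕ) :
    LInfty μ →ₗ[ℤ] Chain (UniversalCover x₀) k →ₗ[ℤ] (SingularSimplex X k →₀ LInfty μ) :=
  LinearMap.flip (Finsupp.linearCombination ℤ fun σ =>
    (Finsupp.lsingle ((proj x₀).comp σ)) ∘ₗ rightActHom (μ := μ) (deck σ))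

omit [PathConnectedSpace X] in
theorem preCoeffAux_single (k : ℕ) (f : LInfty μ) (σ : SingularSimplex (UniversalCover x₀) k) :
    preCoeffAux x₀ μ k f (Finsupp.single σ 1)
      = Finsupp.single ((proj x₀).comp σ) (rightAct f (deck σ)) := by
  rw [preCoeffAux, LinearMap.flip_apply, Finsupp.linearCombination_single, one_smul]
  rfl

theorem deck_smul_simplex (hX : LocallySimple X) {k : ℕ} (g : FundamentalGroup X x₀)
    (σ : SingularSimplex (UniversalCover x₀) k) : deck (g • σ) = g * deck σ := by
  have h1 : (proj x₀).comp (g • σ) = (proj x₀).comp σ := rfl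
  refine smul_simplex_injective (simplexLift x₀ ((proj x₀).comp σ)) ?_
  have h2 := deck_smul hX (g • σ)
  rw [h1] at h2
  change deck (g • σ) • _ = (g * deck σ) • _
  rw [h2, mul_smul, deck_smul hX]

-- By the cocycle rule `deck (g • σ) = g * deck σ`, both sides translate `f` by `g * deck σ`. This
-- is the balancing condition that makes the coefficients well defined on the tensor product over
-- `ℤΓ`.
include hX in
theorem preCoeffAux_leftAct (k : ℕ) (f : LInfty μ) (g : FundamentalGroup X x₀)
    (c : Chain (UniversalCover x₀) k) :
    preCoeffAux x₀ μ k (rightAct f g) c = preCoeffAux x₀ μ k f (leftAct g k c) := by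
  suffices preCoeffAux x₀ μ k (rightAct f g) = preCoeffAux x₀ μ k f ∘ₗ leftAct g k from
    LinearMap.congr_fun this c
  refine chain_hom_ext fun σ => ?_
  rw [LinearMap.comp_apply, leftAct_single, preCoeffAux_single, preCoeffAux_single,
    deck_smul_simplex hX, rightAct_rightAct]
  rfl

/-- The coefficients of the chosen lifts in a parametrized chain. -/
def parCoeff (hX : LocallySimple X) (μ : Measure S) [SMulInvariantMeasure (FundamentalGroup X x₀) S μ] (k : ℕ) :
    ParChain (FundamentalGroup X x₀) μ (UniversalCover x₀) k →+
      (SingularSimplex X k →₀ LInfty μ) :=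
  QuotientAddGroup.lift _ (TensorProduct.lift (preCoeffAux x₀ μ k)).toAddMonoidHom <| by
    refine (AddSubgroup.closure_le _).2 ?_
    rintro _ ⟨f, g, c, rfl⟩
    have h1 := map_sub (TensorProduct.lift (preCoeffAux x₀ μ k)) (rightAct f g ⊗ₜ[ℤ] c)
      (f ⊗ₜ[ℤ] leftAct g k c)
    have h2 : TensorProduct.lift (preCoeffAux x₀ μ k) (rightAct f g ⊗ₜ[ℤ] c)
        = TensorProduct.lift (preCoeffAux x₀ μ k) (f ⊗ₜ[ℤ] leftAct g k c) :=
      preCoeffAux_leftAct hX k f g c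
    rw [h2, sub_self] at h1
    exact h1

theorem parCoeff_parTmul_single (k : ℕ) (f : LInfty μ)
    (σ : SingularSimplex (UniversalCover x₀) k) :
    parCoeff hX μ k (parTmul _ μ f (Finsupp.single σ 1))
      = Finsupp.single ((proj x₀).comp σ) (rightAct f (deck σ)) :=
  preCoeffAux_single k f σ

section ParTmul

variable {k : ℕ} (μ)

omit [PathConnectedSpace X] in
theorem parTmul_add_left (f g : LInfty μ) (c : Chain (UniversalCover x₀) k) :
    parTmul (FundamentalGroup X x₀) μ (f + g) c = parTmul _ μ f c + parTmul _ μ g c := by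
  simp only [parTmul, TensorProduct.add_tmul]
  rfl

omit [PathConnectedSpace X] in
theorem parTmul_add_right (f : LInfty μ) (c d : Chain (UniversalCover x₀) k) :
    parTmul (FundamentalGroup X x₀) μ f (c + d) = parTmul _ μ f c + parTmul _ μ f d := by
  simp only [parTmul, TensorProduct.tmul_add]
  rfl

/-- `parTmul` as a homomorphism in the second variable. -/
def parTmulHom (f : LInfty μ) : Chain (UniversalCover x₀) k →+
    ParChain (FundamentalGroup X x₀) μ (UniversalCover x₀) k where
  toFun := parTmul _ μ f
  map_zero' := by simp [parTmul]
  map_add' := parTmul_add_right μ f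

omit [PathConnectedSpace X] in
theorem parTmulHom_apply (f : LInfty μ) (c : Chain (UniversalCover x₀) k) :
    parTmulHom μ f c = parTmul (FundamentalGroup X x₀) μ f c := rfl

omit [PathConnectedSpace X] in
theorem parTmul_zsmul (f : LInfty μ) (n : ℤ) (c : Chain (UniversalCover x₀) k) :
    parTmul (FundamentalGroup X x₀) μ (n • f) c = parTmul _ μ f (n • c) := by
  simp only [parTmul, TensorProduct.smul_tmul]

omit [PathConnectedSpace X] in
theorem parTmul_leftAct (f : LInfty μ) (g : FundamentalGroup X x₀)
    (c : Chain (UniversalCover x₀) k) :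
    parTmul (FundamentalGroup X x₀) μ f (leftAct g k c) = parTmul _ μ (rightAct f g) c := by
  refine (QuotientAddGroup.eq_iff_sub_mem.2 ?_).symm
  exact AddSubgroup.subset_closure ⟨f, g, c, rfl⟩

omit [PathConnectedSpace X] in
/-- Every parametrized chain is a sum of elementary tensors. -/
theorem exists_eq_sum_parTmul (c : ParChain (FundamentalGroup X x₀) μ (UniversalCover x₀) k) :
    ∃ (N : ℕ) (f : Fin N → LInfty μ) (σ : Fin N → SingularSimplex (UniversalCover x₀) k),
      c = ∑ j, parTmul _ μ (f j) (Finsupp.single (σ j) 1) := by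
  obtain ⟨t, rfl⟩ := QuotientAddGroup.mk_surjective c
  induction t using TensorProduct.induction_on with
  | zero => exact ⟨0, Fin.elim0, Fin.elim0, by simp⟩
  | tmul f c =>
    induction c using Finsupp.induction_linear with
    | zero => exact ⟨0, Fin.elim0, Fin.elim0, by simp⟩
    | add c d hc hd =>
      obtain ⟨N, f₁, σ₁, h₁⟩ := hc
      obtain ⟨K, f₂, σ₂, h₂⟩ := hd
      refine ⟨N + K, Fin.append f₁ f₂, Fin.append σ₁ σ₂, ?_⟩
      simp only [Fin.sum_univ_add, Fin.append_left, Fin.append_right]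
      rw [← h₁, ← h₂]
      exact parTmul_add_right μ f c d
    | single σ a =>
      refine ⟨1, fun _ => a • f, fun _ => σ, ?_⟩
      simp only [Finset.univ_unique, Finset.sum_singleton, parTmul_zsmul, Finsupp.smul_single,
        smul_eq_mul, mul_one]
      rfl
  | add s t hs ht =>
    obtain ⟨N, f₁, σ₁, h₁⟩ := hs
    obtain ⟨K, f₂, σ₂, h₂⟩ := ht
    refine ⟨N + K, Fin.append f₁ f₂, Fin.append σ₁ σ₂, ?_⟩
    simp only [Fin.sum_univ_add, Fin.append_left, Fin.append_right]
    rw [← h₁, ← h₂]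
    rfl

include hX in
theorem parTmul_single_eq (f : LInfty μ) (σ : SingularSimplex (UniversalCover x₀) k) :
    parTmul (FundamentalGroup X x₀) μ f (Finsupp.single σ 1)
      = parTmul _ μ (rightAct f (deck σ))
        (Finsupp.single (simplexLift x₀ ((proj x₀).comp σ)) 1) := by
  rw [← parTmul_leftAct, leftAct_single, deck_smul hX]

theorem eq_sum_parCoeff (c : ParChain (FundamentalGroup X x₀) μ (UniversalCover x₀) k)
    {J : Finset (SingularSimplex X k)} (hJ : (parCoeff hX μ k c).support ⊆ J) :
    c = ∑ s ∈ J, parTmul _ μ (parCoeff hX μ k c s) (Finsupp.single (simplexLift x₀ s) 1) := by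
  let B : SingularSimplex X k → LInfty μ →+
      ParChain (FundamentalGroup X x₀) μ (UniversalCover x₀) k := fun s =>
    { toFun := fun f => parTmul _ μ f (Finsupp.single (simplexLift x₀ s) 1)
      map_zero' := by simp [parTmul]
      map_add' := fun f g => parTmul_add_left μ f g _ }
  have hB : c = Finsupp.liftAddHom B (parCoeff hX μ k c) := by
    obtain ⟨N, f, σ, rfl⟩ := exists_eq_sum_parTmul μ c
    simp only [map_sum, parCoeff_parTmul_single, Finsupp.liftAddHom_apply_single]
    exact Finset.sum_congr rfl fun j _ => parTmul_single_eq hX μ (f j) (σ j)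
  rw [Finsupp.liftAddHom_apply, Finsupp.sum_of_support_subset _ hJ _ (fun s _ => map_zero (B s))]
    at hB
  exact hB

end ParTmul

/-- The coefficients of any reduced form differ from those of the form with chosen lifts only by
right translations, and these preserve the integral of the absolute value. -/
theorem parNorm_eq {k : ℕ} (c : ParChain (FundamentalGroup X x₀) μ (UniversalCover x₀) k)
    {J : Finset (SingularSimplex X k)} (hJ : (parCoeff hX μ k c).support ⊆ J) :
    parNorm (FundamentalGroup X x₀) μ (proj x₀) c
      = ∑ s ∈ J, ∫⁻ x, ‖parCoeff hX μ k c s x‖ₑ ∂μ := by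
  have hzero : ∫⁻ x, ‖(0 : LInfty μ) x‖ₑ ∂μ = 0 := by
    rw [lintegral_congr_ae (g := fun _ => 0)]
    · simp
    · filter_upwards [Lp.coeFn_zero ℤ ∞ μ] with x hx
      rw [hx, Pi.zero_apply, enorm_zero]
  refine le_antisymm ?_ ?_
  · refine iInf_le_of_le J.card (iInf_le_of_le (fun j => parCoeff hX μ k c (J.equivFin.symm j))
      (iInf_le_of_le (fun j => simplexLift x₀ (J.equivFin.symm j)) (iInf_le_of_le ?_
      (iInf_le_of_le ?_ ?_))))
    · intro i j hij
      simp only [proj_comp_simplexLift hX] at hij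
      exact J.equivFin.symm.injective (Subtype.ext hij)
    · have h1 := J.equivFin.symm.sum_comp fun s : J => parTmul (FundamentalGroup X x₀) μ
        (parCoeff hX μ k c s) (Finsupp.single (simplexLift x₀ (s : SingularSimplex X k)) 1)
      have h2 := Finset.sum_coe_sort J fun s => parTmul (FundamentalGroup X x₀) μ
        (parCoeff hX μ k c s) (Finsupp.single (simplexLift x₀ s) 1)
      exact (eq_sum_parCoeff hX μ c hJ).trans (h2.symm.trans h1.symm)
    · have h1 := J.equivFin.symm.sum_comp fun s : J => ∫⁻ x, ‖parCoeff hX μ k c s x‖ₑ ∂μ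
      have h2 := Finset.sum_coe_sort J fun s => ∫⁻ x, ‖parCoeff hX μ k c s x‖ₑ ∂μ
      exact (h1.trans h2).le
  · refine le_iInf fun N => le_iInf fun f => le_iInf fun σ => le_iInf fun hσ => le_iInf fun hc => ?_
    classical
    have hcoeff : parCoeff hX μ k c
        = ∑ j, Finsupp.single ((proj x₀).comp (σ j)) (rightAct (f j) (deck (σ j))) := by
      simp only [hc, map_sum, parCoeff_parTmul_single]
    have hval : ∀ j, parCoeff hX μ k c ((proj x₀).comp (σ j)) = rightAct (f j) (deck (σ j)) := by
      intro j
      rw [hcoeff, Finsupp.finsetSum_apply, Finset.sum_eq_single j]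
      · simp
      · intro i _ hij
        exact Finsupp.single_eq_of_ne fun h => hij (hσ h.symm)
      · simp
    have hsub : (parCoeff hX μ k c).support ⊆ Finset.univ.image fun j => (proj x₀).comp (σ j) := by
      intro s hs
      by_contra hns
      refine Finsupp.mem_support_iff.1 hs ?_
      rw [hcoeff, Finsupp.finsetSum_apply]
      refine Finset.sum_eq_zero fun j _ => Finsupp.single_eq_of_ne fun h => hns ?_
      exact Finset.mem_image.2 ⟨j, Finset.mem_univ _, h.symm⟩
    have h1 : ∀ J', (parCoeff hX μ k c).support ⊆ J' →
        ∑ s ∈ J', ∫⁻ x, ‖parCoeff hX μ k c s x‖ₑ ∂μ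
          = ∑ s ∈ (parCoeff hX μ k c).support, ∫⁻ x, ‖parCoeff hX μ k c s x‖ₑ ∂μ := by
      intro J' hJ'
      refine (Finset.sum_subset hJ' fun s _ hs => ?_).symm
      rw [Finsupp.notMem_support_iff.1 hs, hzero]
    rw [h1 J hJ, ← h1 _ hsub, Finset.sum_image fun i _ j _ h => hσ h]
    refine (Finset.sum_congr rfl fun j _ => ?_).le
    rw [hval, lintegral_rightAct]

/-- The parametrized chain `c` is given by a family of chains which depends on the parameter. -/
def HasCoeff (hX : LocallySimple X) {k : ℕ} (c : ParChain (FundamentalGroup X x₀) μ (UniversalCover x₀) k)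
    (C : S → Chain X k) : Prop :=
  ∀ s, parCoeff hX μ k c s =ᵐ[μ] fun x => C x s

section HasCoeff

variable {hX} {k : ℕ} {c d : ParChain (FundamentalGroup X x₀) μ (UniversalCover x₀) k}
  {C D : S → Chain X k}

theorem HasCoeff.zero : HasCoeff hX (0 : ParChain (FundamentalGroup X x₀) μ (UniversalCover x₀) k)
    fun _ => 0 := fun s => by
  rw [map_zero]
  exact Lp.coeFn_zero ℤ ∞ μ

theorem HasCoeff.add (hc : HasCoeff hX c C) (hd : HasCoeff hX d D) :
    HasCoeff hX (c + d) fun x => C x + D x := fun s => by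
  rw [map_add, Finsupp.add_apply]
  filter_upwards [hc s, hd s, Lp.coeFn_add (parCoeff hX μ k c s) (parCoeff hX μ k d s)]
    with x h1 h2 h3
  rw [h3, Pi.add_apply, h1, h2, Finsupp.add_apply]

theorem HasCoeff.zsmul (hc : HasCoeff hX c C) (n : ℤ) :
    HasCoeff hX (n • c) fun x => n • C x := fun s => by
  rw [map_zsmul, Finsupp.smul_apply]
  filter_upwards [hc s, coeFn_zsmul_linfty n (parCoeff hX μ k c s)] with x h1 h2
  rw [h2, h1, Finsupp.smul_apply, smul_eq_mul]

theorem HasCoeff.sum {ι : Type w} (I : Finset ι)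
    {c : ι → ParChain (FundamentalGroup X x₀) μ (UniversalCover x₀) k} {C : ι → S → Chain X k}
    (h : ∀ i, HasCoeff hX (c i) (C i)) : HasCoeff hX (∑ i ∈ I, c i) fun x => ∑ i ∈ I, C i x := by
  classical
  induction I using Finset.induction_on with
  | empty => simpa using HasCoeff.zero
  | insert i I hi ih =>
    simp only [Finset.sum_insert hi]
    exact (h i).add ih

theorem HasCoeff.parTmul_single (f : LInfty μ) {f' : S → ℤ} (hf : f =ᵐ[μ] f')
    (σ : SingularSimplex (UniversalCover x₀) k) :
    HasCoeff hX (parTmul _ μ f (Finsupp.single σ 1))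
      fun x => f' (deck σ • x) • Finsupp.single ((proj x₀).comp σ) 1 := fun s => by
  classical
  rw [parCoeff_parTmul_single]
  by_cases hs : (proj x₀).comp σ = s
  · subst hs
    simp only [Finsupp.single_eq_same]
    filter_upwards [coeFn_rightAct f (deck σ), ae_smul hf (deck σ)] with x h1 h2
    rw [h1, h2]
    simp
  · rw [Finsupp.single_eq_of_ne (Ne.symm hs)]
    filter_upwards [Lp.coeFn_zero ℤ ∞ μ] with x hx
    rw [hx]
    simp [Finsupp.single_eq_of_ne (Ne.symm hs)]

theorem HasCoeff.parTmul_const [IsFiniteMeasure μ] (z : Chain (UniversalCover x₀) k) :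
    HasCoeff hX (parTmul _ μ (Lp.const ∞ μ (1 : ℤ)) z) fun _ => pushChain (proj x₀) k z := by
  induction z using Finsupp.induction_linear with
  | zero =>
    rw [map_zero, ← parTmulHom_apply, map_zero]
    exact HasCoeff.zero
  | add y z hy hz =>
    rw [map_add, parTmul_add_right]
    exact hy.add hz
  | single σ a =>
    have h1 : (Finsupp.single σ a : Chain (UniversalCover x₀) k) = a • Finsupp.single σ 1 := by
      simp
    rw [h1, ← parTmulHom_apply, map_zsmul, map_smul, pushChain_single]
    refine HasCoeff.zsmul ?_ a
    have := HasCoeff.parTmul_single (hX := hX) (Lp.const ∞ μ (1 : ℤ))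
      (Lp.coeFn_const (p := ∞) (μ := μ) (c := (1 : ℤ))) σ
    simp only [Function.const_apply, one_smul] at this
    exact this

/-- One finite set `J` contains the supports for all parameters, so the `ℓ¹`-norm is a sum over a
fixed index set and can be exchanged with the integral. -/
theorem HasCoeff.parNorm_eq (hc : HasCoeff hX c C) {J : Finset (SingularSimplex X k)}
    (hJ : ∀ x, (C x).support ⊆ J) :
    parNorm (FundamentalGroup X x₀) μ (proj x₀) c = ∫⁻ x, l1Norm (C x) ∂μ := by
  classical
  rw [FoliatedVolume.parNorm_eq hX c
    (J := J ∪ (parCoeff hX μ k c).support) Finset.subset_union_right,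
    lintegral_congr fun x => l1Norm_eq_sum (C x) ((hJ x).trans Finset.subset_union_left)]
  have h1 : ∀ s, (fun x => ‖parCoeff hX μ k c s x‖ₑ) =ᵐ[μ] fun x => ‖C x s‖ₑ := fun s => by
    filter_upwards [hc s] with x hx
    rw [hx]
  rw [lintegral_finsetSum' _ fun s _ =>
    ((Lp.stronglyMeasurable (parCoeff hX μ k c s)).enorm.aemeasurable).congr (h1 s)]
  exact Finset.sum_congr rfl fun s _ => lintegral_congr_ae (h1 s)

end HasCoeff

/-! ### Parametrized volume as an infimum of integrals of local functions -/

/-- The value in a point of the parametrized chain `1 ⊗ z + ∑ h_j ⊗ ∂ τ_j`; here `w γ j` is the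
value of `h_j` in the translate of that point by `γ`. -/
def evalChain {k N : ℕ} (z : Chain (UniversalCover x₀) k)
    (τ : Fin N → SingularSimplex (UniversalCover x₀) (k + 1))
    (w : FundamentalGroup X x₀ → Fin N → ℤ) : Chain X k :=
  pushChain (proj x₀) k z + ∑ j, ∑ i : Fin (k + 2), ((-1 : ℤ) ^ (i : ℕ)) •
    (w (deck (face i (τ j))) j • Finsupp.single ((proj x₀).comp (face i (τ j))) (1 : ℤ))

omit [PathConnectedSpace X] in
theorem exists_support_evalChain {k N : ℕ} (z : Chain (UniversalCover x₀) k)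
    (τ : Fin N → SingularSimplex (UniversalCover x₀) (k + 1)) :
    ∃ J : Finset (SingularSimplex X k), ∀ w, (evalChain z τ w).support ⊆ J := by
  classical
  refine ⟨(pushChain (proj x₀) k z).support ∪
    Finset.univ.image fun p : Fin N × Fin (k + 2) => (proj x₀).comp (face p.2 (τ p.1)), fun w => ?_⟩
  rw [← Finset.coe_subset, ← Finsupp.mem_supported ℤ]
  refine add_mem ((Finsupp.mem_supported ℤ _).2 ?_) (sum_mem fun j _ => sum_mem fun i _ =>
    Submodule.smul_mem _ _ (Submodule.smul_mem _ _ (Finsupp.single_mem_supported ℤ 1 ?_)))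
  · exact Finset.coe_subset.2 Finset.subset_union_left
  · exact Finset.mem_coe.2 (Finset.mem_union_right _
      (Finset.mem_image.2 ⟨(j, i), Finset.mem_univ _, rfl⟩))

omit [PathConnectedSpace X] in
theorem parTmul_boundary {k : ℕ} (f : LInfty μ)
    (σ : SingularSimplex (UniversalCover x₀) (k + 1)) :
    parTmul (FundamentalGroup X x₀) μ f (boundary _ k (Finsupp.single σ 1))
      = ∑ i : Fin (k + 2), ((-1 : ℤ) ^ (i : ℕ)) • parTmul _ μ f (Finsupp.single (face i σ) 1) := by
  rw [boundary_single, ← parTmulHom_apply, map_sum]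
  exact Finset.sum_congr rfl fun i _ => map_zsmul (parTmulHom μ f) _ _

include hX in
theorem parNorm_eq_lintegral [IsFiniteMeasure μ] {k N : ℕ} (z : Chain (UniversalCover x₀) k)
    (τ : Fin N → SingularSimplex (UniversalCover x₀) (k + 1)) (H : Fin N → LInfty μ)
    (h : S → Fin N → ℤ) (hH : ∀ j, H j =ᵐ[μ] fun x => h x j) :
    parNorm (FundamentalGroup X x₀) μ (proj x₀) (parTmul _ μ (Lp.const ∞ μ (1 : ℤ)) z
        + ∑ j, parTmul _ μ (H j) (boundary _ k (Finsupp.single (τ j) 1)))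
      = ∫⁻ x, l1Norm (evalChain z τ fun γ => h (γ • x)) ∂μ := by
  obtain ⟨J, hJ⟩ := exists_support_evalChain z τ
  refine HasCoeff.parNorm_eq (hX := hX) (J := J) ?_ fun x => hJ _
  refine (HasCoeff.parTmul_const z).add (HasCoeff.sum _ fun j => ?_)
  rw [parTmul_boundary]
  exact HasCoeff.sum _ fun i => (HasCoeff.parTmul_single (H j) (hH j) _).zsmul _

-- The terms `h_j ⊗ ∂τ_j` are boundaries of parametrized chains. Adding them to `1 ⊗ z` leaves the
-- homology class unchanged, for any bounded measurable choice of `h`.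
include hX in
theorem parVolume_le_lintegral {n : ℕ} (o : Orientation X n) [IsProbabilityMeasure μ]
    {N : ℕ} {z : Chain (UniversalCover x₀) n}
    (hz : IsFundamentalCycle o (pushChain (proj x₀) n z))
    (τ : Fin N → SingularSimplex (UniversalCover x₀) (n + 1)) {h : S → Fin N → ℤ}
    (hm : Measurable h) {B : ℝ} (hB : ∀ x j, |(h x j : ℝ)| ≤ B) :
    parVolume o x₀ μ ≤ ∫⁻ x, l1Norm (evalChain z τ fun γ => h (γ • x)) ∂μ := by
  have hmem : ∀ j, MemLp (fun x => h x j) ∞ μ := fun j =>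
    memLp_top_of_bound ((measurable_pi_apply j).comp hm).aestronglyMeasurable B
      (Filter.Eventually.of_forall fun x => by
        rw [← Int.norm_cast_real]
        exact hB x j)
  rw [← parNorm_eq_lintegral hX z τ (fun j => (hmem j).toLp _) h fun j => (hmem j).coeFn_toLp]
  refine iInf₂_le_of_le _ ⟨z, hz, ∑ j, parTmul _ μ ((hmem j).toLp _) (Finsupp.single (τ j) 1), ?_⟩
    le_rfl
  rw [map_sum, add_sub_cancel_left]
  exact Finset.sum_congr rfl fun j _ => parBoundary_parTmul _ μ _ _

include hX in
theorem exists_lintegral_lt {n : ℕ} (o : Orientation X n) [IsProbabilityMeasure μ] {r : ℝ≥0∞}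
    (hr : parVolume o x₀ μ < r) :
    ∃ (N : ℕ) (z : Chain (UniversalCover x₀) n)
      (τ : Fin N → SingularSimplex (UniversalCover x₀) (n + 1)) (h : S → Fin N → ℤ) (B : ℕ),
      IsFundamentalCycle o (pushChain (proj x₀) n z) ∧ Measurable h ∧ (∀ x j, |h x j| ≤ B) ∧
      ∫⁻ x, l1Norm (evalChain z τ fun γ => h (γ • x)) ∂μ < r := by
  simp only [parVolume, parVolumeOn, iInf_lt_iff] at hr
  obtain ⟨c, ⟨z, hz, b, hb⟩, hcr⟩ := hr
  obtain ⟨N, H, τ, rfl⟩ := exists_eq_sum_parTmul μ b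
  have hbd : ∀ j, ∃ B : ℕ, ∀ᵐ x ∂μ, |H j x| ≤ B := fun j => by
    have h1 := Lp.eLpNorm_lt_top (H j)
    rw [eLpNorm_exponent_top] at h1
    refine ⟨⌈(eLpNormEssSup (H j) μ).toReal⌉₊, ?_⟩
    filter_upwards [ae_le_eLpNormEssSup (f := H j) (μ := μ)] with x hx
    have h2 : ‖H j x‖ ≤ (eLpNormEssSup (H j) μ).toReal := by
      have := ENNReal.toReal_mono h1.ne hx
      simpa using this
    rw [← Int.norm_cast_real, Real.norm_eq_abs] at h2
    have h3 := h2.trans (Nat.le_ceil _)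
    exact_mod_cast h3
  choose B hB using hbd
  -- Truncation to `0` where the essential bound fails: a change on a null set that makes the
  -- functions bounded everywhere. The sum of the `B j` bounds all of them.
  let h : S → Fin N → ℤ := fun x j => if |H j x| ≤ B j then H j x else 0
  refine ⟨N, z, τ, h, ∑ j, B j, hz, ?_, ?_, ?_⟩
  · refine measurable_pi_lambda _ fun j => ?_
    have h1 : Measurable (H j) := (Lp.stronglyMeasurable (H j)).measurable
    exact (measurable_from_top (f := fun a : ℤ => if |a| ≤ B j then a else 0)).comp h1
  · intro x j
    have h1 : |h x j| ≤ B j := by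
      by_cases hx : |H j x| ≤ B j <;> simp [h, hx]
    refine h1.trans ?_
    exact_mod_cast Finset.single_le_sum (fun i _ => Nat.zero_le (B i)) (Finset.mem_univ j)
  · rw [← parNorm_eq_lintegral hX z τ H h fun j => ?_]
    · convert hcr using 2
      rw [map_sum] at hb
      rw [sub_eq_iff_eq_add'.1 hb.symm]
      rfl
    · filter_upwards [hB j] with x hx
      simp [h, hx]

end Reduced

/-! ### Finite coverings and finite parameter spaces -/

section FiniteCovering

open UniversalCover

variable {X : Type u} [TopologicalSpace X] {x₀ : X} {Y : Type u} [TopologicalSpace Y]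
  {F : Type w} [Fintype F] [MulAction (FundamentalGroup X x₀) F] {q : C(Y, X)}
  {Φ : F → C(UniversalCover x₀, Y)}

/-- The chain of the covering with coefficient `E f s` in the lift `Φ_f ∘ s~`. -/
def spread (Φ : F → C(UniversalCover x₀, Y)) (k : ℕ) : (F → Chain X k) →ₗ[ℤ] Chain Y k :=
  ∑ f, Finsupp.lmapDomain ℤ ℤ (fun s => (Φ f).comp (simplexLift x₀ s)) ∘ₗ LinearMap.proj f

omit [MulAction (FundamentalGroup X x₀) F] in
theorem spread_apply (k : ℕ) (E : F → Chain X k) :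
    spread Φ k E = ∑ f, Finsupp.mapDomain (fun s => (Φ f).comp (simplexLift x₀ s)) (E f) := by
  simp [spread]

omit [MulAction (FundamentalGroup X x₀) F] in
theorem spread_single (k : ℕ) (a : F → ℤ) (s : SingularSimplex X k) :
    spread Φ k (fun f => a f • Finsupp.single s 1)
      = ∑ f, a f • Finsupp.single ((Φ f).comp (simplexLift x₀ s)) 1 := by
  simp [spread_apply, Finsupp.mapDomain_single]

namespace IsAssociated

variable (h : IsAssociated q Φ) [PathConnectedSpace X] (hX : LocallySimple X)

include h hX

omit [Fintype F] in
theorem comp_simplexLift_injective {k : ℕ} {f f' : F} {s s' : SingularSimplex X k}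
    (e : (Φ f).comp (simplexLift x₀ s) = (Φ f').comp (simplexLift x₀ s')) : f = f' ∧ s = s' := by
  have h1 := congrArg q.comp e
  rw [h.comp_eq, h.comp_eq, proj_comp_simplexLift hX, proj_comp_simplexLift hX] at h1
  subst h1
  exact ⟨h.comp_injective e, rfl⟩

/-- The simplices `Φ f ∘ s~` are pairwise distinct for distinct pairs `(f, s)`, so nothing cancels.
-/
theorem l1Norm_spread {k : ℕ} (E : F → Chain X k) :
    l1Norm (spread Φ k E) = ∑ f, l1Norm (E f) := by
  classical
  let e : F × SingularSimplex X k → SingularSimplex Y k := fun p =>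
    (Φ p.1).comp (simplexLift x₀ p.2)
  have he : Function.Injective e := fun p p' hp => by
    obtain ⟨h1, h2⟩ := h.comp_simplexLift_injective hX hp
    exact Prod.ext h1 h2
  let J : Finset (SingularSimplex X k) := Finset.univ.biUnion fun f => (E f).support
  have hJ : ∀ f, (E f).support ⊆ J := fun f s hs =>
    Finset.mem_biUnion.2 ⟨f, Finset.mem_univ f, hs⟩
  have hval : ∀ f s, spread Φ k E (e (f, s)) = E f s := by
    intro f s
    rw [spread_apply, Finsupp.finsetSum_apply, Finset.sum_eq_single f]
    · exact Finsupp.mapDomain_apply (fun s s' hs => (h.comp_simplexLift_injective hX hs).2) _ _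
    · intro f' _ hf'
      refine Finsupp.mapDomain_of_notMem_range _ _ ?_
      rintro ⟨s', hs'⟩
      exact hf' (h.comp_simplexLift_injective hX hs').1
    · simp
  have hsub : (spread Φ k E).support ⊆ (Finset.univ ×ˢ J).image e := by
    rw [← Finset.coe_subset, ← Finsupp.mem_supported ℤ, spread_apply]
    refine sum_mem fun f _ => (Finsupp.mem_supported ℤ _).2 ?_
    refine (Finset.coe_subset.2 Finsupp.mapDomain_support).trans ?_
    rintro _ hs
    obtain ⟨s, hsf, rfl⟩ := Finset.mem_image.1 (Finset.mem_coe.1 hs)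
    exact Finset.mem_coe.2 (Finset.mem_image.2
      ⟨(f, s), Finset.mem_product.2 ⟨Finset.mem_univ f, hJ f hsf⟩, rfl⟩)
  rw [l1Norm_eq_sum _ hsub, Finset.sum_image fun p _ p' _ hp => he hp, Finset.sum_product]
  refine Finset.sum_congr rfl fun f _ => ?_
  rw [l1Norm_eq_sum _ (hJ f)]
  exact Finset.sum_congr rfl fun s _ => by rw [hval]

/-- Moving `σ` to the chosen lift by its deck transformation shifts the weight `φ`. This is the same
shift that a parameter undergoes in `evalChain`, and it is why coverings and parametrized chains
match. -/
theorem fibreSum_single {k : ℕ} (φ : F → ℤ) (σ : SingularSimplex (UniversalCover x₀) k) :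
    fibreSum Φ φ k (Finsupp.single σ 1)
      = spread Φ k fun f => φ (deck σ • f) • Finsupp.single ((proj x₀).comp σ) 1 := by
  have h1 := h.fibreSum_leftAct φ k (deck σ)
    (Finsupp.single (simplexLift x₀ ((proj x₀).comp σ)) 1)
  rw [leftAct_single, deck_smul hX] at h1
  rw [h1, fibreSum_apply, spread_single]
  simp [pushChain_single]

theorem fibreSum_one {k : ℕ} (z : Chain (UniversalCover x₀) k) :
    fibreSum Φ (fun _ => 1) k z = spread Φ k fun _ => pushChain (proj x₀) k z := by
  rw [← h.transfer_proj hX]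
  generalize pushChain (proj x₀) k z = c
  suffices transfer Φ k = spread Φ k ∘ₗ LinearMap.pi fun _ => LinearMap.id from
    LinearMap.congr_fun this c
  refine chain_hom_ext fun s => ?_
  rw [transfer_single, LinearMap.comp_apply]
  have := spread_single (Φ := Φ) k (fun _ => 1) s
  simp only [one_smul] at this
  exact this.symm

/-- The norm of the chain in a finite covering which corresponds to a parametrized chain. -/
theorem sum_l1Norm_evalChain {k N : ℕ} (z : Chain (UniversalCover x₀) k)
    (τ : Fin N → SingularSimplex (UniversalCover x₀) (k + 1)) (w : F → Fin N → ℤ) :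
    ∑ f, l1Norm (evalChain z τ fun γ => w (γ • f))
      = l1Norm (fibreSum Φ (fun _ => 1) k z + boundary Y k
        (∑ j, fibreSum Φ (fun f => w f j) (k + 1) (Finsupp.single (τ j) 1))) := by
  rw [← h.l1Norm_spread hX]
  congr 1
  rw [h.fibreSum_one hX, map_sum]
  have h1 : (fun f => evalChain z τ fun γ => w (γ • f)) = (fun _ => pushChain (proj x₀) k z)
      + ∑ j, ∑ i : Fin (k + 2), ((-1 : ℤ) ^ (i : ℕ)) • (fun f =>
        w (deck (face i (τ j)) • f) j • Finsupp.single ((proj x₀).comp (face i (τ j))) (1 : ℤ)) := by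
    funext f
    simp [evalChain]
  rw [h1, map_add, map_sum]
  congr 1
  refine Finset.sum_congr rfl fun j _ => ?_
  rw [boundary_fibreSum, boundary_single, map_sum, map_sum]
  refine Finset.sum_congr rfl fun i _ => ?_
  rw [map_smul, map_smul, h.fibreSum_single hX]

end IsAssociated

theorem IsFundamentalCycle.add_boundary {n : ℕ} {o : Orientation X n} {c : Chain X n}
    (hc : IsFundamentalCycle o c) (b : Chain X (n + 1)) :
    IsFundamentalCycle o (c + boundary X n b) := by
  refine ⟨add_mem hc.1 (boundary_mem_relCycles _ _ _), fun x => (hc.2 x).of_sub_mem ?_⟩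
  rw [sub_add_cancel_left, ← map_neg]
  exact mem_relBoundaries.2 ⟨-b, 0, zero_mem _, by simp⟩

variable [T1Space X] [PathConnectedSpace X] (hX : LocallySimple X) {m : ℕ}
  (o : Orientation X (m + 1))

include hX

/-- On the connected covering `X~ ×_Γ F` with `card F` sheets, the sum is the norm of the transfer
of a fundamental cycle plus a boundary, hence of a fundamental cycle. -/
theorem stableIntegralVolume_le {F : Type u} [Fintype F] [Nonempty F]
    [MulAction (FundamentalGroup X x₀) F] [MulAction.IsPretransitive (FundamentalGroup X x₀) F]
    {N : ℕ} {z : Chain (UniversalCover x₀) (m + 1)}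
    (hz : IsFundamentalCycle o (pushChain (proj x₀) (m + 1) z))
    (τ : Fin N → SingularSimplex (UniversalCover x₀) (m + 2)) (w : F → Fin N → ℤ) :
    stableIntegralVolume o
      ≤ (∑ f, l1Norm (evalChain z τ fun γ => w (γ • f))) / Fintype.card F := by
  let _ : TopologicalSpace F := ⊥
  have : DiscreteTopology F := ⟨rfl⟩
  have : ContinuousConstSMul (FundamentalGroup X x₀) F := ⟨fun _ => continuous_of_discreteTopology⟩
  have h := AssociatedSpace.isAssociated x₀ F hX
  have := AssociatedSpace.connectedSpace x₀ F
  have hcard : ∀ x : X, Nat.card (AssociatedSpace.covering x₀ F ⁻¹' {x}) = Fintype.card F := by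
    intro x
    obtain ⟨a, rfl⟩ := proj_surjective (x₀ := x₀) x
    rw [← Nat.card_eq_fintype_card]
    refine (Nat.card_congr (Equiv.ofBijective (fun f : F =>
      (⟨AssociatedSpace.incl x₀ F f a, h.proj_eq f a⟩ :
        AssociatedSpace.covering x₀ F ⁻¹' {proj x₀ a})) ⟨?_, ?_⟩)).symm
    · intro f f' e
      exact h.injective a (congrArg Subtype.val e)
    · rintro ⟨y, hy⟩
      obtain ⟨f, hf⟩ := h.surjective a y hy
      exact ⟨f, Subtype.ext hf⟩
  -- Points in one fibre are separated by a sheet on which the covering is injective, points in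
  -- different fibres by their images.
  have hT1 : T1Space (AssociatedSpace x₀ F) := by
    refine ⟨fun y => ?_⟩
    have h1 : ({y} : Set (AssociatedSpace x₀ F)) =
        (AssociatedSpace.covering x₀ F ⁻¹' {AssociatedSpace.covering x₀ F y}) ∩
          {y' | AssociatedSpace.covering x₀ F y' = AssociatedSpace.covering x₀ F y → y' = y} := by
      ext y'
      constructor
      · rintro rfl
        exact ⟨rfl, fun _ => rfl⟩
      · rintro ⟨h1, h2⟩
        exact h2 h1
    rw [← isOpen_compl_iff]
    refine isOpen_iff_mem_nhds.2 fun y' hy' => ?_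
    by_cases e : AssociatedSpace.covering x₀ F y' = AssociatedSpace.covering x₀ F y
    · obtain ⟨e', hy'e, he⟩ := h.covering.isLocalHomeomorph y'
      refine Filter.mem_of_superset (e'.open_source.mem_nhds hy'e) fun v hv hvy => hy' ?_
      rw [Set.mem_singleton_iff] at hvy
      subst hvy
      refine e'.injOn hy'e hv ?_
      rw [← he]
      exact e
    · refine Filter.mem_of_superset ((isClosed_singleton.isOpen_compl.preimage
        (AssociatedSpace.covering x₀ F).continuous).mem_nhds e) ?_
      rintro v hv rfl
      exact hv rfl
  obtain ⟨o', ho'⟩ := h.exists_isPullback hX o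
  refine iInf_le_of_le (AssociatedSpace x₀ F) (iInf_le_of_le inferInstance (iInf_le_of_le
    inferInstance (iInf_le_of_le (AssociatedSpace.covering x₀ F) (iInf_le_of_le h.covering
    (iInf_le_of_le (Fintype.card F) (iInf_le_of_le Fintype.card_pos (iInf_le_of_le hcard
    (iInf_le_of_le o' (iInf_le_of_le ho' ?_)))))))))
  refine ENNReal.div_le_div_right ?_ _
  rw [h.sum_l1Norm_evalChain hX]
  refine iInf₂_le _ ?_
  rw [← h.transfer_proj hX]
  exact (h.isFundamentalCycle_transfer hX ho' hz).add_boundary _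

-- Uniqueness of the fundamental class upstairs writes `c` as the transfer of a fundamental cycle
-- plus `∂b`. Each simplex of `b` is some `Φ f` applied to a chosen lift, so `b` is itself given by
-- weights on `F`.
omit [T1Space X] in
theorem IsAssociated.exists_sum_evalChain_eq [T2Space X] [CompactSpace X]
    (hE : LocallyEuclidean X (m + 1)) (h : IsAssociated q Φ) [T2Space Y] [CompactSpace Y]
    {o' : Orientation Y (m + 1)} (ho' : IsPullback o' q o) {c : Chain Y (m + 1)}
    (hc : IsFundamentalCycle o' c) :
    ∃ (N : ℕ) (z : Chain (UniversalCover x₀) (m + 1))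
      (τ : Fin N → SingularSimplex (UniversalCover x₀) (m + 2)) (w : F → Fin N → ℤ),
      IsFundamentalCycle o (pushChain (proj x₀) (m + 1) z) ∧
      ∑ f, l1Norm (evalChain z τ fun γ => w (γ • f)) = l1Norm c := by
  classical
  obtain ⟨c₀, hc₀⟩ := exists_isFundamentalCycle hE o
  obtain ⟨z, rfl⟩ := exists_pushChain_proj_eq (x₀ := x₀) hX c₀
  obtain ⟨b, hb⟩ := hc.exists_eq_add_boundary
    (hE.of_isLocalHomeomorph h.covering.isLocalHomeomorph)
    (h.isFundamentalCycle_transfer hX ho' hc₀)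
  -- The index of the sheet containing a given simplex. The weight attached to that simplex is its
  -- coefficient in `b`, concentrated at this index.
  choose φ hφ using fun σ : SingularSimplex Y (m + 2) => h.exists_comp_simplexLift hX σ
  let e := b.support.equivFin.symm
  have h1 : ∀ j, fibreSum Φ (fun f => if f = φ (e j) then b (e j) else 0) (m + 2)
      (Finsupp.single (simplexLift x₀ (q.comp (e j))) 1) =
      Finsupp.single (e j : SingularSimplex Y (m + 2)) (b (e j)) := by
    intro j
    rw [fibreSum_apply, Finset.sum_eq_single (φ (e j))]
    · rw [if_pos rfl, pushChain_single, hφ]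
      simp
    · intro f _ hf
      rw [if_neg hf, zero_smul]
    · simp
  have h2 : ∑ j, fibreSum Φ (fun f => if f = φ (e j) then b (e j) else 0) (m + 2)
      (Finsupp.single (simplexLift x₀ (q.comp (e j))) 1) = b := by
    rw [Finset.sum_congr rfl fun j _ => h1 j,
      e.sum_comp fun σ : b.support => Finsupp.single (σ : SingularSimplex Y (m + 2)) (b σ),
      Finset.sum_coe_sort b.support fun σ => Finsupp.single σ (b σ)]
    exact Finsupp.sum_single b
  refine ⟨b.support.card, z, fun j => simplexLift x₀ (q.comp (e j)),
    fun f j => if f = φ (e j) then b (e j) else 0, hc₀, ?_⟩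
  refine (h.sum_l1Norm_evalChain hX z (fun j => simplexLift x₀ (q.comp (e j)))
    fun f j => if f = φ (e j) then b (e j) else 0).trans ?_
  rw [← h.transfer_proj hX, hb, h2]

omit [T1Space X] in
theorem exists_sum_evalChain_eq [T2Space X] [CompactSpace X] (hE : LocallyEuclidean X (m + 1))
    (x₀ : X) {Y : Type u} [TopologicalSpace Y] [ConnectedSpace Y] {q : C(Y, X)}
    (hq : IsCoveringMap q) {d : ℕ} (hd : 0 < d) (hcard : ∀ x : X, Nat.card (q ⁻¹' {x}) = d)
    {o' : Orientation Y (m + 1)} (ho' : IsPullback o' q o) {c : Chain Y (m + 1)}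
    (hc : IsFundamentalCycle o' c) :
    ∃ (F : Type u) (_ : Fintype F) (_ : Nonempty F) (_ : MulAction (FundamentalGroup X x₀) F)
      (_ : MulAction.IsPretransitive (FundamentalGroup X x₀) F) (N : ℕ)
      (z : Chain (UniversalCover x₀) (m + 1))
      (τ : Fin N → SingularSimplex (UniversalCover x₀) (m + 2)) (w : F → Fin N → ℤ),
      Fintype.card F = d ∧ IsFundamentalCycle o (pushChain (proj x₀) (m + 1) z) ∧
      ∑ f, l1Norm (evalChain z τ fun γ => w (γ • f)) = l1Norm c := by
  have hfin : ∀ x, Finite (q ⁻¹' {x}) := fun x =>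
    Nat.finite_of_card_ne_zero (by rw [hcard]; exact hd.ne')
  have := hfin x₀
  let _ : Fintype (q ⁻¹' {x₀}) := Fintype.ofFinite _
  have hF : Fintype.card (q ⁻¹' {x₀}) = d := by rw [← Nat.card_eq_fintype_card, hcard]
  have : Nonempty (q ⁻¹' {x₀}) := Fintype.card_pos_iff.1 (by rw [hF]; exact hd)
  have := t2Space_of_isCoveringMap hq
  have := compactSpace_of_isCoveringMap hq hfin
  let _ := hq.fundamentalGroupMulAction x₀
  have h := isAssociated_monodromyMap (x₀ := x₀) hq
  obtain ⟨N, z, τ, w, h1, h2⟩ := IsAssociated.exists_sum_evalChain_eq hX o hE h ho' hc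
  exact ⟨q ⁻¹' {x₀}, inferInstance, inferInstance, hq.fundamentalGroupMulAction x₀,
    h.isPretransitive hX, N, z, τ, w, hF, h1, h2⟩

end FiniteCovering

/-! ### Patterns of finite-valued functions on measured group actions -/

section Patterns

variable {Γ : Type u} [Group Γ] {A : Type} [Fintype A] [Nonempty A] [MeasurableSpace A]
  [MeasurableSingletonClass A]

/-- The points at which the translates of `h` by the elements of `D` take the values `p`. -/
def patternSet {S : Type v} [MulAction Γ S] (D : Finset Γ) (h : S → A) (p : D → A) : Set S :=
  {x | ∀ δ : D, h ((δ : Γ) • x) = p δ}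

/-- Some function on `Γ` with prescribed restriction to `D`. -/
def extendPattern (D : Finset Γ) (p : D → A) (γ : Γ) : A :=
  open Classical in if hγ : γ ∈ D then p ⟨γ, hγ⟩ else Classical.arbitrary A

omit [Nonempty A] [Fintype A] in
theorem measurableSet_patternSet {S : Type v} [MeasurableSpace S] [MulAction Γ S]
    [MeasurableConstSMul Γ S] (D : Finset Γ) {h : S → A} (hh : Measurable h) (p : D → A) :
    MeasurableSet (patternSet D h p) := by
  have : patternSet D h p = ⋂ δ : D, (fun x => h ((δ : Γ) • x)) ⁻¹' {p δ} := by
    ext x; simp [patternSet]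
  rw [this]
  exact MeasurableSet.iInter fun δ =>
    (hh.comp (measurable_const_smul (δ : Γ))) (measurableSet_singleton _)

-- Only the `D`-pattern of `h` at `x` matters, and there are finitely many patterns; the integral is
-- the sum of the values weighted by their measures.
open scoped Classical in
theorem lintegral_eq_sum_patternSet {S : Type v} [MeasurableSpace S] [MulAction Γ S]
    [MeasurableConstSMul Γ S] (μ : Measure S) {D : Finset Γ} {Φ : (Γ → A) → ℝ≥0∞}
    (hΦ : ∀ w w' : Γ → A, (∀ γ ∈ D, w γ = w' γ) → Φ w = Φ w') {h : S → A} (hh : Measurable h) :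
    ∫⁻ x, Φ (fun γ => h (γ • x)) ∂μ
      = ∑ p : D → A, Φ (extendPattern D p) * μ (patternSet D h p) := by
  classical
  let pat : S → D → A := fun x δ => h ((δ : Γ) • x)
  have hpat : Measurable pat :=
    measurable_pi_iff.2 fun δ => hh.comp (measurable_const_smul (δ : Γ))
  have h1 : ∀ x, Φ (fun γ => h (γ • x)) = Φ (extendPattern D (pat x)) := fun x =>
    hΦ _ _ fun γ hγ => by simp [extendPattern, hγ, pat]
  simp_rw [h1]
  rw [← lintegral_map (f := fun p => Φ (extendPattern D p)) (measurable_of_finite _) hpat,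
    lintegral_fintype]
  refine Finset.sum_congr rfl fun p _ => ?_
  rw [Measure.map_apply hpat (measurableSet_singleton p)]
  congr 2
  ext x
  simp [patternSet, pat, funext_iff]

open scoped Classical in
theorem lintegral_le_of_patternSet_le {S : Type v} [MeasurableSpace S] [MulAction Γ S]
    [MeasurableConstSMul Γ S] (μ : Measure S) {T : Type w} [MeasurableSpace T] [MulAction Γ T]
    [MeasurableConstSMul Γ T] (ν : Measure T) {D : Finset Γ} {Φ : (Γ → A) → ℝ≥0∞}
    (hΦ : ∀ w w' : Γ → A, (∀ γ ∈ D, w γ = w' γ) → Φ w = Φ w') {h : S → A} (hh : Measurable h)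
    {h' : T → A} (hh' : Measurable h') {η : ℝ≥0∞}
    (hle : ∀ p : D → A, ν (patternSet D h' p) ≤ μ (patternSet D h p) + η) :
    ∫⁻ x, Φ (fun γ => h' (γ • x)) ∂ν
      ≤ ∫⁻ x, Φ (fun γ => h (γ • x)) ∂μ + (∑ p : D → A, Φ (extendPattern D p)) * η := by
  rw [lintegral_eq_sum_patternSet μ hΦ hh, lintegral_eq_sum_patternSet ν hΦ hh',
    Finset.sum_mul, ← Finset.sum_add_distrib]
  refine Finset.sum_le_sum fun p _ => ?_
  rw [← mul_add]
  gcongr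
  exact hle p

/-- If every pattern error can be made small, so can the error of the integral of a local
functional. -/
theorem exists_lintegral_le_add {S : Type v} [MeasurableSpace S] [MulAction Γ S]
    [MeasurableConstSMul Γ S] (μ : Measure S) {T : Type w} [MeasurableSpace T] [MulAction Γ T]
    [MeasurableConstSMul Γ T] (ν : Measure T) {D : Finset Γ} {Φ : (Γ → A) → ℝ≥0∞}
    (hΦ : ∀ w w' : Γ → A, (∀ γ ∈ D, w γ = w' γ) → Φ w = Φ w') (hfin : ∀ w, Φ w ≠ ∞)
    {h : S → A} (hh : Measurable h) {P : (T → A) → Prop}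
    (hP : ∀ η : ℝ, 0 < η → ∃ h' : T → A, Measurable h' ∧ P h' ∧
      ∀ p : D → A, ν (patternSet D h' p) ≤ μ (patternSet D h p) + ENNReal.ofReal η)
    {ε : ℝ≥0∞} (hε : 0 < ε) :
    ∃ h' : T → A, Measurable h' ∧ P h' ∧
      ∫⁻ x, Φ (fun γ => h' (γ • x)) ∂ν ≤ ∫⁻ x, Φ (fun γ => h (γ • x)) ∂μ + ε := by
  classical
  set C : ℝ≥0∞ := ∑ p : D → A, Φ (extendPattern D p) with hC
  -- This constant depends on `Φ` and `D` but not on the approximating function, so a small enough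
  -- pattern error `η` makes `C * η` at most `ε`.
  have hCfin : C ≠ ∞ := ENNReal.sum_ne_top.2 fun p _ => hfin _
  have hlim : Filter.Tendsto (fun η : ℝ => C * ENNReal.ofReal η) (nhdsWithin 0 (Set.Ioi 0))
      (nhds 0) := by
    have : Filter.Tendsto (fun η : ℝ => C * ENNReal.ofReal η) (nhds 0)
        (nhds (C * ENNReal.ofReal 0)) :=
      ENNReal.Tendsto.const_mul (ENNReal.continuous_ofReal.tendsto 0) (Or.inr hCfin)
    simp only [ENNReal.ofReal_zero, mul_zero] at this
    exact this.mono_left nhdsWithin_le_nhds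
  obtain ⟨η, hη, hη0⟩ := ((hlim.eventually_le_const hε).and self_mem_nhdsWithin).exists
  obtain ⟨h', hm, hp, hle⟩ := hP η hη0
  exact ⟨h', hm, hp, (lintegral_le_of_patternSet_le μ ν hΦ hh hm hle).trans (by gcongr)⟩

/-- Deleting all pairwise overlaps, a set of measure at most `card V ^ 2 * η`, makes the sets
disjoint. The loss occurs once for each of the `card V` sets. -/
theorem measure_ge_of_almost_disjoint {T : Type w} [MeasurableSpace T] (ν : Measure T)
    [IsProbabilityMeasure ν] {V : Type v} [Fintype V] {B : V → Set T}
    (hB : ∀ p, MeasurableSet (B p)) {η : ℝ} (hη : 0 ≤ η)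
    (hd : ∀ p q, p ≠ q → ν.real (B p ∩ B q) ≤ η) :
    ∑ p, ν.real (B p) ≤ ν.real (⋃ p, B p) + (Fintype.card V : ℝ) ^ 3 * η := by
  classical
  set E : Set T := ⋃ p, ⋃ q, if p ≠ q then B p ∩ B q else ∅ with hE
  have hEm : MeasurableSet E := MeasurableSet.iUnion fun p => MeasurableSet.iUnion fun q => by
    split_ifs
    · exact (hB p).inter (hB q)
    · exact MeasurableSet.empty
  have hEle : ν.real E ≤ (Fintype.card V : ℝ) ^ 2 * η := by
    calc ν.real E ≤ ∑ p, ν.real (⋃ q, if p ≠ q then B p ∩ B q else ∅) :=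
          measureReal_iUnion_fintype_le _
      _ ≤ ∑ _p : V, ∑ _q : V, η := by
          refine Finset.sum_le_sum fun p _ => (measureReal_iUnion_fintype_le _).trans
            (Finset.sum_le_sum fun q _ => ?_)
          split_ifs with h
          · exact hd p q h
          · simpa using hη
      _ = _ := by simp; ring
  have h1 : ∑ p, ν.real (B p \ E) ≤ ν.real (⋃ p, B p) := by
    rw [← measureReal_iUnion_fintype]
    · exact measureReal_mono (Set.iUnion_mono fun p => Set.sdiff_subset)
    · intro p q hpq
      refine Set.disjoint_left.2 fun x hx hx' => hx.2 ?_
      refine Set.mem_iUnion.2 ⟨p, Set.mem_iUnion.2 ⟨q, ?_⟩⟩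
      rw [if_pos hpq]
      exact ⟨hx.1, hx'.1⟩
    · exact fun p => (hB p).diff hEm
  have h2 : ∀ p, ν.real (B p) ≤ ν.real (B p \ E) + (Fintype.card V : ℝ) ^ 2 * η := fun p => by
    have := measureReal_union_le (μ := ν) (B p \ E) E
    have h3 : ν.real (B p) ≤ ν.real (B p \ E ∪ E) := measureReal_mono (by
      rw [Set.sdiff_union_self]; exact Set.subset_union_left)
    linarith
  calc ∑ p, ν.real (B p) ≤ ∑ p, (ν.real (B p \ E) + (Fintype.card V : ℝ) ^ 2 * η) :=
        Finset.sum_le_sum fun p _ => h2 p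
    _ = ∑ p, ν.real (B p \ E) + (Fintype.card V : ℝ) ^ 3 * η := by
        rw [Finset.sum_add_distrib]; simp; ring
    _ ≤ _ := by linarith

end Patterns

/-! ### Transport of pattern distributions along weak containment. -/

section WeakContainment

variable {Γ : Type u} [Group Γ] {A : Type} [Fintype A] [Nonempty A] [MeasurableSpace A]
  [MeasurableSingletonClass A]

theorem measureReal_image_smul_inter {T : Type w} [MeasurableSpace T] [MulAction Γ T]
    [MeasurableConstSMul Γ T] (ν : Measure T) [SMulInvariantMeasure Γ T ν] (g : Γ) (B B' : Set T) :
    ν.real (((g • ·) '' B) ∩ B') = ν.real (B ∩ (g • ·) ⁻¹' B') := by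
  have : ((g • ·) '' B) ∩ B' = (g • ·) '' (B ∩ (g • ·) ⁻¹' B') := by
    rw [Set.image_inter_preimage]
  rw [this, measureReal_def, measureReal_def]
  congr 1
  exact measure_smul (μ := ν) g (B ∩ (g • ·) ⁻¹' B')

/-- Weak containment yields functions on the bigger space with almost the same pattern
distribution. -/
theorem WeaklyContained.exists_patternSet_le {S : Type v} [MeasurableSpace S] [MulAction Γ S]
    [MeasurableConstSMul Γ S] {μ : Measure S} [IsProbabilityMeasure μ]
    {T : Type w} [MeasurableSpace T] [MulAction Γ T]
    [MeasurableConstSMul Γ T] {ν : Measure T} [IsProbabilityMeasure ν] [SMulInvariantMeasure Γ T ν]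
    (hw : WeaklyContained Γ μ ν) {D : Finset Γ} (hD : (1 : Γ) ∈ D) {h : S → A}
    (hh : Measurable h) {η : ℝ} (hη : 0 < η) :
    ∃ h' : T → A, Measurable h' ∧
      ∀ p : D → A, ν (patternSet D h' p) ≤ μ (patternSet D h p) + ENNReal.ofReal η := by
  classical
  set k : ℝ := ((Fintype.card (D → A) : ℕ) : ℝ) with hk
  set d : ℝ := ((Fintype.card D : ℕ) : ℝ) with hd
  have hk0 : 0 ≤ k := Nat.cast_nonneg _
  have hd0 : 0 ≤ d := Nat.cast_nonneg _
  have hpos : 0 < 1 + d * (k ^ 3 + k + k ^ 2) := by positivity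
  -- The tolerance is chosen so that the final error adds up to `η`: one `η'` from comparing `B p`
  -- with its pattern set, and `d * (k ^ 3 + k + k ^ 2) * η'` from the exceptional set `N`.
  set η' : ℝ := η / (1 + d * (k ^ 3 + k + k ^ 2)) with hη'
  have hη'0 : 0 < η' := div_pos hη hpos
  let e := Fintype.equivFin (D → A)
  obtain ⟨B', hB'm, hB'⟩ := hw η' hη'0 D _ (fun j => patternSet D h (e.symm j))
    fun j => measurableSet_patternSet D hh _
  obtain ⟨B, hBm, hB⟩ : ∃ B : (D → A) → Set T, (∀ p, MeasurableSet (B p)) ∧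
      ∀ δ ∈ D, ∀ p q, |μ.real (((δ • ·) '' patternSet D h p) ∩ patternSet D h q)
        - ν.real (((δ • ·) '' B p) ∩ B q)| < η' :=
    ⟨fun p => B' (e p), fun p => hB'm _, fun δ hδ p q => by
      simpa using hB' δ hδ (e p) (e q)⟩
  let i1 : D := ⟨1, hD⟩
  -- If `x` has pattern `p`, then the pattern of `δ • x` takes the value `p δ` at `1`. Pairs
  -- violating this never occur in `S`, hence rarely in `T`.
  have hbad : ∀ (δ : D) (p q : D → A), q i1 ≠ p δ →
      ν.real (B p ∩ ((δ : Γ) • ·) ⁻¹' B q) ≤ η' := by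
    intro δ p q hpq
    have h1 := hB δ δ.2 p q
    have h2 : (((δ : Γ) • ·) '' patternSet D h p) ∩ patternSet D h q = ∅ := by
      refine Set.eq_empty_of_forall_notMem ?_
      rintro _ ⟨⟨x, hx, rfl⟩, hx'⟩
      refine hpq ?_
      rw [← hx δ, ← hx' i1]
      simp [i1]
    rw [h2, measureReal_empty, zero_sub, abs_neg, measureReal_image_smul_inter] at h1
    exact (le_abs_self _).trans h1.le
  have hone : ∀ p q : D → A, |μ.real (patternSet D h p ∩ patternSet D h q)
      - ν.real (B p ∩ B q)| < η' := fun p q => by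
    simpa using hB 1 hD p q
  have hdisj : ∀ p q : D → A, p ≠ q → patternSet D h p ∩ patternSet D h q = ∅ := by
    intro p q hpq
    refine Set.eq_empty_of_forall_notMem fun x hx => hpq (funext fun δ => ?_)
    rw [← hx.1 δ, ← hx.2 δ]
  have hBd : ∀ p q, p ≠ q → ν.real (B p ∩ B q) ≤ η' := fun p q hpq => by
    have h1 := hone p q
    rw [hdisj p q hpq, measureReal_empty, zero_sub, abs_neg] at h1
    exact (le_abs_self _).trans h1.le
  have hself : ∀ p, |μ.real (patternSet D h p) - ν.real (B p)| < η' := fun p => by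
    simpa using hone p p
  have hsum : ∑ p, μ.real (patternSet D h p) = 1 := by
    rw [← measureReal_iUnion_fintype (fun p q hpq => Set.disjoint_iff_inter_eq_empty.2
      (hdisj p q hpq)) fun p => measurableSet_patternSet D hh p]
    have : ⋃ p, patternSet D h p = Set.univ :=
      Set.eq_univ_of_forall fun x => Set.mem_iUnion.2 ⟨fun δ => h ((δ : Γ) • x), fun δ => rfl⟩
    rw [this, probReal_univ]
  set U : Set T := ⋃ p, B p with hU
  have hUm : MeasurableSet U := MeasurableSet.iUnion hBm
  -- The pattern sets partition `S`, so the measures of the `B p` add up to at least `1 - k * η'`;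
  -- overlaps account for at most `k ^ 3 * η'`.
  have hUc : ν.real Uᶜ ≤ (k ^ 3 + k) * η' := by
    have h1 := measure_ge_of_almost_disjoint ν hBm hη'0.le hBd
    have h2 : ∑ p, μ.real (patternSet D h p) ≤ ∑ p, (ν.real (B p) + η') :=
      Finset.sum_le_sum fun p _ => by have := (abs_lt.1 (hself p)).2; linarith
    rw [hsum, Finset.sum_add_distrib] at h2
    simp only [Finset.sum_const, Finset.card_univ, nsmul_eq_mul] at h2
    rw [measureReal_compl hUm, probReal_univ]
    rw [← hk] at h1 h2
    linarith
  -- The exceptional points: some translate by `δ ∈ D` lies in no `B q`, or membership of the point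
  -- and of its translate in some `B p` and `B q` is incompatible.
  set N : Set T := ⋃ δ : D, (((δ : Γ) • ·) ⁻¹' Uᶜ ∪
    ⋃ p, ⋃ q, if q i1 ≠ p δ then B p ∩ ((δ : Γ) • ·) ⁻¹' B q else ∅) with hN
  have hNle : ν.real N ≤ d * (k ^ 3 + k + k ^ 2) * η' := by
    calc ν.real N ≤ ∑ δ : D, ν.real (((δ : Γ) • ·) ⁻¹' Uᶜ ∪
          ⋃ p, ⋃ q, if q i1 ≠ p δ then B p ∩ ((δ : Γ) • ·) ⁻¹' B q else ∅) :=
          measureReal_iUnion_fintype_le _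
      _ ≤ ∑ _δ : D, ((k ^ 3 + k) * η' + k ^ 2 * η') := by
          refine Finset.sum_le_sum fun δ _ => (measureReal_union_le _ _).trans (add_le_add ?_ ?_)
          · rw [measureReal_def, measure_preimage_smul, ← measureReal_def]
            exact hUc
          · calc _ ≤ ∑ p, ν.real (⋃ q, if q i1 ≠ p δ then B p ∩ ((δ : Γ) • ·) ⁻¹' B q else ∅) :=
                  measureReal_iUnion_fintype_le _
              _ ≤ ∑ _p : D → A, ∑ _q : D → A, η' := by
                  refine Finset.sum_le_sum fun p _ => (measureReal_iUnion_fintype_le _).trans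
                    (Finset.sum_le_sum fun q _ => ?_)
                  split_ifs with hc
                  · exact hbad δ p q hc
                  · simpa using hη'0.le
              _ = k ^ 2 * η' := by
                  simp only [Finset.sum_const, Finset.card_univ, nsmul_eq_mul]; rw [← hk]; ring
      _ = _ := by simp only [Finset.sum_const, Finset.card_univ, nsmul_eq_mul]; rw [← hd]; ring
  let code : T → ((D → A) → Prop) := fun t p => t ∈ B p
  have hcode : Measurable code := measurable_pi_iff.2 fun p => measurableSet_setOfPred.1 (hBm p)
  -- The new function reads off the value at `1` of one chosen pattern whose set contains the point,
  -- with an arbitrary value where there is none.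
  let dec : ((D → A) → Prop) → A := fun c =>
    if hc : ∃ p, c p then hc.choose i1 else Classical.arbitrary A
  refine ⟨dec ∘ code, (measurable_of_finite dec).comp hcode, fun p => ?_⟩
  -- Off `N` a point lies in some `B p'`, and compatibility shows that the value read at each
  -- translate by `δ` is `p' δ`. Hence `p'` is the actual pattern `p`.
  have hsub : patternSet D (dec ∘ code) p ⊆ B p ∪ N := by
    intro t ht
    by_cases htN : t ∈ N
    · exact Or.inr htN
    left
    have hmem : ∀ δ : D, ∃ q, (δ : Γ) • t ∈ B q := by
      intro δ
      by_contra hcon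
      refine htN (Set.mem_iUnion.2 ⟨δ, Or.inl ?_⟩)
      intro hx
      exact hcon (Set.mem_iUnion.1 hx)
    obtain ⟨p', hp'⟩ := hmem i1
    rw [show ((i1 : D) : Γ) = 1 from rfl, one_smul] at hp'
    suffices p = p' by rwa [this]
    funext δ
    rw [← ht δ]
    have hex : ∃ q, code ((δ : Γ) • t) q := hmem δ
    have h1 : (dec ∘ code) ((δ : Γ) • t) = hex.choose i1 := dif_pos hex
    rw [h1]
    by_contra hne
    refine htN (Set.mem_iUnion.2 ⟨δ, Or.inr (Set.mem_iUnion.2 ⟨p', Set.mem_iUnion.2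
      ⟨hex.choose, ?_⟩⟩)⟩)
    rw [if_pos hne]
    exact ⟨hp', hex.choose_spec⟩
  have hreal : ν.real (patternSet D (dec ∘ code) p) ≤ μ.real (patternSet D h p) + η := by
    have h1 := (measureReal_mono hsub (measure_ne_top ν _)).trans (measureReal_union_le (B p) N)
    have h2 := (abs_lt.1 (hself p)).1
    have h3 : η' * (1 + d * (k ^ 3 + k + k ^ 2)) = η := div_mul_cancel₀ _ hpos.ne'
    nlinarith
  rw [← ENNReal.ofReal_toReal (measure_ne_top ν _), ← ENNReal.ofReal_toReal (measure_ne_top μ _),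
    ← ENNReal.ofReal_add ENNReal.toReal_nonneg hη.le]
  exact ENNReal.ofReal_le_ofReal hreal

/-- Integrals of local functionals can be approximated from above along weak containment. -/
theorem WeaklyContained.exists_lintegral_le {S : Type v} [MeasurableSpace S] [MulAction Γ S]
    [MeasurableConstSMul Γ S] {μ : Measure S} [IsProbabilityMeasure μ]
    {T : Type w} [MeasurableSpace T] [MulAction Γ T]
    [MeasurableConstSMul Γ T] {ν : Measure T} [IsProbabilityMeasure ν] [SMulInvariantMeasure Γ T ν]
    (hw : WeaklyContained Γ μ ν) {D : Finset Γ} {Φ : (Γ → A) → ℝ≥0∞}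
    (hΦ : ∀ w w' : Γ → A, (∀ γ ∈ D, w γ = w' γ) → Φ w = Φ w') (hfin : ∀ w, Φ w ≠ ∞)
    {h : S → A} (hh : Measurable h) {ε : ℝ≥0∞} (hε : 0 < ε) :
    ∃ h' : T → A, Measurable h' ∧
      ∫⁻ x, Φ (fun γ => h' (γ • x)) ∂ν ≤ ∫⁻ x, Φ (fun γ => h (γ • x)) ∂μ + ε := by
  classical
  have hΦ' : ∀ w w' : Γ → A, (∀ γ ∈ insert 1 D, w γ = w' γ) → Φ w = Φ w' := fun w w' hw =>
    hΦ w w' fun γ hγ => hw γ (Finset.mem_insert_of_mem hγ)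
  obtain ⟨h', hm, -, hle⟩ := exists_lintegral_le_add μ ν hΦ' hfin hh (P := fun _ => True)
    (fun η hη => by
      obtain ⟨h', hm, hle⟩ := hw.exists_patternSet_le (Finset.mem_insert_self 1 D) hh hη
      exact ⟨h', hm, trivial, hle⟩) hε
  exact ⟨h', hm, hle⟩

end WeakContainment

/-! ### Finite quotients of the profinite completion -/

section FiniteQuotients

variable {Γ : Type u} [Group Γ]

/-- An equivariant measurable map to a finite transitive `Γ`-set pushes every invariant probability
measure forward to the uniform one. -/
theorem lintegral_equivariant_finite {T : Type w} [MeasurableSpace T] [MulAction Γ T]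
    [MeasurableConstSMul Γ T] (ν : Measure T) [IsProbabilityMeasure ν] [SMulInvariantMeasure Γ T ν]
    {F : Type v} [Fintype F] [MulAction Γ F] [MulAction.IsPretransitive Γ F]
    {π : T → F} (hπ : ∀ f, MeasurableSet (π ⁻¹' {f})) (he : ∀ (γ : Γ) t, π (γ • t) = γ • π t)
    (G : F → ℝ≥0∞) : ∫⁻ t, G (π t) ∂ν = (∑ f, G f) / Fintype.card F := by
  let _ : MeasurableSpace F := ⊤
  have hm : Measurable π := measurable_to_countable' hπ
  have hconst : ∀ f f' : F, ν (π ⁻¹' {f}) = ν (π ⁻¹' {f'}) := by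
    intro f f'
    obtain ⟨γ, rfl⟩ := MulAction.exists_smul_eq Γ f f'
    rw [← measure_preimage_smul ν γ (π ⁻¹' {γ • f})]
    congr 1
    ext t
    simp [he]
  have hsum : ∑ f, ν (π ⁻¹' {f}) = 1 := by
    have hd : Pairwise (Function.onFun Disjoint fun f => π ⁻¹' {f}) := fun f f' hff' =>
      Set.disjoint_left.2 fun t h1 h2 => hff' (h1.symm.trans h2)
    have h1 := measure_iUnion (μ := ν) hd hπ
    rw [tsum_fintype] at h1
    rw [← h1, ← measure_univ (μ := ν)]
    congr 1
    ext t; simp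
  have hval : ∀ f, ν (π ⁻¹' {f}) = (Fintype.card F : ℝ≥0∞)⁻¹ := by
    intro f
    rw [Finset.sum_congr rfl fun f' _ => hconst f' f, Finset.sum_const, Finset.card_univ,
      nsmul_eq_mul] at hsum
    exact ENNReal.eq_inv_of_mul_eq_one_left (by rw [mul_comm]; exact hsum)
  rw [← lintegral_map (f := G) (measurable_of_finite _) hm, lintegral_fintype, div_eq_mul_inv,
    Finset.sum_mul]
  refine Finset.sum_congr rfl fun f _ => ?_
  rw [Measure.map_apply hm (measurableSet_singleton f), hval]

namespace ProfiniteCompletion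

instance : TotallyDisconnectedSpace (ProfiniteCompletion Γ) :=
  inferInstanceAs (TotallyDisconnectedSpace
    (ProfiniteGrp.ProfiniteCompletion.completion (GrpCat.of Γ)))

theorem denseRange_ofGroup : DenseRange (ofGroup Γ) :=
  ProfiniteGrp.ProfiniteCompletion.denseRange (GrpCat.of Γ)

/-- Every finite `Γ`-set with a base point is the equivariant continuous image of the profinite
completion. -/
theorem exists_equivariant_map {F : Type u} [Finite F] [MulAction Γ F] (f₀ : F) :
    ∃ π : ProfiniteCompletion Γ → F, (∀ f, IsOpen (π ⁻¹' {f})) ∧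
      ∀ (γ : Γ) x, π (γ • x) = γ • π x := by
  -- The permutation representation has values in a finite group, so it extends to the profinite
  -- completion; `π` is the orbit map of `f₀` under the extension.
  let P : ProfiniteGrp.{u} := ProfiniteGrp.ofFiniteGrp (FiniteGrp.of (Equiv.Perm F))
  let φ : GrpCat.of Γ ⟶ GrpCat.of P := GrpCat.ofHom (MulAction.toPermHom Γ F)
  let L : ProfiniteCompletion Γ →* Equiv.Perm F :=
    (ProfiniteGrp.ProfiniteCompletion.lift φ).hom.toMonoidHom
  have hLc : ∀ s : Set (Equiv.Perm F), IsOpen (L ⁻¹' s) := fun s =>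
    (show @IsOpen P _ s from trivial).preimage
      (ProfiniteGrp.ProfiniteCompletion.lift φ).hom.continuous_toFun
  have hL : ∀ γ : Γ, L (ofGroup Γ γ) = MulAction.toPerm γ := fun γ =>
    CategoryTheory.ConcreteCategory.congr_hom (ProfiniteGrp.ProfiniteCompletion.lift_eta φ) γ
  refine ⟨fun x => L x f₀, fun f => hLc {σ | σ f₀ = f}, fun γ x => ?_⟩
  change L (ofGroup Γ γ * x) f₀ = γ • L x f₀
  rw [map_mul, hL]
  rfl

/-- Functions with finitely many values on the profinite completion are almost everywhere close to
locally constant ones. -/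
theorem exists_isLocallyConstant {A : Type} [Fintype A] [Nonempty A] [MeasurableSpace A]
    [MeasurableSingletonClass A] {h : ProfiniteCompletion Γ → A} (hh : Measurable h) {η : ℝ≥0∞}
    (hη : 0 < η) : ∃ h' : ProfiniteCompletion Γ → A, IsLocallyConstant h' ∧
      haar Γ {x | h x ≠ h' x} ≤ η := by
  classical
  have _ : (haar Γ).Regular := Measure.regular_haarMeasure
  have hη' : η / Fintype.card A ≠ 0 := (ENNReal.div_pos hη.ne' (ENNReal.natCast_ne_top _)).ne'
  have hK : ∀ a, ∃ K ⊆ h ⁻¹' {a}, IsCompact K ∧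
      haar Γ (h ⁻¹' {a} \ K) < η / Fintype.card A := fun a =>
    (hh (measurableSet_singleton a)).exists_isCompact_sdiff_lt (measure_ne_top _ _) hη'
  choose K hKs hKc hKm using hK
  -- The fibres of `h` are approximated from inside by disjoint compact sets. These are separated by
  -- a clopen partition, which defines `h'`; it differs from `h` only outside the compact sets.
  obtain ⟨C, hC, hKC, -, hcov, hdis⟩ := exists_clopen_partition_of_clopen_cover
    (Z := K) (D := fun _ => Set.univ) (fun a => (hKc a).isClosed) (fun _ => isClopen_univ)
    (fun _ => Set.subset_univ _) (fun a _ b _ hab => Set.disjoint_left.2 fun x hx hx' =>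
      hab ((hKs a hx).symm.trans (hKs b hx')))
  have hex : ∀ x, ∃ a, x ∈ C a := fun x =>
    Set.mem_iUnion.1 (hcov (Set.mem_iUnion.2 ⟨Classical.arbitrary A, Set.mem_univ x⟩))
  choose h' hh' using hex
  have huniq : ∀ {x a}, x ∈ C a → h' x = a := fun {x a} hx => by
    by_contra hne
    exact Set.disjoint_left.1 (hdis (Set.mem_univ _) (Set.mem_univ _) hne) (hh' x) hx
  refine ⟨h', ?_, ?_⟩
  · refine (IsLocallyConstant.iff_exists_open _).2 fun x => ⟨C (h' x), (hC _).isOpen, hh' x,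
      fun y hy => huniq hy⟩
  · have hsub : {x | h x ≠ h' x} ⊆ ⋃ a, h ⁻¹' {a} \ K a := by
      intro x hx
      refine Set.mem_iUnion.2 ⟨h x, rfl, fun hxK => hx (huniq (hKC _ hxK)).symm⟩
    calc haar Γ {x | h x ≠ h' x} ≤ ∑ a, haar Γ (h ⁻¹' {a} \ K a) :=
          (measure_mono hsub).trans (measure_iUnion_fintype_le _ _)
      _ ≤ ∑ _a : A, η / Fintype.card A := Finset.sum_le_sum fun a _ => (hKm a).le
      _ = η := by
        rw [Finset.sum_const, Finset.card_univ, nsmul_eq_mul]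
        exact ENNReal.mul_div_cancel (by simp) (ENNReal.natCast_ne_top _)

/-- Locally constant functions on the profinite completion factor through a finite transitive
`Γ`-set. -/
theorem exists_factor {A : Type} {h : ProfiniteCompletion Γ → A} (hh : IsLocallyConstant h) :
    ∃ (F : Type u) (_ : Fintype F) (_ : Nonempty F) (_ : MulAction Γ F)
      (_ : MulAction.IsPretransitive Γ F) (π : ProfiniteCompletion Γ → F) (w : F → A),
      (∀ f, IsOpen (π ⁻¹' {f})) ∧ (∀ (γ : Γ) x, π (γ • x) = γ • π x) ∧ ∀ x, h x = w (π x) := by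
  -- The stabilizer of `h` under right translations. It commutes with the left action of `Γ`, so the
  -- quotient by it is a `Γ`-set through which `h` factors.
  let K : Subgroup (ProfiniteCompletion Γ) :=
    { carrier := {g | ∀ x, h (x * g) = h x}
      one_mem' := fun x => by rw [mul_one]
      mul_mem' := fun {a b} ha hb x => by rw [← mul_assoc, hb, ha]
      inv_mem' := fun {a} ha x => by
        have := ha (x * a⁻¹)
        rw [inv_mul_cancel_right] at this
        exact this.symm }
  -- Compactness makes local constancy uniform: one neighbourhood of `1` leaves `h` unchanged at all
  -- points. Hence `K` is open and has finite index.
  have hKo : IsOpen (K : Set (ProfiniteCompletion Γ)) := by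
    refine Subgroup.isOpen_of_mem_nhds K (g := 1) ?_
    have h1 : ∀ x ∈ (Set.univ : Set (ProfiniteCompletion Γ)),
        ∀ᶠ z : ProfiniteCompletion Γ × ProfiniteCompletion Γ in nhds (1, x),
          h (z.2 * z.1) = h z.2 := by
      intro x _
      have hc1 : IsLocallyConstant fun z : ProfiniteCompletion Γ × ProfiniteCompletion Γ =>
          h (z.2 * z.1) := hh.comp_continuous (continuous_snd.mul continuous_fst)
      have hc2 : IsLocallyConstant fun z : ProfiniteCompletion Γ × ProfiniteCompletion Γ =>
          h z.2 := hh.comp_continuous continuous_snd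
      filter_upwards [hc1.eventually_eq (1, x), hc2.eventually_eq (1, x)] with z hz1 hz2
      rw [hz1, hz2, mul_one]
    filter_upwards [isCompact_univ.eventually_forall_of_forall_eventually
      (P := fun g x => h (x * g) = h x) h1] with g hg
    exact fun x => hg x (Set.mem_univ x)
  have _ : Finite (ProfiniteCompletion Γ ⧸ K) := Subgroup.quotient_finite_of_isOpen K hKo
  let act : MulAction Γ (ProfiniteCompletion Γ ⧸ K) := MulAction.compHom _ (ofGroup Γ)
  have hopen : ∀ f : ProfiniteCompletion Γ ⧸ K,
      IsOpen ((QuotientGroup.mk : _ → ProfiniteCompletion Γ ⧸ K) ⁻¹' {f}) := fun f => by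
    have := QuotientGroup.discreteTopology hKo
    exact (isOpen_discrete {f}).preimage QuotientGroup.continuous_mk
  refine ⟨ProfiniteCompletion Γ ⧸ K, Fintype.ofFinite _, ⟨QuotientGroup.mk 1⟩, act, ⟨?_⟩,
    QuotientGroup.mk, Quotient.lift h ?_, hopen, fun γ x => rfl, fun x => rfl⟩
  · intro f f'
    obtain ⟨x, rfl⟩ := QuotientGroup.mk_surjective f
    -- Transitivity: the elements moving one coset to another form a nonempty open set, which meets
    -- the dense image of `Γ`.
    have hU : IsOpen {g : ProfiniteCompletion Γ |
        (QuotientGroup.mk (g * x) : ProfiniteCompletion Γ ⧸ K) = f'} :=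
      (hopen f').preimage (continuous_mul_const x)
    obtain ⟨y, rfl⟩ := QuotientGroup.mk_surjective f'
    obtain ⟨γ, hγ⟩ := denseRange_ofGroup.exists_mem_open hU ⟨y * x⁻¹, by simp⟩
    exact ⟨γ, hγ⟩
  · intro x y hxy
    have h1 : x⁻¹ * y ∈ K := QuotientGroup.leftRel_apply.1 hxy
    have h2 : h (x * (x⁻¹ * y)) = h x := h1 x
    rw [mul_inv_cancel_left] at h2
    exact h2.symm

end ProfiniteCompletion

/-- A lower bound for the averages of a local functional over all finite transitive `Γ`-sets is a
lower bound for its integrals over the profinite completion. -/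
theorem le_lintegral_haar {A : Type} [Fintype A] [Nonempty A] [MeasurableSpace A]
    [MeasurableSingletonClass A] {D : Finset Γ} {Φ : (Γ → A) → ℝ≥0∞}
    (hΦ : ∀ w w' : Γ → A, (∀ γ ∈ D, w γ = w' γ) → Φ w = Φ w') (hfin : ∀ w, Φ w ≠ ∞) {r : ℝ≥0∞}
    (hr : ∀ (F : Type u) [Fintype F] [Nonempty F] [MulAction Γ F] [MulAction.IsPretransitive Γ F]
      (w : F → A), r ≤ (∑ f, Φ fun γ => w (γ • f)) / Fintype.card F)
    {h : ProfiniteCompletion Γ → A} (hh : Measurable h) :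
    r ≤ ∫⁻ x, Φ (fun γ => h (γ • x)) ∂ProfiniteCompletion.haar Γ := by
  refine ENNReal.le_of_forall_pos_le_add fun ε hε _ => ?_
  have key : ∀ η : ℝ, 0 < η → ∃ h' : ProfiniteCompletion Γ → A, Measurable h' ∧
      IsLocallyConstant h' ∧ ∀ p : D → A, ProfiniteCompletion.haar Γ (patternSet D h' p) ≤
        ProfiniteCompletion.haar Γ (patternSet D h p) + ENNReal.ofReal η := by
    intro η hη
    -- The pattern can change only where one of the `D.card` translates meets the exceptional set.
    -- For empty `D` the quotient is infinite, but then the union over `D` is empty as well.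
    have hpos : 0 < ENNReal.ofReal η / D.card :=
      ENNReal.div_pos (ENNReal.ofReal_pos.2 hη).ne' (ENNReal.natCast_ne_top _)
    obtain ⟨h', hlc, hle⟩ := ProfiniteCompletion.exists_isLocallyConstant hh hpos
    refine ⟨h', measurable_to_countable' fun a => (hlc.isOpen_fiber a).measurableSet, hlc,
      fun p => ?_⟩
    have hsub : patternSet D h' p ⊆ patternSet D h p ∪
        ⋃ δ ∈ D, (δ • ·) ⁻¹' {x | h x ≠ h' x} := by
      intro x hx
      by_cases hex : ∃ δ ∈ D, h (δ • x) ≠ h' (δ • x)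
      · obtain ⟨δ, hδ, hne⟩ := hex
        exact Or.inr (Set.mem_iUnion₂.2 ⟨δ, hδ, hne⟩)
      · push Not at hex
        exact Or.inl fun δ => (hex δ δ.2).trans (hx δ)
    refine (measure_mono hsub).trans ((measure_union_le _ _).trans ?_)
    gcongr
    refine (measure_biUnion_finset_le _ _).trans ?_
    calc ∑ δ ∈ D, ProfiniteCompletion.haar Γ ((δ • ·) ⁻¹' {x | h x ≠ h' x})
        ≤ ∑ _δ ∈ D, ENNReal.ofReal η / D.card := by
          refine Finset.sum_le_sum fun δ _ => ?_
          rw [measure_preimage_smul]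
          exact hle
      _ ≤ ENNReal.ofReal η := by
          rw [Finset.sum_const, nsmul_eq_mul]
          exact ENNReal.mul_div_le
  obtain ⟨h', -, hlc, hle⟩ := exists_lintegral_le_add (ProfiniteCompletion.haar Γ)
    (ProfiniteCompletion.haar Γ) hΦ hfin hh (P := IsLocallyConstant) key
    (ENNReal.coe_pos.2 hε)
  refine le_trans ?_ hle
  obtain ⟨F, _, _, _, _, π, w, hπ, he, hw⟩ := ProfiniteCompletion.exists_factor hlc
  simp_rw [hw, he]
  rw [lintegral_equivariant_finite _ (fun f => (hπ f).measurableSet) he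
    fun f => Φ fun γ => w (γ • f)]
  exact hr F w
end FiniteQuotients

/-! ### Ergodic measures on compact spaces -/

/-- For `c` the minimal integral: if an average of two measures attains the minimum, then so does
each of them. -/
theorem le_of_convex_combination_le {t s a b c : ℝ} (ht : 0 < t) (hs : 0 ≤ s) (hts : t + s = 1)
    (hb : c ≤ b) (h : t * a + s * b ≤ c) : a ≤ c := by
  have h1 : s * c ≤ s * b := mul_le_mul_of_nonneg_left hb hs
  have h2 : t * c + s * c = c := by rw [← add_mul, hts, one_mul]
  exact le_of_mul_le_mul_left (by linarith) ht

section ExtremeMeasures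

variable {Γ : Type u} [Group Γ] {Ω : Type v} [TopologicalSpace Ω] [CompactSpace Ω] [T2Space Ω]
  [MeasurableSpace Ω] [BorelSpace Ω] [HasOuterApproxClosed Ω] [MulAction Γ Ω]
  [ContinuousConstSMul Γ Ω]

/-- The functional on continuous functions given by a probability measure. -/
def integralFunctional (m : ProbabilityMeasure Ω) (f : C(Ω, ℝ)) : ℝ :=
  ∫ x, f x ∂(m : Measure Ω)

omit [T2Space Ω] [HasOuterApproxClosed Ω] in
theorem continuous_integralFunctional :
    Continuous (integralFunctional : ProbabilityMeasure Ω → C(Ω, ℝ) → ℝ) :=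
  continuous_pi fun f => ProbabilityMeasure.continuous_integral_continuousMap f

omit [CompactSpace Ω] [T2Space Ω] in
theorem integralFunctional_injective :
    Function.Injective (integralFunctional : ProbabilityMeasure Ω → C(Ω, ℝ) → ℝ) := by
  intro m m' h
  have h1 : (m : Measure Ω) = m' :=
    ext_of_forall_integral_eq_of_IsFiniteMeasure fun f => congrFun h f.toContinuousMap
  exact Subtype.ext h1

variable (Γ Ω) in
/-- The probability measures invariant under `Γ`. -/
def invariantMeasures : Set (ProbabilityMeasure Ω) :=
  {m | ∀ γ : Γ, m.map (continuous_const_smul γ).measurable.aemeasurable = m}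

omit [CompactSpace Ω] [T2Space Ω] in
theorem isClosed_invariantMeasures : IsClosed (invariantMeasures Γ Ω) := by
  have : invariantMeasures Γ Ω = ⋂ γ : Γ, {m : ProbabilityMeasure Ω |
      m.map (continuous_const_smul γ).measurable.aemeasurable = m} := by
    ext m; simp [invariantMeasures]
  rw [this]
  exact isClosed_iInter fun γ =>
    isClosed_eq (ProbabilityMeasure.continuous_map (continuous_const_smul γ)) continuous_id

omit [CompactSpace Ω] [T2Space Ω] [HasOuterApproxClosed Ω] in
theorem mem_invariantMeasures {m : ProbabilityMeasure Ω} :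
    m ∈ invariantMeasures Γ Ω ↔ SMulInvariantMeasure Γ Ω (m : Measure Ω) := by
  constructor
  · intro h
    refine ⟨fun γ s hs => ?_⟩
    have h1 := congrArg (fun m' : ProbabilityMeasure Ω => (m' : Measure Ω) s) (h γ)
    simp only [ProbabilityMeasure.toMeasure_map] at h1
    rwa [Measure.map_apply (continuous_const_smul γ).measurable hs] at h1
  · intro h γ
    refine Subtype.ext ?_
    exact (measurePreserving_smul γ (m : Measure Ω)).map_eq

omit [TopologicalSpace Ω] [CompactSpace Ω] [T2Space Ω] [BorelSpace Ω] [HasOuterApproxClosed Ω]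
  [ContinuousConstSMul Γ Ω] in
theorem smulInvariantMeasure_cond [MeasurableConstSMul Γ Ω] (μ : Measure Ω)
    [SMulInvariantMeasure Γ Ω μ] {s : Set Ω} (hs : MeasurableSet s)
    (h : ∀ γ : Γ, (γ • ·) ⁻¹' s =ᵐ[μ] s) :
    SMulInvariantMeasure Γ Ω (ProbabilityTheory.cond μ s) := by
  refine ⟨fun γ t ht => ?_⟩
  rw [ProbabilityTheory.cond_apply hs, ProbabilityTheory.cond_apply hs]
  congr 1
  rw [← measure_preimage_smul μ γ (s ∩ t), Set.preimage_inter]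
  exact measure_congr ((h γ).symm.inter (ae_eq_refl _))

omit [T2Space Ω] [HasOuterApproxClosed Ω] in
theorem integral_cond_add_integral_cond_compl (μ : Measure Ω)
    [IsProbabilityMeasure μ] {s : Set Ω} (hs : MeasurableSet s) (h0 : μ s ≠ 0) (h1 : μ sᶜ ≠ 0)
    (f : C(Ω, ℝ)) :
    μ.real s * ∫ x, f x ∂ProbabilityTheory.cond μ s
      + μ.real sᶜ * ∫ x, f x ∂ProbabilityTheory.cond μ sᶜ = ∫ x, f x ∂μ := by
  have hf : Integrable f μ := f.continuous.integrable_of_hasCompactSupport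
    (HasCompactSupport.of_compactSpace f)
  have key : ∀ t, μ t ≠ 0 → μ.real t * ∫ x, f x ∂ProbabilityTheory.cond μ t
      = ∫ x in t, f x ∂μ := by
    intro t ht
    rw [ProbabilityTheory.cond, integral_smul_measure, ENNReal.toReal_inv, smul_eq_mul,
      ← mul_assoc, ← measureReal_def, mul_inv_cancel₀, one_mul]
    exact (ENNReal.toReal_pos ht (measure_ne_top μ t)).ne'
  rw [key s h0, key sᶜ h1, integral_add_compl hs hf]

/-- Integrals of continuous functions against invariant probability measures are bounded below by
integrals against ergodic ones. -/
theorem exists_ergodicSMul_integral_le (m₀ : ProbabilityMeasure Ω)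
    [SMulInvariantMeasure Γ Ω (m₀ : Measure Ω)] (φ : C(Ω, ℝ)) :
    ∃ m : ProbabilityMeasure Ω, ErgodicSMul Γ Ω (m : Measure Ω) ∧
      ∫ x, φ x ∂(m : Measure Ω) ≤ ∫ x, φ x ∂(m₀ : Measure Ω) := by
  have hm₀ : m₀ ∈ invariantMeasures Γ Ω := mem_invariantMeasures.2 inferInstance
  -- Measures are viewed as functionals in a product of lines, which provides the ambient locally
  -- convex space for extreme points.
  set K : Set (C(Ω, ℝ) → ℝ) := integralFunctional '' invariantMeasures Γ Ω with hK
  have hKc : IsCompact K :=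
    isClosed_invariantMeasures.isCompact.image continuous_integralFunctional
  obtain ⟨v₀, hv₀, hmin⟩ := hKc.exists_isMinOn ⟨_, Set.mem_image_of_mem _ hm₀⟩
    (continuous_apply φ).continuousOn
  have hmin' : ∀ v ∈ K, v₀ φ ≤ v φ := fun v hv => hmin hv
  -- The set of minimizers of the integral of `φ`. It is compact and nonempty and so has an extreme
  -- point, by Krein–Milman.
  set K' : Set (C(Ω, ℝ) → ℝ) := K ∩ {v | v φ ≤ v₀ φ} with hK'
  have hK'c : IsCompact K' :=
    hKc.inter_right (isClosed_le (continuous_apply φ) continuous_const)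
  obtain ⟨v, hv⟩ := hK'c.extremePoints_nonempty ⟨v₀, hv₀, le_refl (v₀ φ)⟩
  obtain ⟨⟨⟨m, hm, rfl⟩, hmφ⟩, hext⟩ := mem_extremePoints.1 hv
  have hmφ' : integralFunctional m φ ≤ v₀ φ := hmφ
  have hinv : SMulInvariantMeasure Γ Ω (m : Measure Ω) := mem_invariantMeasures.1 hm
  refine ⟨m, ⟨fun {s} hs hsinv => ?_⟩,
    hmφ'.trans (hmin' _ (Set.mem_image_of_mem _ hm₀))⟩
  rw [Filter.eventuallyConst_set']
  by_contra hcon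
  push Not at hcon
  have h0 : (m : Measure Ω) s ≠ 0 := fun h => hcon.1 (ae_eq_empty.2 h)
  have h1 : (m : Measure Ω) sᶜ ≠ 0 := fun h => hcon.2 (ae_eq_univ.2 h)
  have hp1 : IsProbabilityMeasure (ProbabilityTheory.cond (m : Measure Ω) s) :=
    ProbabilityTheory.cond_isProbabilityMeasure h0
  have hp2 : IsProbabilityMeasure (ProbabilityTheory.cond (m : Measure Ω) sᶜ) :=
    ProbabilityTheory.cond_isProbabilityMeasure h1
  let m1 : ProbabilityMeasure Ω := ⟨_, hp1⟩
  let m2 : ProbabilityMeasure Ω := ⟨_, hp2⟩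
  have hm1 : m1 ∈ invariantMeasures Γ Ω :=
    mem_invariantMeasures.2 (smulInvariantMeasure_cond _ hs hsinv)
  have hm2 : m2 ∈ invariantMeasures Γ Ω :=
    mem_invariantMeasures.2 (smulInvariantMeasure_cond _ hs.compl fun γ => by
      rw [Set.preimage_compl]
      exact (hsinv γ).compl)
  -- A nontrivial invariant set `s` would make `m` a convex combination of its conditional measures
  -- on `s` and `sᶜ`. Both are invariant and hence minimizers; extremality then forces the first to
  -- equal `m`, although it vanishes on `sᶜ`.
  have hcomb : ∀ f, (m : Measure Ω).real s * integralFunctional m1 f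
      + (m : Measure Ω).real sᶜ * integralFunctional m2 f = integralFunctional m f := fun f =>
    integral_cond_add_integral_cond_compl (m : Measure Ω) hs h0 h1 f
  have ht0 : 0 < (m : Measure Ω).real s := ENNReal.toReal_pos h0 (measure_ne_top _ _)
  have ht1 : 0 < (m : Measure Ω).real sᶜ := ENNReal.toReal_pos h1 (measure_ne_top _ _)
  have hsum : (m : Measure Ω).real s + (m : Measure Ω).real sᶜ = 1 := by
    rw [measureReal_add_measureReal_compl hs, probReal_univ]
  have hb1 := hmin' _ (Set.mem_image_of_mem integralFunctional hm1)
  have hb2 := hmin' _ (Set.mem_image_of_mem integralFunctional hm2)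
  have hcφ := hcomb φ
  have hk1 : integralFunctional m1 ∈ K' := by
    refine ⟨Set.mem_image_of_mem _ hm1, ?_⟩
    change integralFunctional m1 φ ≤ v₀ φ
    exact le_of_convex_combination_le ht0 ht1.le hsum hb2 (hcφ.trans_le hmφ')
  have hk2 : integralFunctional m2 ∈ K' := by
    refine ⟨Set.mem_image_of_mem _ hm2, ?_⟩
    change integralFunctional m2 φ ≤ v₀ φ
    exact le_of_convex_combination_le ht1 ht0.le ((add_comm _ _).trans hsum) hb1
      ((add_comm _ _).trans_le (hcφ.trans_le hmφ'))
  have heq := (hext _ hk1 _ hk2 ⟨_, _, ht0, ht1, hsum, funext hcomb⟩).1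
  have hmm : m1 = m := integralFunctional_injective heq
  have hval : (m1 : Measure Ω) sᶜ = 0 := by
    change ProbabilityTheory.cond (m : Measure Ω) s sᶜ = 0
    rw [ProbabilityTheory.cond_apply hs]
    simp
  rw [hmm] at hval
  exact h1 hval

end ExtremeMeasures

/-! ### The shift -/

/-- Functions on a countably infinite group, coded by functions on the natural numbers. -/
@[nolint unusedArguments]
def ShiftSpace {Γ : Type u} (_e : Γ ≃ ℕ) (A : Type) : Type := ℕ → A

namespace ShiftSpace

variable {Γ : Type u} (e : Γ ≃ ℕ) (A : Type)

instance [TopologicalSpace A] : TopologicalSpace (ShiftSpace e A) :=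
  inferInstanceAs (TopologicalSpace (ℕ → A))

instance [TopologicalSpace A] [CompactSpace A] : CompactSpace (ShiftSpace e A) :=
  inferInstanceAs (CompactSpace (ℕ → A))

instance [TopologicalSpace A] [T2Space A] : T2Space (ShiftSpace e A) :=
  inferInstanceAs (T2Space (ℕ → A))

instance [TopologicalSpace A] [DiscreteTopology A] :
    TopologicalSpace.PseudoMetrizableSpace (ShiftSpace e A) :=
  inferInstanceAs (TopologicalSpace.PseudoMetrizableSpace (ℕ → A))

instance [MeasurableSpace A] : MeasurableSpace (ShiftSpace e A) :=
  inferInstanceAs (MeasurableSpace (ℕ → A))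

instance [TopologicalSpace A] [SecondCountableTopology A] [MeasurableSpace A] [BorelSpace A] :
    BorelSpace (ShiftSpace e A) :=
  inferInstanceAs (BorelSpace (ℕ → A))

instance [MeasurableSpace A] [StandardBorelSpace A] : StandardBorelSpace (ShiftSpace e A) :=
  inferInstanceAs (StandardBorelSpace (ℕ → A))

variable {e A}

/-- The element `γ` sends `w` to `γ' ↦ w (γ' * γ)`. With this right translation the map `x ↦ (γ' ↦ h
(γ' • x))` is equivariant for left actions. -/
instance [Group Γ] : MulAction Γ (ShiftSpace e A) where
  smul γ w := fun n => w (e (e.symm n * γ))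
  one_smul w := by
    funext n
    change w (e (e.symm n * 1)) = w n
    rw [mul_one, e.apply_symm_apply]
  mul_smul γ γ' w := by
    funext n
    change w (e (e.symm n * (γ * γ'))) = w (e (e.symm (e (e.symm n * γ)) * γ'))
    rw [e.symm_apply_apply, mul_assoc]

instance [Group Γ] [TopologicalSpace A] : ContinuousConstSMul Γ (ShiftSpace e A) where
  continuous_const_smul γ := by
    refine continuous_pi (A := fun _ : ℕ => A) fun n => ?_
    exact continuous_apply (A := fun _ : ℕ => A) (e (e.symm n * γ))

instance [Group Γ] [MeasurableSpace A] : MeasurableConstSMul Γ (ShiftSpace e A) where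
  measurable_const_smul γ := by
    refine measurable_pi_iff.2 fun n => ?_
    exact measurable_pi_apply (X := fun _ : ℕ => A) (e (e.symm n * γ))

end ShiftSpace

/-- For groups with property EMD*, lower bounds for the averages of a local functional over finite
transitive `Γ`-sets are lower bounds for its integrals over all measure preserving actions. -/
theorem HasEMDStar.le_lintegral {Γ : Type u} [Group Γ] (hE : HasEMDStar Γ) {A : Type} [Fintype A]
    [Nonempty A] [MeasurableSpace A] [MeasurableSingletonClass A] {D : Finset Γ}
    {Φ : (Γ → A) → ℝ≥0∞} (hΦ : ∀ w w' : Γ → A, (∀ γ ∈ D, w γ = w' γ) → Φ w = Φ w')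
    (hfin : ∀ w, Φ w ≠ ∞) {r : ℝ≥0∞}
    (hr : ∀ (F : Type u) [Fintype F] [Nonempty F] [MulAction Γ F] [MulAction.IsPretransitive Γ F]
      (w : F → A), r ≤ (∑ f, Φ fun γ => w (γ • f)) / Fintype.card F)
    {S : Type v} [MeasurableSpace S] [MulAction Γ S] [MeasurableConstSMul Γ S] (μ : Measure S)
    [IsProbabilityMeasure μ] [SMulInvariantMeasure Γ S μ] {h : S → A} (hh : Measurable h) :
    r ≤ ∫⁻ x, Φ (fun γ => h (γ • x)) ∂μ := by
  obtain ⟨hinf, hcount, hemd⟩ := hE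
  obtain ⟨hden⟩ := nonempty_denumerable Γ
  -- EMD* speaks about standard Borel spaces in `Type`. Indexing the shift by `ℕ` instead of `Γ`
  -- puts it there whatever the universe of `Γ`.
  let e : Γ ≃ ℕ := Denumerable.eqv Γ
  let _ : TopologicalSpace A := ⊥
  have _ : DiscreteTopology A := ⟨rfl⟩
  have _ : DiscreteMeasurableSpace A := MeasurableSingletonClass.toDiscreteMeasurableSpace
  have _ : BorelSpace A := DiscreteMeasurableSpace.toBorelSpace
  let ev : ShiftSpace e A → A := fun w => w (e 1)
  have hev : ∀ (w : ShiftSpace e A) (γ : Γ), ev (γ • w) = w (e γ) := fun w γ => by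
    change w (e (e.symm (e 1) * γ)) = _
    rw [e.symm_apply_apply, one_mul]
  have hevm : Measurable ev := measurable_pi_apply (X := fun _ : ℕ => A) (e 1)
  let code : S → ShiftSpace e A := fun x n => h (e.symm n • x)
  have hcode : Measurable code := measurable_pi_iff.2 fun n => hh.comp (measurable_const_smul _)
  have hequiv : ∀ (γ : Γ) x, code (γ • x) = γ • code x := by
    intro γ x
    funext n
    change h (e.symm n • γ • x) = h (e.symm (e (e.symm n * γ)) • x)
    rw [e.symm_apply_apply, mul_smul]
  let m₀ : ProbabilityMeasure (ShiftSpace e A) :=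
    ⟨μ.map code, Measure.isProbabilityMeasure_map hcode.aemeasurable⟩
  have _ : SMulInvariantMeasure Γ (ShiftSpace e A) (m₀ : Measure (ShiftSpace e A)) := by
    refine ⟨fun γ s hs => ?_⟩
    change μ.map code _ = μ.map code _
    rw [Measure.map_apply hcode hs, Measure.map_apply hcode
      ((measurable_const_smul γ) hs), ← measure_preimage_smul μ γ (code ⁻¹' s)]
    congr 1
    ext x
    simp [hequiv]
  -- The functional depends on finitely many coordinates with values in a discrete space.
  have hcont : Continuous fun w : ShiftSpace e A => (Φ fun γ => ev (γ • w)).toReal := by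
    have h1 : ∀ w : ShiftSpace e A, (Φ fun γ => ev (γ • w)).toReal
        = (fun p : D → A => (Φ (extendPattern D p)).toReal) (fun δ => w (e δ)) := fun w => by
      refine congrArg ENNReal.toReal (hΦ _ _ fun γ hγ => ?_)
      simp [extendPattern, hγ, hev]
    simp_rw [h1]
    exact (continuous_of_discreteTopology
      (f := fun p : D → A => (Φ (extendPattern D p)).toReal)).comp
      (continuous_pi fun δ => continuous_apply (A := fun _ : ℕ => A) (e δ))
  let φ : C(ShiftSpace e A, ℝ) := ⟨_, hcont⟩
  have hlint : ∀ m : ProbabilityMeasure (ShiftSpace e A),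
      ∫⁻ w, Φ (fun γ => ev (γ • w)) ∂(m : Measure (ShiftSpace e A))
        = ENNReal.ofReal (∫ w, φ w ∂(m : Measure (ShiftSpace e A))) := by
    intro m
    rw [ofReal_integral_eq_lintegral_ofReal (φ.continuous.integrable_of_hasCompactSupport
      (HasCompactSupport.of_compactSpace φ)) (Filter.Eventually.of_forall fun w =>
        ENNReal.toReal_nonneg)]
    exact lintegral_congr fun w => (ENNReal.ofReal_toReal (hfin _)).symm
  -- The image measure on the shift need not be ergodic, but an ergodic measure with no larger
  -- integral suffices for a lower bound.
  obtain ⟨m, hm, hmφ⟩ := exists_ergodicSMul_integral_le (Γ := Γ) m₀ φ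
  have hle : ∫⁻ w, Φ (fun γ => ev (γ • w)) ∂(m : Measure (ShiftSpace e A))
      ≤ ∫⁻ x, Φ (fun γ => h (γ • x)) ∂μ := by
    calc _ ≤ ∫⁻ w, Φ (fun γ => ev (γ • w)) ∂(m₀ : Measure (ShiftSpace e A)) := by
          rw [hlint, hlint]
          exact ENNReal.ofReal_le_ofReal hmφ
      _ = ∫⁻ x, Φ (fun γ => ev (γ • code x)) ∂μ := by
          refine lintegral_map ?_ hcode
          have h2 : (fun w : ShiftSpace e A => Φ fun γ => ev (γ • w))
              = fun w => ENNReal.ofReal (φ w) :=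
            funext fun w => (ENNReal.ofReal_toReal (hfin _)).symm
          rw [h2]
          exact ENNReal.measurable_ofReal.comp φ.continuous.measurable
      _ = _ := by
          refine lintegral_congr fun x => congrArg Φ (funext fun γ => ?_)
          rw [hev]
          change h (e.symm (e γ) • x) = _
          rw [e.symm_apply_apply]
  refine le_trans ?_ hle
  refine ENNReal.le_of_forall_pos_le_add fun ε hε _ => ?_
  obtain ⟨h', hm', hle'⟩ := (hemd (ShiftSpace e A) (m : Measure (ShiftSpace e A))).exists_lintegral_le
    hΦ hfin hevm (ENNReal.coe_pos.2 hε)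
  exact (le_lintegral_haar hΦ hfin hr hm').trans hle'

/-! ### Parametrized volumes and coverings -/

section Comparison

open UniversalCover

variable {X : Type u} [TopologicalSpace X] {x₀ : X}

theorem l1Norm_ne_top {k : ℕ} (c : Chain X k) : l1Norm c ≠ ∞ :=
  ENNReal.sum_ne_top.2 fun _ _ => enorm_ne_top

variable [PathConnectedSpace X]

/-- A measure preserving action with an equivariant map to a finite transitive set has at most the
parametrized volume given by the covering associated with that set. -/
theorem parVolume_le_of_equivariant (hX : LocallySimple X) {n : ℕ} (o : Orientation X n) {F : Type u} [Fintype F]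
    [MulAction (FundamentalGroup X x₀) F] [MulAction.IsPretransitive (FundamentalGroup X x₀) F]
    {N : ℕ} {z : Chain (UniversalCover x₀) n}
    (hz : IsFundamentalCycle o (pushChain (proj x₀) n z))
    (τ : Fin N → SingularSimplex (UniversalCover x₀) (n + 1)) (w : F → Fin N → ℤ)
    {S : Type v} [MeasurableSpace S] [MulAction (FundamentalGroup X x₀) S]
    [MeasurableConstSMul (FundamentalGroup X x₀) S] (μ : Measure S) [IsProbabilityMeasure μ]
    [SMulInvariantMeasure (FundamentalGroup X x₀) S μ] {π : S → F}
    (hπ : ∀ f, MeasurableSet (π ⁻¹' {f}))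
    (he : ∀ (γ : FundamentalGroup X x₀) s, π (γ • s) = γ • π s) :
    parVolume o x₀ μ ≤ (∑ f, l1Norm (evalChain z τ fun γ => w (γ • f))) / Fintype.card F := by
  let _ : MeasurableSpace F := ⊤
  have hm : Measurable fun s => w (π s) :=
    (measurable_of_finite w).comp (measurable_to_countable' hπ)
  have hB : ∀ s j, |(w (π s) j : ℝ)| ≤ ∑ f, ∑ j, |(w f j : ℝ)| := fun s j =>
    (Finset.single_le_sum (f := fun j => |(w (π s) j : ℝ)|) (fun _ _ => abs_nonneg _)
      (Finset.mem_univ j)).trans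
    (Finset.single_le_sum (f := fun f => ∑ j, |(w f j : ℝ)|)
      (fun _ _ => Finset.sum_nonneg fun _ _ => abs_nonneg _) (Finset.mem_univ (π s)))
  refine (parVolume_le_lintegral hX o hz τ hm hB).trans_eq ?_
  simp_rw [he]
  exact lintegral_equivariant_finite μ hπ he fun f => l1Norm (evalChain z τ fun γ => w (γ • f))

omit [PathConnectedSpace X] in
theorem evalChain_local {k N : ℕ} (z : Chain (UniversalCover x₀) k)
    (τ : Fin N → SingularSimplex (UniversalCover x₀) (k + 1)) :
    ∃ D : Finset (FundamentalGroup X x₀), ∀ w w' : FundamentalGroup X x₀ → Fin N → ℤ,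
      (∀ γ ∈ D, w γ = w' γ) → evalChain z τ w = evalChain z τ w' := by
  classical
  refine ⟨Finset.univ.image fun p : Fin N × Fin (k + 2) => deck (face p.2 (τ p.1)),
    fun w w' hw => ?_⟩
  refine congrArg (pushChain (proj x₀) k z + ·)
    (Finset.sum_congr rfl fun j _ => Finset.sum_congr rfl fun i _ => ?_)
  have h1 : w (deck (face i (τ j))) = w' (deck (face i (τ j))) :=
    hw _ (Finset.mem_image.2 ⟨(j, i), Finset.mem_univ _, rfl⟩)
  simp only [h1]

theorem stableIntegralVolume_le_lintegral [T1Space X] (hX : LocallySimple X) {m : ℕ}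
    (o : Orientation X (m + 1)) (hE : HasEMDStar (FundamentalGroup X x₀)) {N : ℕ}
    {z : Chain (UniversalCover x₀) (m + 1)}
    (hz : IsFundamentalCycle o (pushChain (proj x₀) (m + 1) z))
    (τ : Fin N → SingularSimplex (UniversalCover x₀) (m + 2)) {A : Type} [Fintype A] [Nonempty A]
    [MeasurableSpace A] [MeasurableSingletonClass A] (val : A → Fin N → ℤ) {S : Type v}
    [MeasurableSpace S] [MulAction (FundamentalGroup X x₀) S]
    [MeasurableConstSMul (FundamentalGroup X x₀) S] (μ : Measure S) [IsProbabilityMeasure μ]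
    [SMulInvariantMeasure (FundamentalGroup X x₀) S μ] {h : S → A} (hh : Measurable h) :
    stableIntegralVolume o ≤ ∫⁻ x, l1Norm (evalChain z τ fun γ => val (h (γ • x))) ∂μ := by
  obtain ⟨D, hD⟩ := evalChain_local z τ
  exact hE.le_lintegral (Φ := fun w => l1Norm (evalChain z τ fun γ => val (w γ)))
    (fun w w' hw => congrArg l1Norm (hD _ _ fun γ hγ => congrArg val (hw γ hγ)))
    (fun w => l1Norm_ne_top _)
    (fun F _ _ _ _ w => stableIntegralVolume_le hX o hz τ fun f => val (w f)) μ hh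

/-- Bounded integer-valued functions take values in a finite type. -/
theorem exists_finite_code {S : Type v} [MeasurableSpace S] {N : ℕ} {h : S → Fin N → ℤ}
    (hm : Measurable h) {B : ℕ} (hB : ∀ x j, |h x j| ≤ B) :
    ∃ (A : Type) (_ : Fintype A) (_ : Nonempty A) (_ : MeasurableSpace A)
      (_ : MeasurableSingletonClass A) (val : A → Fin N → ℤ) (h' : S → A),
      Measurable h' ∧ ∀ x, val (h' x) = h x :=
  ⟨Fin N → Finset.Icc (-(B : ℤ)) B, inferInstance, ⟨fun _ => ⟨0, by simp⟩⟩, inferInstance,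
    inferInstance, fun a j => a j, fun x j => ⟨h x j, Finset.mem_Icc.2 (abs_le.1 (hB x j))⟩,
    measurable_pi_iff.2 fun j => ((measurable_pi_apply j).comp hm).subtype_mk, fun _ => rfl⟩

/-- The stable integral simplicial volume is at most the parametrized volume of any measure
preserving action. -/
theorem stableIntegralVolume_le_parVolume [T1Space X] (hX : LocallySimple X) {m : ℕ}
    (o : Orientation X (m + 1)) (hE : HasEMDStar (FundamentalGroup X x₀)) {S : Type v}
    [MeasurableSpace S] [MulAction (FundamentalGroup X x₀) S]
    [MeasurableConstSMul (FundamentalGroup X x₀) S] (μ : Measure S) [IsProbabilityMeasure μ]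
    [SMulInvariantMeasure (FundamentalGroup X x₀) S μ] :
    stableIntegralVolume o ≤ parVolume o x₀ μ := by
  refine le_of_forall_gt fun r hr => ?_
  obtain ⟨N, z, τ, h, B, hz, hm, hB, hlt⟩ := exists_lintegral_lt hX o hr
  obtain ⟨A, _, _, _, _, val, h', hm', hval⟩ := exists_finite_code hm hB
  refine lt_of_le_of_lt ?_ hlt
  simp_rw [← hval]
  exact stableIntegralVolume_le_lintegral hX o hE hz τ val μ hm'

/-- For a base point, the fibre of a connected finite covering is a finite transitive `Γ`-set, and
every fundamental cycle of the covering has the norm of some data over it. Bounds over such sets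
therefore bound all coverings. -/
theorem le_stableIntegralVolume [T2Space X] [CompactSpace X] {m : ℕ}
    (hL : LocallyEuclidean X (m + 1)) (o : Orientation X (m + 1)) (x₀ : X) {r : ℝ≥0∞}
    (hr : ∀ (F : Type u) [Fintype F] [Nonempty F] [MulAction (FundamentalGroup X x₀) F]
      [MulAction.IsPretransitive (FundamentalGroup X x₀) F] (N : ℕ)
      (z : Chain (UniversalCover x₀) (m + 1))
      (τ : Fin N → SingularSimplex (UniversalCover x₀) (m + 2)) (w : F → Fin N → ℤ),
      IsFundamentalCycle o (pushChain (proj x₀) (m + 1) z) →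
      r ≤ (∑ f, l1Norm (evalChain z τ fun γ => w (γ • f))) / Fintype.card F) :
    r ≤ stableIntegralVolume o := by
  refine le_iInf fun Y => le_iInf fun _ => le_iInf fun _ => le_iInf fun q => le_iInf fun hq =>
    le_iInf fun d => le_iInf fun hd => le_iInf fun hcard => le_iInf fun o' => le_iInf fun ho' => ?_
  have hd0 : (d : ℝ≥0∞) ≠ 0 := Nat.cast_ne_zero.2 hd.ne'
  rw [ENNReal.le_div_iff_mul_le (Or.inl hd0) (Or.inl (ENNReal.natCast_ne_top d))]
  refine le_iInf₂ fun c hc => ?_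
  obtain ⟨F, _, _, _, _, N, z, τ, w, hF, hz, hsum⟩ :=
    exists_sum_evalChain_eq hL.locallySimple o hL x₀ hq hd hcard ho' hc
  have := hr F N z τ w hz
  rwa [hsum, hF, ENNReal.le_div_iff_mul_le (Or.inl hd0)
    (Or.inl (ENNReal.natCast_ne_top d))] at this

theorem parVolume_haar_le [T2Space X] [CompactSpace X] {m : ℕ}
    (hL : LocallyEuclidean X (m + 1)) (o : Orientation X (m + 1)) :
    parVolume o x₀ (ProfiniteCompletion.haar (FundamentalGroup X x₀)) ≤ stableIntegralVolume o := by
  refine le_stableIntegralVolume hL o x₀ fun F _ _ _ _ N z τ w hz => ?_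
  obtain ⟨π, hπ, he⟩ := ProfiniteCompletion.exists_equivariant_map
    (Γ := FundamentalGroup X x₀) (Classical.arbitrary F)
  exact parVolume_le_of_equivariant hL.locallySimple o hz τ w _ (fun f => (hπ f).measurableSet) he

theorem foliatedVolume_le [T2Space X] [CompactSpace X] {m : ℕ}
    (hL : LocallyEuclidean X (m + 1)) (o : Orientation X (m + 1)) :
    foliatedVolume o x₀ ≤ stableIntegralVolume o := by
  refine le_stableIntegralVolume hL o x₀ fun F _ _ _ _ N z τ w hz => ?_
  -- The infimum defining `|M|` runs over spaces in `Type`, so `F` is replaced by `Fin (Fintype.card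
  -- F)` with the transported action. Its uniform measure is invariant.
  let e : Fin (Fintype.card F) ≃ F := (Fintype.equivFin F).symm
  let _ : MulAction (FundamentalGroup X x₀) (Fin (Fintype.card F)) := e.mulAction _
  have _ : MeasurableConstSMul (FundamentalGroup X x₀) (Fin (Fintype.card F)) :=
    ⟨fun _ => measurable_of_finite _⟩
  have _ : Nonempty (Fin (Fintype.card F)) := e.nonempty
  let μ : Measure (Fin (Fintype.card F)) := ProbabilityTheory.uniformOn Set.univ
  have _ : IsProbabilityMeasure μ :=
    ProbabilityTheory.isProbabilityMeasure_uniformOn Set.finite_univ Set.univ_nonempty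
  have _ : SMulInvariantMeasure (FundamentalGroup X x₀) (Fin (Fintype.card F)) μ := by
    refine ⟨fun γ s _ => ?_⟩
    simp only [μ, ProbabilityTheory.uniformOn_univ]
    rw [Measure.count_apply (Set.toFinite _).measurableSet,
      Measure.count_apply (Set.toFinite _).measurableSet,
      Set.encard_preimage_of_bijective (MulAction.bijective γ)]
  have he : ∀ (γ : FundamentalGroup X x₀) s, e (γ • s) = γ • e s := fun γ s =>
    e.apply_symm_apply _
  refine le_trans ?_ (parVolume_le_of_equivariant hL.locallySimple o hz τ w μ
    (fun f => (Set.toFinite _).measurableSet) he)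
  refine iInf_le_of_le (Fin (Fintype.card F)) ?_
  refine iInf_le_of_le inferInstance ?_
  refine iInf_le_of_le inferInstance ?_
  refine iInf_le_of_le inferInstance ?_
  refine iInf_le_of_le inferInstance ?_
  refine iInf_le_of_le μ ?_
  exact iInf_le_of_le inferInstance (iInf_le_of_le inferInstance le_rfl)

end Comparison

/-- Connected manifolds of dimension zero are points. -/
theorem subsingleton_of_chartedSpace_zero (X : Type u) [TopologicalSpace X] [ConnectedSpace X]
    [ChartedSpace (EuclideanSpace ℝ (Fin 0)) X] : Subsingleton X := by
  have : DiscreteTopology X := by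
    refine discreteTopology_iff_isOpen_singleton.2 fun x => ?_
    have hs : (chartAt (EuclideanSpace ℝ (Fin 0)) x).source = {x} := by
      refine Set.eq_singleton_iff_unique_mem.2 ⟨mem_chart_source _ x, fun y hy => ?_⟩
      exact (chartAt (EuclideanSpace ℝ (Fin 0)) x).injOn hy (mem_chart_source _ x)
        (Subsingleton.elim _ _)
    rw [← hs]
    exact (chartAt (EuclideanSpace ℝ (Fin 0)) x).open_source
  exact PreconnectedSpace.trivial_of_discrete

end

end FoliatedVolume

/-! ### The corollary. -/

theorem corollary3p6 {M : Type u} [TopologicalSpace M] [T2Space M] [CompactSpace M]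
    [ConnectedSpace M] {n : ℕ} [ChartedSpace (EuclideanSpace ℝ (Fin n)) M]
    (o : FoliatedVolume.Orientation M n) (x₀ : M)
    (hEMD : FoliatedVolume.HasEMDStar (FundamentalGroup M x₀)) :
    (∀ (S : Type v) [MeasurableSpace S] [StandardBorelSpace S]
      [MulAction (FundamentalGroup M x₀) S] [MeasurableConstSMul (FundamentalGroup M x₀) S]
      (μ : MeasureTheory.Measure S) [MeasureTheory.IsProbabilityMeasure μ]
      [ErgodicSMul (FundamentalGroup M x₀) S μ],
      FoliatedVolume.parVolume o x₀ μ ≥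
        FoliatedVolume.parVolume o x₀
          (FoliatedVolume.ProfiniteCompletion.haar (FundamentalGroup M x₀))) ∧
    FoliatedVolume.parVolume o x₀
        (FoliatedVolume.ProfiniteCompletion.haar (FundamentalGroup M x₀)) =
      FoliatedVolume.stableIntegralVolume o ∧
    FoliatedVolume.foliatedVolume o x₀ = FoliatedVolume.stableIntegralVolume o := by
  have hlpc : LocallyPathConnectedSpace M :=
    ChartedSpace.locallyPathConnectedSpace (EuclideanSpace ℝ (Fin n)) M
  have hpc : PathConnectedSpace M := pathConnectedSpace_iff_connectedSpace.2 inferInstance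
  obtain _ | m := n
  -- In dimension zero the manifold is a point with trivial fundamental group, whereas EMD* requires
  -- an infinite one.
  · have hM := FoliatedVolume.subsingleton_of_chartedSpace_zero M
    have hsub : Subsingleton (FundamentalGroup M x₀) :=
      inferInstanceAs (Subsingleton (Path.Homotopic.Quotient x₀ x₀))
    exact absurd hEMD.1 (not_infinite_iff_finite.2 inferInstance)
  · have hL : FoliatedVolume.LocallyEuclidean M (m + 1) :=
      FoliatedVolume.LocallyEuclidean.of_chartedSpace
    have hle := FoliatedVolume.parVolume_haar_le (x₀ := x₀) hL o
    refine ⟨fun S _ _ _ _ μ _ _ => hle.trans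
      (FoliatedVolume.stableIntegralVolume_le_parVolume hL.locallySimple o hEMD μ),
      hle.antisymm (FoliatedVolume.stableIntegralVolume_le_parVolume hL.locallySimple o hEMD _),
      (FoliatedVolume.foliatedVolume_le hL o).antisymm ?_⟩
    exact le_iInf fun S => le_iInf fun _ => le_iInf fun _ => le_iInf fun _ => le_iInf fun _ =>
      le_iInf fun μ => le_iInf fun _ => le_iInf fun _ =>
        FoliatedVolume.stableIntegralVolume_le_parVolume hL.locallySimple o hEMD μ
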